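/- **Theorem (Nash–Moser).** *Scale.* Let $(X_s,\|\cdot\|_s)_{s\ge 0}$ be real Banach spaces with $X_{s'}\subseteq X_s$ and $\|u\|_s\le\|u\|_{s'}$ for $u \in X_{s'}$, $s\le s'$. Let $(E^{(N)})_{N\in\mathbb N}$ be a non-decreasing family of linear subspaces of $\bigcap_{s}X_s$ whose union is dense in every $X_s$, and let $\Pi^{(N)}:X_0\to E^{(N)}$ be linear projectors onto $E^{(N)}$ such that for all $s,\nu\ge 0$ there is $C=C(s,\nu)$ with, for all $N\ge 1$, - (P1) $\|\Pi^{(N)}u\|_{s+\nu}\le CN^{\nu}\|u\|_s$ for all $u\in X_s$; - (P2) $\|u-\Pi^{(N)}u\|_{s}\le CN^{-\nu}\|u\|_{s+\nu}$ for all $u\in X_{s+\nu}$. *The map.* Let $\mathcal I\subseteq\mathbb R$ be an interval with more than one point, $s_0\ge 0$, $\nu>0$, $\varepsilon'>0$, $S'\in(s_0,+\infty]$, and let $F:[0,\varepsilon')\times\mathcal I\times X_{s_0+\nu}\to X_{s_0}$ be of class $C^2$. Assume (F0) $F(0,\lambda,0)=0$ for all $\lambda\in\mathcal I$, and that for each $s\in[s_0,S')$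 there is a constant $C(s)$ such that for all $(\varepsilon,\lambda)\in[0,\varepsilon')\times\mathcal I$ and all $u,h,v\in X_{s+\nu}$ with $\|u\|_{s_0}\le 1$ the following elements lie in $X_s$ and satisfy - (F1) $\|\partial_\lambda F(\varepsilon,\lambda,u)\|_s\le C(s)(1+\|u\|_{s+\nu})$, and $\|\partial_\varepsilon F(\varepsilon,\lambda,0)\|_s\le C(s)$; - (F2) $\|D_uF(\varepsilon,\lambda,0)[h]\|_s\le C(s)\|h\|_{s+\nu}$; - (F3) $\|D_u^2F(\varepsilon,\lambda,u)[h,v]\|_s\le C(s)\big(\|u\|_{s+\nu}\|h\|_{s_0}\|v\|_{s_0}+\|h\|_{s+\nu}\|v\|_{s_0}+\|h\|_{s_0}\|v\|_{s+\nu}\big)$; - (F4) $\|\partial_\lambda D_uF(\varepsilon,\lambda,u)[h]\|_s\le C(s)(\|h\|_{s+\nu}+\|u\|_{s+\nu}\|h\|_{s_0})$. *Parameters.* Let $\tau>0$, $\delta\in(0,1/4)$, $s_1>s_0$, $S<S'$ and $\sigma$ satisfy, with $\mu:=\tau+\delta s_1$, $$\sigma\ge\max\{2\mu+3\nu+2,\;4(\mu+\nu)\},\qquad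 2(2\mu+\nu+3+\sigma)\le S-s_1\le 4(\sigma+1).$$ *Good sets.* For $u\in E^{(N)}$ put $L^{(N)}(\varepsilon,\lambda,u):=\Pi^{(N)}D_uF(\varepsilon,\lambda,u)|_{E^{(N)}}$. Fix constants $C_J(s)$, $s\in[s_1,S]$. Let $J^{(N)}_\varepsilon$ be the set of $(\lambda,u)\in\mathcal I\times E^{(N)}$ with $\|u\|_{s_1}\le 1$ such that $L^{(N)}(\varepsilon,\lambda,u):E^{(N)}\to E^{(N)}$ is invertible and, for all $s\in[s_1,S]$ and $h\in E^{(N)}$, $$\|L^{(N)}(\varepsilon,\lambda,u)^{-1}[h]\|_s\le C_J(s)N^{\mu}\big(\|h\|_s+N^{\delta(s-s_1)}\|u\|_s\|h\|_{s_1}\big).$$ For a function $u$ on $\mathcal I$ let $\mathtt G^{(N)}_\varepsilon(u):=\{\lambda\in\mathcal I:(\lambda,u(\lambda))\in J^{(N)}_\varepsilon\}$. For $N_0\in\mathbb N$ set $N_n:=N_0^{2^n}$, $E_n:=E^{(N_n)}$, $\Pi_n:=\Pi^{(N_n)}$. For a sequence $(u_n)_{n\ge 0}$, with $u_{-1}:=0$,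 set $A_n:=\bigcap_{i=0}^n\mathtt G^{(N_i)}_\varepsilon(u_{i-1})$ and $A_\infty:=\bigcap_{n\ge 0}A_n$. $\mathcal N(A,\eta)$ denotes the open $\eta$-neighbourhood of $A$ in $\mathcal I$. *Invariant subspaces.* For $\varepsilon_0\in(0,\varepsilon']$, a family of closed subspaces $\widehat X_s\subseteq X_s$ ($s\ge 0$) is called invariant if $F(\varepsilon,\lambda,\cdot)$ maps $\widehat X_{s+\nu}$ into $\widehat X_s$ for all $s\in[s_0,S')$, $(\varepsilon,\lambda)\in[0,\varepsilon_0)\times\mathcal I$, if $\widehat X_{s'}=\widehat X_s\cap X_{s'}$ for $s\le s'$, if $\Pi^{(N)}\widehat X_s\subseteq\widehat X_s$ for $N\ge1$, and if all $E^{(N)}\cap\widehat X_s$ are finite dimensional. *Conclusion.* There are $c>0$, $\overline N_0\ge 1$, $K_0>0$ such that for all integers $N_0\ge\overline N_0$ and all $\varepsilon_0\in(0,\varepsilon']$ with $\varepsilon_0N_0^{S}\le c$ there is, for each $\varepsilon\in[0,\varepsilon_0)$, a sequence $u_n=u_n(\varepsilon,\cdot)\in C^1(\mathcal I,X_{s_1+\nu})$,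 $n\ge0$, such that for all $n\ge0$ and $\lambda\in\mathcal I$: - (S1) $u_n(\varepsilon,\lambda),\partial_\lambda u_n(\varepsilon,\lambda)\in E_n$, $u_n(0,\lambda)=0$, $\|u_n\|_{s_1}\le 1$ and $\|\partial_\lambda u_n\|_{s_1}\le K_0N_0^{\sigma/2}$; - ($\widehat{\mathrm{S1}}$) $u_n(\varepsilon,\lambda)\in E_n\cap\widehat X_s$ for all $s\ge0$ and every invariant family $(\widehat X_s)$; - (S2) for $1\le i\le n$: $\|u_i-u_{i-1}\|_{s_1}\le N_i^{-\sigma-1}$ and $\|\partial_\lambda(u_i-u_{i-1})\|_{s_1}\le N_i^{-1-\nu}$; - (S3) if $\lambda\in\mathcal N(A_n,N_n^{-\sigma/2})$ then $\Pi_nF(\varepsilon,\lambda,u_n(\varepsilon,\lambda))=0$; - (S4) $1+\|u_n\|_S\le 2N_{n+1}^{p}$ with $p:=\mu+\frac\nu2+1$, and $\|\partial_\lambda u_n\|_S\le 2N_{n+1}^{q}$ with $q:=2\mu+\nu+2+\frac\sigma2$. Moreover, for each $\varepsilon\in[0,\varepsilon_0)$, $u_n(\varepsilon,\cdot)$ converges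 in $C^1(\mathcal I,X_{s_1+\nu})$, uniformly on $\mathcal I$ together with the first derivatives, to some $u_\varepsilon\in C^1(\mathcal I,X_{s_1+\nu})$, with $u_\varepsilon\equiv 0$ for $\varepsilon=0$ and $$\|u_\varepsilon(\lambda)-u_n(\varepsilon,\lambda)\|_{s_1}\le N_{n+1}^{-\sigma-1}\qquad\text{for all }\lambda\in\mathcal I,\ n\ge0 ;$$ $F(\varepsilon,\lambda,u_\varepsilon(\lambda))=0$ for all $\lambda\in A_\infty$; and $u_\varepsilon(\lambda)\in\widehat X_{s_1+\nu}$ for all $\lambda\in\mathcal I$ and every invariant family $(\widehat X_s)$. -/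

import Mathlib

open Set Filter Topology
open scoped NNReal ENNReal

noncomputable section

/-- A scale of (real) Banach spaces `(X_s, ‖·‖_s)`, `s ≥ 0`: a decreasing family of linear subspaces
of the vector space `V = X_0`, each one complete for its own norm, with `‖u‖_s ≤ ‖u‖_t` for
`s ≤ t`.  The value `nrm s u` has a meaning only for `u ∈ X_s`. -/
structure BanachScale (V : Type*) [AddCommGroup V] [Module ℝ V] where
  /-- the space `X_s` -/
  space : ℝ≥0 → Submodule ℝ V
  /-- the norm `‖·‖_s` -/
  nrm : ℝ≥0 → V → ℝ
  space_zero : space 0 = ⊤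
  nrm_smul : ∀ s (c : ℝ), ∀ u ∈ space s, nrm s (c • u) = |c| * nrm s u
  nrm_add_le : ∀ s, ∀ u ∈ space s, ∀ v ∈ space s, nrm s (u + v) ≤ nrm s u + nrm s v
  eq_zero_of_nrm : ∀ s, ∀ u ∈ space s, nrm s u = 0 → u = 0
  complete : ∀ s (x : ℕ → V), (∀ n, x n ∈ space s) →
    (∀ η > 0, ∃ k, ∀ m ≥ k, ∀ n ≥ k, nrm s (x m - x n) < η) →
    ∃ y ∈ space s, Tendsto (fun n => nrm s (x n - y)) atTop (𝓝 0)
  space_anti : ∀ s t, s ≤ t → space t ≤ space s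
  nrm_mono : ∀ s t, s ≤ t → ∀ u ∈ space t, nrm s u ≤ nrm t u

namespace BanachScale

variable {V : Type*} [AddCommGroup V] [Module ℝ V] (X : BanachScale V)

/-- The space `X_s` as a type; it carries the norm `‖·‖_s`. -/
def Sp (s : ℝ≥0) : Type _ := X.space s

/-- The element of `X_s` given by a vector which lies in `X_s`. -/
def toSp {s : ℝ≥0} (u : V) (hu : u ∈ X.space s) : X.Sp s := Subtype.mk u hu

theorem nrm_zero (s : ℝ≥0) : X.nrm s 0 = 0 := by
  have h := X.nrm_smul s 0 0 (X.space s).zero_mem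
  simpa using h

theorem nrm_nonneg (s : ℝ≥0) (u : V) (hu : u ∈ X.space s) : 0 ≤ X.nrm s u := by
  have h1 := X.nrm_add_le s u hu ((-1 : ℝ) • u) ((X.space s).smul_mem _ hu)
  rw [X.nrm_smul s (-1) u hu] at h1
  have h2 : u + (-1 : ℝ) • u = 0 := by simp
  rw [h2, X.nrm_zero] at h1
  norm_num at h1
  linarith

instance instCoeOutSp (s : ℝ≥0) : CoeOut (X.Sp s) V := ⟨fun u => u.1⟩

instance instAddCommGroupSp (s : ℝ≥0) : AddCommGroup (X.Sp s) :=
  inferInstanceAs (AddCommGroup (X.space s))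

instance instModuleSp (s : ℝ≥0) : Module ℝ (X.Sp s) :=
  inferInstanceAs (Module ℝ (X.space s))

instance instNormSp (s : ℝ≥0) : Norm (X.Sp s) := ⟨fun u => X.nrm s (u : V)⟩

theorem core (s : ℝ≥0) : NormedSpace.Core ℝ (X.Sp s) where
  norm_nonneg u := X.nrm_nonneg s u u.2
  norm_smul c u := X.nrm_smul s c u u.2
  norm_triangle u v := X.nrm_add_le s u u.2 v v.2
  norm_eq_zero_iff u := by
    constructor
    · intro h
      exact Subtype.ext (X.eq_zero_of_nrm s u u.2 h)
    · rintro rfl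
      exact X.nrm_zero s

instance instNormedAddCommGroupSp (s : ℝ≥0) : NormedAddCommGroup (X.Sp s) :=
  NormedAddCommGroup.ofCore (X.core s)

instance instNormedSpaceSp (s : ℝ≥0) : NormedSpace ℝ (X.Sp s) :=
  NormedSpace.ofCore (X.core s)

theorem norm_def (s : ℝ≥0) (u : X.Sp s) : ‖u‖ = X.nrm s (u : V) := rfl

instance instCompleteSpaceSp (s : ℝ≥0) : CompleteSpace (X.Sp s) := by
  refine Metric.complete_of_cauchySeq_tendsto fun x hx => ?_
  obtain ⟨y, hy, hlim⟩ := X.complete s (fun n => (x n : V)) (fun n => (x n).2) (by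
    intro η hη
    obtain ⟨k, hk⟩ := Metric.cauchySeq_iff.1 hx η hη
    refine ⟨k, fun m hm n hn => ?_⟩
    have h := hk m hm n hn
    rw [dist_eq_norm] at h
    exact h)
  refine ⟨X.toSp y hy, ?_⟩
  rw [tendsto_iff_norm_sub_tendsto_zero]
  exact hlim

/-- The inclusion `X_s ⊆ V`. -/
def val (s : ℝ≥0) : X.Sp s →ₗ[ℝ] V where
  toFun u := u
  map_add' _ _ := rfl
  map_smul' _ _ := rfl

/-- The inclusion in `X_s` of a subspace `W` of `V` which is contained in `X_s`. -/
def ofLE {W : Submodule ℝ V} {s : ℝ≥0} (h : W ≤ X.space s) : W →ₗ[ℝ] X.Sp s where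
  toFun u := X.toSp u (h u.2)
  map_add' _ _ := rfl
  map_smul' _ _ := rfl

/-- The inclusion `X_t ⊆ X_s` for `s ≤ t`. -/
def incl {s t : ℝ≥0} (h : s ≤ t) : X.Sp t →ₗ[ℝ] X.Sp s where
  toFun u := X.toSp u (X.space_anti s t h u.2)
  map_add' _ _ := rfl
  map_smul' _ _ := rfl

/-- A non-decreasing family of subspaces `E^(N)` of `⋂ X_s` with dense union in every `X_s`, and
linear projectors `Π^(N)` of `X_0` onto `E^(N)` which satisfy the smoothing properties
(P1) and (P2).  These are required for `N ≥ 1`. -/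
structure Smoothing where
  /-- the subspace `E^(N)` -/
  E : ℕ → Submodule ℝ V
  E_le : ∀ N s, E N ≤ X.space s
  E_mono : ∀ M N, M ≤ N → E M ≤ E N
  dense : ∀ s, ∀ u ∈ X.space s, ∀ η > 0, ∃ N, ∃ v ∈ E N, X.nrm s (u - v) < η
  /-- the projector `Π^(N)` -/
  proj : ℕ → V →ₗ[ℝ] V
  proj_mem : ∀ N u, proj N u ∈ E N
  proj_eq : ∀ N, ∀ u ∈ E N, proj N u = u
  P1 : ∀ s ν : ℝ≥0, ∃ C > 0, ∀ N : ℕ, 1 ≤ N → ∀ u ∈ X.space s,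
    X.nrm (s + ν) (proj N u) ≤ C * (N : ℝ) ^ (ν : ℝ) * X.nrm s u
  P2 : ∀ s ν : ℝ≥0, ∃ C > 0, ∀ N : ℕ, 1 ≤ N → ∀ u ∈ X.space (s + ν),
    X.nrm s (u - proj N u) ≤ C * (N : ℝ) ^ (-(ν : ℝ)) * X.nrm (s + ν) u

/-- A `C²` family of maps `F : [0, ε₀) × I × X_{s₀+ν} → X_{s₀}` with the tame properties
(F0)-(F4), for `s ∈ [s₀, S')`.  Here `∂_λ F = derivWithin (fun l => F ε l u) I lam`,
`D_u F = fderiv ℝ (F ε lam) u`; each bound includes that the element which it bounds lies in the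
space `X_s`.  The first bound is the one on `∂_ε F (ε, λ, 0)`. -/
structure IsTame {s₀ ν : ℝ≥0} (S' : ℝ≥0∞) (ε₀ : ℝ) (I : Set ℝ)
    (F : ℝ → ℝ → X.Sp (s₀ + ν) → X.Sp s₀) : Prop where
  contDiff : ContDiffOn ℝ 2
    (fun p : ℝ × ℝ × X.Sp (s₀ + ν) => F p.1 p.2.1 p.2.2) (Ico 0 ε₀ ×ˢ I ×ˢ univ)
  F0 : ∀ lam ∈ I, F 0 lam 0 = 0
  F1_eps : ∀ s : ℝ≥0, s₀ ≤ s → (s : ℝ≥0∞) < S' → ∃ C : ℝ, ∀ ε ∈ Ico 0 ε₀, ∀ lam ∈ I,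
    ((derivWithin (fun e => F e lam 0) (Ico 0 ε₀) ε : X.Sp s₀) : V) ∈ X.space s ∧
    X.nrm s (derivWithin (fun e => F e lam 0) (Ico 0 ε₀) ε : X.Sp s₀) ≤ C
  F1 : ∀ s : ℝ≥0, s₀ ≤ s → (s : ℝ≥0∞) < S' → ∃ C : ℝ, ∀ ε ∈ Ico 0 ε₀, ∀ lam ∈ I,
    ∀ u : X.Sp (s₀ + ν), (u : V) ∈ X.space (s + ν) → X.nrm s₀ u ≤ 1 →
    ((derivWithin (fun l => F ε l u) I lam : X.Sp s₀) : V) ∈ X.space s ∧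
    X.nrm s (derivWithin (fun l => F ε l u) I lam : X.Sp s₀) ≤ C * (1 + X.nrm (s + ν) u)
  F2 : ∀ s : ℝ≥0, s₀ ≤ s → (s : ℝ≥0∞) < S' → ∃ C : ℝ, ∀ ε ∈ Ico 0 ε₀, ∀ lam ∈ I,
    ∀ h : X.Sp (s₀ + ν), (h : V) ∈ X.space (s + ν) →
    ((fderiv ℝ (F ε lam) 0 h : X.Sp s₀) : V) ∈ X.space s ∧
    X.nrm s (fderiv ℝ (F ε lam) 0 h : X.Sp s₀) ≤ C * X.nrm (s + ν) h
  F3 : ∀ s : ℝ≥0, s₀ ≤ s → (s : ℝ≥0∞) < S' → ∃ C : ℝ, ∀ ε ∈ Ico 0 ε₀, ∀ lam ∈ I,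
    ∀ u h v : X.Sp (s₀ + ν), (u : V) ∈ X.space (s + ν) → (h : V) ∈ X.space (s + ν) →
    (v : V) ∈ X.space (s + ν) → X.nrm s₀ u ≤ 1 →
    ((fderiv ℝ (fun w => fderiv ℝ (F ε lam) w) u h v : X.Sp s₀) : V) ∈ X.space s ∧
    X.nrm s (fderiv ℝ (fun w => fderiv ℝ (F ε lam) w) u h v : X.Sp s₀) ≤
      C * (X.nrm (s + ν) u * X.nrm s₀ h * X.nrm s₀ v + X.nrm (s + ν) h * X.nrm s₀ v
        + X.nrm s₀ h * X.nrm (s + ν) v)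
  F4 : ∀ s : ℝ≥0, s₀ ≤ s → (s : ℝ≥0∞) < S' → ∃ C : ℝ, ∀ ε ∈ Ico 0 ε₀, ∀ lam ∈ I,
    ∀ u h : X.Sp (s₀ + ν), (u : V) ∈ X.space (s + ν) → (h : V) ∈ X.space (s + ν) →
    X.nrm s₀ u ≤ 1 →
    ((derivWithin (fun l => fderiv ℝ (F ε l) u h) I lam : X.Sp s₀) : V) ∈ X.space s ∧
    X.nrm s (derivWithin (fun l => fderiv ℝ (F ε l) u h) I lam : X.Sp s₀) ≤
      C * (X.nrm (s + ν) h + X.nrm (s + ν) u * X.nrm s₀ h)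

variable {X}

/-- The truncated linearised operator `L^(N)(ε, λ, u) = Π^(N) D_u F(ε, λ, u)|_{E^(N)}`,
for `u ∈ E^(N)`. -/
def linOp (P : X.Smoothing) {a b : ℝ≥0} (F : ℝ → ℝ → X.Sp a → X.Sp b) (N : ℕ) (ε lam : ℝ)
    (u : P.E N) : P.E N →ₗ[ℝ] P.E N :=
  (LinearMap.codRestrict (P.E N) (P.proj N) (P.proj_mem N)) ∘ₗ X.val b ∘ₗ
    (fderiv ℝ (F ε lam) (X.ofLE (P.E_le N a) u) : X.Sp a →ₗ[ℝ] X.Sp b) ∘ₗ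
    X.ofLE (P.E_le N a)

/-- The set `J^(N)_{τ,δ}` at the parameter `ε`: pairs `(λ, u) ∈ I × E^(N)` with `‖u‖_{s₁} ≤ 1` for
which `L^(N)(ε, λ, u)` is invertible and its inverse satisfies the tame bounds on `[s₁, S]`, with
the constants `C(s)`. -/
def tameSet (P : X.Smoothing) {a b : ℝ≥0} (F : ℝ → ℝ → X.Sp a → X.Sp b) (I : Set ℝ)
    (s₁ S : ℝ≥0) (τ δ : ℝ) (C : ℝ≥0 → ℝ) (N : ℕ) (ε : ℝ) : Set (ℝ × P.E N) :=
  {q | q.1 ∈ I ∧ X.nrm s₁ q.2 ≤ 1 ∧ ∃ L : P.E N ≃ₗ[ℝ] P.E N,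
    (L : P.E N →ₗ[ℝ] P.E N) = linOp P F N ε q.1 q.2 ∧
    ∀ s ∈ Icc s₁ S, ∀ h : P.E N,
      X.nrm s (L.symm h) ≤ C s * (N : ℝ) ^ (τ + δ * s₁) *
        (X.nrm s h + (N : ℝ) ^ (δ * ((s : ℝ) - s₁)) * X.nrm s q.2 * X.nrm s₁ h)}

/-- The set `G^(N)_{τ,δ}(u)` of the parameters `λ ∈ I` with `(λ, u(λ)) ∈ J^(N)_{τ,δ}`. -/
def goodSet (P : X.Smoothing) {a b : ℝ≥0} (F : ℝ → ℝ → X.Sp a → X.Sp b) (I : Set ℝ)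
    (s₁ S : ℝ≥0) (τ δ : ℝ) (C : ℝ≥0 → ℝ) (N : ℕ) (ε : ℝ) (u : ℝ → V) : Set ℝ :=
  {lam | lam ∈ I ∧ ∃ h : u lam ∈ P.E N, (lam, ⟨u lam, h⟩) ∈ tameSet P F I s₁ S τ δ C N ε}

/-- The index shift `n ↦ u_{n-1}`, with `u_{-1} = 0`. -/
def shift (u : ℕ → ℝ → V) : ℕ → ℝ → V
  | 0 => fun _ => 0
  | n + 1 => u n

/-- `A_n = ⋂_{i ≤ n} G^(N_i)_{τ,δ}(u_{i-1})`, where `N_i = N₀ ^ (2 ^ i)`. -/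
def setA (P : X.Smoothing) {a b : ℝ≥0} (F : ℝ → ℝ → X.Sp a → X.Sp b) (I : Set ℝ)
    (s₁ S : ℝ≥0) (τ δ : ℝ) (C : ℝ≥0 → ℝ) (N₀ : ℕ) (ε : ℝ) (u : ℕ → ℝ → V) (n : ℕ) : Set ℝ :=
  {lam | ∀ i ≤ n, lam ∈ goodSet P F I s₁ S τ δ C (N₀ ^ 2 ^ i) ε (shift u i)}

/-- A family of closed subspaces `Y_s` of `X_s`, `s ≥ 0`, which is invariant for `F` (that is,
`F(ε, λ, ·)` maps `Y_{s+ν}` to `Y_s`) and compatible with the scale and with the projectors: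
`Y_t = Y_s ∩ X_t` for `s ≤ t`, `Π^(N)` maps `Y_s` to itself for `N ≥ 1`, and the truncations
`E^(N) ∩ Y_s` are finite dimensional. -/
structure IsInvariant (P : X.Smoothing) {s₀ ν : ℝ≥0} (S' : ℝ≥0∞) (ε₀ : ℝ) (I : Set ℝ)
    (F : ℝ → ℝ → X.Sp (s₀ + ν) → X.Sp s₀) (Y : ℝ≥0 → Submodule ℝ V) : Prop where
  le : ∀ s, Y s ≤ X.space s
  closed : ∀ s, IsClosed {u : X.Sp s | (u : V) ∈ Y s}
  inter : ∀ s t, s ≤ t → Y t = Y s ⊓ X.space t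
  proj : ∀ N s, 1 ≤ N → ∀ u ∈ Y s, P.proj N u ∈ Y s
  finite : ∀ N s, FiniteDimensional ℝ (P.E N ⊓ Y s : Submodule ℝ V)
  map : ∀ s : ℝ≥0, s₀ ≤ s → (s : ℝ≥0∞) < S' → ∀ ε ∈ Ico 0 ε₀, ∀ lam ∈ I,
    ∀ u : X.Sp (s₀ + ν), (u : V) ∈ Y (s + ν) → ((F ε lam u : X.Sp s₀) : V) ∈ Y s

end BanachScale

end

/-! The approximate solutions are exact zeros of the truncated equations. If `M = N_n`, `N = M ^ 2`
and `Π^(M) F(u_n) = 0`, then `Π^(N) F(u_n) = Π^(N) (1 - Π^(M)) F(u_n)`, and (P2) bounds this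
residual in `‖·‖_{s₁}` by a constant times `M ^ (ν - (S - s₁)) * (ε + ‖u_n‖_S)`. The high norm may
grow like a fixed power of `N_{n+1}`; the gap `S - s₁` is so large that the residual still beats
this growth, the loss `N ^ μ` of the inverse and the loss `N ^ ν` of derivatives.

The next truncated equation is solved in the Banach space `E^(N)`, normed by `‖·‖_{s₁}`, with
`‖·‖_S` as a second norm `‖j ·‖` in which every estimate is affine (`TameFamily`, `TameInvertible`).
A contraction with the linearised operator frozen at `u_n` gives a zero in a small ball
(`exists_zero_of_tameInvertible`), and the tame structure bounds its high norm (`norm_map_zero_le`).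

Invertibility is known only at the good parameters `A`. It persists on the `2 * r`-neighbourhood of
`A`, with `r = N ^ (-σ / 2)`, because the operator varies little there (`TameInvertible.perturb`).
On this neighbourhood the correction is `C¹` by the implicit function theorem, and a cutoff of slope
`4 / r` extends it to `I`; the correction is so small that multiplication by `4 / r` is harmless.
All this is `exists_newton_step`. The iterates of the contraction start at `0` and stay in every
finite dimensional invariant subspace, hence so does the zero.

`IsStage` records what is propagated, `exists_stage_succ` propagates it, and
`eventually_step_numerics` checks the exponents. On `E^(N)` the norm `‖·‖_{s₁+ν}` costs a factor `N
^ ν` over `‖·‖_{s₁}`, which the decay of the corrections and of their derivatives pays for; so the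
sequence converges in `C¹(I, X_{s₁+ν})`. On `A_∞`, `F(u_n) = (1 - Π_n) F(u_n)` tends to `0` in
`X_{s₀}` like `N_n ^ (-(s₁ - s₀))` (`map_limit_eq_zero`). -/

/-! ### Calculus of one-parameter families of maps -/

section PartialDerivatives

variable {E G H : Type*} [NormedAddCommGroup E] [NormedSpace ℝ E]
  [NormedAddCommGroup G] [NormedSpace ℝ G] [NormedAddCommGroup H] [NormedSpace ℝ H]
  {I : Set ℝ} {Φ : ℝ → E → G} {t : ℝ}

theorem uniqueDiffOn_of_ordConnected (hI : I.OrdConnected) (hI' : I.Nontrivial) :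
    UniqueDiffOn ℝ I := by
  obtain ⟨x, hx, y, hy, hxy⟩ := hI'.exists_lt
  refine uniqueDiffOn_convex hI.convex ⟨(x + y) / 2, ?_⟩
  rw [mem_interior]
  exact ⟨Ioo x y, fun z hz => hI.out hx hy ⟨hz.1.le, hz.2.le⟩, isOpen_Ioo,
    ⟨by linarith, by linarith⟩⟩

theorem uniqueDiffOn_prod_univ (hI : UniqueDiffOn ℝ I) :
    UniqueDiffOn ℝ (I ×ˢ (univ : Set E)) := hI.prod uniqueDiffOn_univ

theorem hasFDerivWithinAt_uncurry {n : WithTop ℕ∞} (hn : n ≠ 0)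
    (hΦ : ContDiffOn ℝ n (fun p : ℝ × E => Φ p.1 p.2) (I ×ˢ univ)) (ht : t ∈ I) (u : E) :
    HasFDerivWithinAt (fun p : ℝ × E => Φ p.1 p.2)
      (fderivWithin ℝ (fun p : ℝ × E => Φ p.1 p.2) (I ×ˢ univ) (t, u)) (I ×ˢ univ) (t, u) :=
  ((hΦ.differentiableOn hn) (t, u) ⟨ht, mem_univ _⟩).hasFDerivWithinAt

theorem hasFDerivAt_slice {n : WithTop ℕ∞} (hn : n ≠ 0)
    (hΦ : ContDiffOn ℝ n (fun p : ℝ × E => Φ p.1 p.2) (I ×ˢ univ)) (ht : t ∈ I) (u : E) :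
    HasFDerivAt (Φ t) ((fderivWithin ℝ (fun p : ℝ × E => Φ p.1 p.2) (I ×ˢ univ) (t, u)).comp
      (ContinuousLinearMap.inr ℝ ℝ E)) u := by
  have h := hasFDerivWithinAt_uncurry hn hΦ ht u
  rw [← hasFDerivWithinAt_univ]
  refine HasFDerivWithinAt.comp (t := I ×ˢ univ) (f := fun v : E => (t, v)) u h ?_ ?_
  · exact (hasFDerivAt_prodMk_right t u).hasFDerivWithinAt
  · intro v _
    exact ⟨ht, mem_univ _⟩

theorem fderiv_slice {n : WithTop ℕ∞} (hn : n ≠ 0)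
    (hΦ : ContDiffOn ℝ n (fun p : ℝ × E => Φ p.1 p.2) (I ×ˢ univ)) (ht : t ∈ I) (u : E) :
    fderiv ℝ (Φ t) u = (fderivWithin ℝ (fun p : ℝ × E => Φ p.1 p.2) (I ×ˢ univ) (t, u)).comp
      (ContinuousLinearMap.inr ℝ ℝ E) := (hasFDerivAt_slice hn hΦ ht u).fderiv

theorem hasDerivWithinAt_slice {n : WithTop ℕ∞} (hn : n ≠ 0) (hI : UniqueDiffOn ℝ I)
    (hΦ : ContDiffOn ℝ n (fun p : ℝ × E => Φ p.1 p.2) (I ×ˢ univ)) (ht : t ∈ I) {w : ℝ → E}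
    {w' : E} (hw : HasDerivWithinAt w w' I t) :
    HasDerivWithinAt (fun l => Φ l (w l))
      (derivWithin (fun l => Φ l (w t)) I t + fderiv ℝ (Φ t) (w t) w') I t := by
  have key : ∀ {v : ℝ → E} {v' : E}, HasDerivWithinAt v v' I t → 
      HasDerivWithinAt (fun l => Φ l (v l))
      (fderivWithin ℝ (fun p : ℝ × E => Φ p.1 p.2) (I ×ˢ univ) (t, v t) (1, v')) I t := by
    intro v v' hv
    have h := hasFDerivWithinAt_uncurry hn hΦ ht (v t)
    have h2 : HasDerivWithinAt (fun l => (l, v l)) ((1 : ℝ), v') I t :=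
      (hasDerivWithinAt_id t I).prodMk hv
    exact HasFDerivWithinAt.comp_hasDerivWithinAt (t := I ×ˢ univ) t h h2
      (fun l hl => ⟨hl, mem_univ _⟩)
  have h1 := key hw
  have h0 := key (hasDerivWithinAt_const t I (w t))
  have h0' := h0.derivWithin (hI t ht)
  rw [h0', fderiv_slice hn hΦ ht]
  convert h1 using 1
  simp [← map_add]

theorem hasDerivWithinAt_fst {n : WithTop ℕ∞} (hn : n ≠ 0)
    (hΦ : ContDiffOn ℝ n (fun p : ℝ × E => Φ p.1 p.2) (I ×ˢ univ)) (ht : t ∈ I) (u : E) :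
    HasDerivWithinAt (fun l => Φ l u)
      (fderivWithin ℝ (fun p : ℝ × E => Φ p.1 p.2) (I ×ˢ univ) (t, u) (1, 0)) I t := by
  have h := hasFDerivWithinAt_uncurry hn hΦ ht u
  have h2 : HasDerivWithinAt (fun l => (l, u)) ((1 : ℝ), (0 : E)) I t :=
    (hasDerivWithinAt_id t I).prodMk (hasDerivWithinAt_const t I u)
  exact HasFDerivWithinAt.comp_hasDerivWithinAt (t := I ×ˢ univ) t h h2
    (fun l hl => ⟨hl, mem_univ _⟩)

theorem continuousOn_fderiv_slice {n : WithTop ℕ∞} (hn : 1 ≤ n) (hI : UniqueDiffOn ℝ I)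
    (hΦ : ContDiffOn ℝ n (fun p : ℝ × E => Φ p.1 p.2) (I ×ˢ univ)) :
    ContinuousOn (fun p : ℝ × E => fderiv ℝ (Φ p.1) p.2) (I ×ˢ univ) := by
  have hc := hΦ.continuousOn_fderivWithin (uniqueDiffOn_prod_univ hI) hn
  refine (hc.clm_comp (g := fun p => fderivWithin ℝ (fun p : ℝ × E => Φ p.1 p.2) (I ×ˢ univ) p)
    (f := fun _ => ContinuousLinearMap.inr ℝ ℝ E) continuousOn_const).congr ?_
  rintro ⟨l, v⟩ h
  exact fderiv_slice (by rintro rfl; simp at hn) hΦ h.1 v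

theorem continuousOn_derivWithin_slice {n : WithTop ℕ∞} (hn : 1 ≤ n) (hI : UniqueDiffOn ℝ I)
    (hΦ : ContDiffOn ℝ n (fun p : ℝ × E => Φ p.1 p.2) (I ×ˢ univ)) :
    ContinuousOn (fun p : ℝ × E => derivWithin (fun l => Φ l p.2) I p.1) (I ×ˢ univ) := by
  have hc := hΦ.continuousOn_fderivWithin (uniqueDiffOn_prod_univ hI) hn
  refine (hc.clm_apply (continuousOn_const (c := ((1 : ℝ), (0 : E))))).congr ?_
  rintro ⟨l, v⟩ h
  exact (hasDerivWithinAt_fst (by rintro rfl; simp at hn) hΦ h.1 v).derivWithin (hI l h.1)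

theorem contDiff_slice {n : WithTop ℕ∞}
    (hΦ : ContDiffOn ℝ n (fun p : ℝ × E => Φ p.1 p.2) (I ×ˢ univ)) (ht : t ∈ I) :
    ContDiff ℝ n (Φ t) := by
  rw [← contDiffOn_univ]
  exact hΦ.comp (f := fun v : E => (t, v)) (contDiff_prodMk_right t).contDiffOn
    (fun v _ => ⟨ht, mem_univ _⟩)

theorem differentiable_fderiv_slice
    (hΦ : ContDiffOn ℝ 2 (fun p : ℝ × E => Φ p.1 p.2) (I ×ˢ univ)) (ht : t ∈ I) :
    Differentiable ℝ (fun u => fderiv ℝ (Φ t) u) :=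
  ((contDiff_slice hΦ ht).fderiv_right (m := 1) (by norm_num)).differentiable (by norm_num)

theorem differentiableOn_fderiv_slice (hI : UniqueDiffOn ℝ I)
    (hΦ : ContDiffOn ℝ 2 (fun p : ℝ × E => Φ p.1 p.2) (I ×ˢ univ)) (u h : E) :
    DifferentiableOn ℝ (fun l => fderiv ℝ (Φ l) u h) I := by
  have hc := (hΦ.fderivWithin (m := 1) (uniqueDiffOn_prod_univ hI) (by norm_num)).differentiableOn
    (by norm_num)
  have hc' : DifferentiableOn ℝ (fun l => fderivWithin ℝ (fun p : ℝ × E => Φ p.1 p.2) (I ×ˢ univ)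
      (l, u)) I :=
    hc.comp (f := fun l => (l, u)) (by fun_prop) (fun l hl => ⟨hl, mem_univ _⟩)
  refine (hc'.clm_apply (differentiableOn_const ((0 : ℝ), h))).congr ?_
  intro l hl
  rw [fderiv_slice two_ne_zero hΦ hl]
  simp

/-! Mean value inequalities after composition with a continuous linear map. -/

/-- `F` is differentiable only as a map into `X_{s₀}`, while its derivatives are bounded in stronger
norms. A continuous `T` on `X_{s₀}`, such as a smoothing projector, turns these bounds into norm
bounds, so the mean value inequality is applied after `T`. -/
theorem norm_map_sub_sub_le_of_fderiv (T : G →L[ℝ] H) {f : E → G} (hf : Differentiable ℝ f)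
    (L : E →L[ℝ] G) (u h : E) {M : ℝ}
    (hM : ∀ s ∈ Icc (0 : ℝ) 1, ‖T (fderiv ℝ f (u + s • h) h - L h)‖ ≤ M) :
    ‖T (f (u + h) - f u - L h)‖ ≤ M := by
  have hd : ∀ s ∈ Icc (0 : ℝ) 1, HasDerivWithinAt (fun s : ℝ => T (f (u + s • h) - s • L h))
      (T (fderiv ℝ f (u + s • h) h - L h)) (Icc 0 1) s := by
    intro s _
    have h1 : HasDerivAt (fun s : ℝ => u + s • h) h s := by
      simpa using ((hasDerivAt_id s).smul_const h).const_add u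
    have h2 := ((hf (u + s • h)).hasFDerivAt).comp_hasDerivAt s h1
    have h3 : HasDerivAt (fun s : ℝ => s • L h) (L h) s := by
      simpa using (hasDerivAt_id s).smul_const (L h)
    exact (T.hasFDerivAt.comp_hasDerivAt s (h2.sub h3)).hasDerivWithinAt
  have := norm_image_sub_le_of_norm_deriv_le_segment_01' hd (fun s hs => hM s ⟨hs.1, hs.2.le⟩)
  simp only [one_smul, zero_smul, add_zero, sub_zero, ← map_sub] at this
  convert this using 3
  abel

theorem norm_map_sub_le_of_fderiv (T : G →L[ℝ] H) {f : E → G} (hf : Differentiable ℝ f)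
    (u h : E) {M : ℝ} (hM : ∀ s ∈ Icc (0 : ℝ) 1, ‖T (fderiv ℝ f (u + s • h) h)‖ ≤ M) :
    ‖T (f (u + h) - f u)‖ ≤ M := by
  have := norm_map_sub_sub_le_of_fderiv T hf 0 u h (M := M) (by simpa using hM)
  simpa using this

theorem norm_map_fderiv_sub_le (T : G →L[ℝ] H) {f : E → G}
    (hf : Differentiable ℝ (fun u => fderiv ℝ f u)) (u h v : E) {M : ℝ}
    (hM : ∀ s ∈ Icc (0 : ℝ) 1, ‖T (fderiv ℝ (fun w => fderiv ℝ f w) (u + s • h) h v)‖ ≤ M) :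
    ‖T (fderiv ℝ f (u + h) v - fderiv ℝ f u v)‖ ≤ M :=
  norm_map_sub_le_of_fderiv (T.comp (ContinuousLinearMap.apply ℝ G v)) hf u h hM

theorem norm_map_sub_le_of_derivWithin (T : G →L[ℝ] H) (hI : Convex ℝ I) {f : ℝ → G}
    (hf : DifferentiableOn ℝ f I) {M : ℝ} (hM : ∀ l ∈ I, ‖T (derivWithin f I l)‖ ≤ M)
    {a b : ℝ} (ha : a ∈ I) (hb : b ∈ I) : ‖T (f b - f a)‖ ≤ M * |b - a| := by
  rw [map_sub]
  refine hI.norm_image_sub_le_of_norm_hasDerivWithin_le (f := fun l => T (f l))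
    (f' := fun l => T (derivWithin f I l)) (fun l hl => ?_) hM ha hb
  exact T.hasFDerivAt.comp_hasDerivWithinAt l (hf l hl).hasDerivWithinAt

theorem norm_le_of_hasDerivWithinAt_of_lipschitz (hI : UniqueDiffOn ℝ I) {f : ℝ → H} {f' : H}
    (ht : t ∈ I) (hf : HasDerivWithinAt f f' I t) {M : ℝ}
    (hM : ∀ l ∈ I, ‖f l - f t‖ ≤ M * |l - t|) : ‖f'‖ ≤ M := by
  have h := hasDerivWithinAt_iff_tendsto_slope.1 hf
  have : (𝓝[I \ {t}] t).NeBot := by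
    have := (hI t ht).accPt
    rwa [accPt_principal_iff_nhdsWithin] at this
  refine le_of_tendsto h.norm ?_
  filter_upwards [self_mem_nhdsWithin] with l hl
  have hne : 0 < |l - t| := abs_pos.2 (sub_ne_zero.2 hl.2)
  rw [slope_def_module, norm_smul, norm_inv, Real.norm_eq_abs, inv_mul_le_iff₀ hne, mul_comm]
  exact hM l hl.1

/-- The bound at hand is on `∂_t D_u Φ`, not on `D_u ∂_t Φ`. Symmetry of the second derivative is
avoided: two mean value inequalities make `l ↦ T (Φ l (u + h) - Φ l u)` Lipschitz at `t` with
constant `M`, which then bounds its derivative. -/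
theorem norm_map_derivWithin_sub_le (T : G →L[ℝ] H) (hI : UniqueDiffOn ℝ I) (hIc : Convex ℝ I)
    (hΦ : ContDiffOn ℝ 2 (fun p : ℝ × E => Φ p.1 p.2) (I ×ˢ univ)) (ht : t ∈ I) (u h : E) {M : ℝ}
    (hM : ∀ l ∈ I, ∀ s ∈ Icc (0 : ℝ) 1,
      ‖T (derivWithin (fun l => fderiv ℝ (Φ l) (u + s • h) h) I l)‖ ≤ M) :
    ‖T (derivWithin (fun l => Φ l (u + h)) I t - derivWithin (fun l => Φ l u) I t)‖ ≤ M := by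
  have hd : ∀ v : E, HasDerivWithinAt (fun l => Φ l v) (derivWithin (fun l => Φ l v) I t) I t :=
    fun v => (hasDerivWithinAt_fst two_ne_zero hΦ ht v).differentiableWithinAt.hasDerivWithinAt
  refine norm_le_of_hasDerivWithinAt_of_lipschitz hI ht
    (T.hasFDerivAt.comp_hasDerivWithinAt t ((hd (u + h)).sub (hd u))) (fun l hl => ?_)
  have hdiff : ∀ l ∈ I, Differentiable ℝ (Φ l) :=
    fun l hl => (contDiff_slice hΦ hl).differentiable two_ne_zero
  have := norm_map_sub_le_of_fderiv T ((hdiff l hl).sub (hdiff t ht)) u h (M := M * |l - t|) ?_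
  · simp only [Function.comp_apply, Pi.sub_apply, ← map_sub] at this ⊢
    convert this using 3
    abel
  · intro s hs
    rw [fderiv_sub (hdiff l hl _) (hdiff t ht _)]
    exact norm_map_sub_le_of_derivWithin T hIc (differentiableOn_fderiv_slice hI hΦ _ h)
      (fun l hl => hM l hl s hs) ht hl

/-- The implicit function theorem relative to a set of parameters: a continuous solution of
`Φ t (u t) = 0` is differentiable where the partial derivative is invertible. -/
theorem hasDerivWithinAt_of_implicit [CompleteSpace E] {Φ : ℝ → E → E} (hI : UniqueDiffOn ℝ I)
    (hΦ : ContDiffOn ℝ 2 (fun p : ℝ × E => Φ p.1 p.2) (I ×ˢ univ)) (ht : t ∈ I) {u : ℝ → E}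
    (hu : ContinuousWithinAt u I t) (hz : ∀ᶠ l in 𝓝[I] t, Φ l (u l) = 0)
    (hL : IsUnit (fderiv ℝ (Φ t) (u t))) :
    HasDerivWithinAt u
      (- (Ring.inverse (fderiv ℝ (Φ t) (u t))) (derivWithin (fun l => Φ l (u t)) I t)) I t := by
  obtain ⟨L, hL⟩ := hL
  set a := derivWithin (fun l => Φ l (u t)) I t with ha
  set D := fderivWithin ℝ (fun p : ℝ × E => Φ p.1 p.2) (I ×ˢ univ) (t, u t) with hD
  have hDa : D (1, 0) = a :=
    ((hasDerivWithinAt_fst two_ne_zero hΦ ht (u t)).derivWithin (hI t ht)).symm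
  have hDL : ∀ v, D (0, v) = L.1 v := by
    intro v
    rw [hL, fderiv_slice two_ne_zero hΦ ht]
    simp [hD]
  let e : E ≃L[ℝ] E := ContinuousLinearEquiv.unitsEquiv ℝ E L
  let A : ℝ →L[ℝ] E := ContinuousLinearMap.toSpanSingleton ℝ a
  -- The derivative of `(l, v) ↦ (l, Φ l v)` is block triangular with invertible diagonal. This map
  -- is a left inverse, on `I × {0}`, of `(l, 0) ↦ (l, u l)`, which is continuous at `(t, 0)` within
  -- this set and therefore differentiable there. The derivatives are taken within `I`, so endpoints
  -- are allowed.
  let f' : (ℝ × E) ≃L[ℝ] (ℝ × E) := (ContinuousLinearEquiv.refl ℝ ℝ).skewProd e A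
  have hf' : HasFDerivWithinAt (fun p : ℝ × E => (p.1, Φ p.1 p.2)) (f' : ℝ × E →L[ℝ] ℝ × E)
      (I ×ˢ univ) (t, u t) := by
    have h1 := (hasFDerivWithinAt_fst (𝕜 := ℝ) (p := (t, u t)) (s := I ×ˢ univ)).prodMk
      (hasFDerivWithinAt_uncurry two_ne_zero hΦ ht (u t))
    rw [← hD] at h1
    have hfe : (f' : ℝ × E →L[ℝ] ℝ × E) = (ContinuousLinearMap.fst ℝ ℝ E).prod D := by
      refine ContinuousLinearMap.ext fun p => ?_
      have hp : D p = p.1 • a + L.1 p.2 := by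
        rw [← hDa, ← hDL, ← map_smul, ← map_add]
        simp
      refine Prod.ext rfl ?_
      change e p.2 + p.1 • a = D p
      rw [hp, add_comm]
      rfl
    rw [hfe]
    exact h1
  have hg : Tendsto (fun p : ℝ × E => (p.1, u p.1)) (𝓝[I ×ˢ {0}] (t, (0 : E)))
      (𝓝[I ×ˢ univ] (t, u t)) := by
    have h1 : Tendsto (Prod.fst : ℝ × E → ℝ) (𝓝[I ×ˢ {0}] (t, (0 : E))) (𝓝[I] t) := by
      rw [nhdsWithin_prod_eq]
      exact tendsto_fst
    rw [nhdsWithin_prod_eq t (u t) I univ, nhdsWithin_univ]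
    exact h1.prodMk (hu.tendsto.comp h1)
  have hz' : ∀ᶠ p : ℝ × E in 𝓝[I ×ˢ {0}] (t, (0 : E)), (p.1, Φ p.1 (u p.1)) = p := by
    have h1 : Tendsto (Prod.fst : ℝ × E → ℝ) (𝓝[I ×ˢ {0}] (t, (0 : E))) (𝓝[I] t) := by
      rw [nhdsWithin_prod_eq]
      exact tendsto_fst
    filter_upwards [h1.eventually hz, self_mem_nhdsWithin] with p hp hp2
    rw [hp]
    exact Prod.ext rfl hp2.2.symm
  have hmain := HasFDerivWithinAt.of_local_left_inverse (s := I ×ˢ {(0 : E)}) (t := I ×ˢ univ)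
    (g := fun p : ℝ × E => (p.1, u p.1)) (f := fun p : ℝ × E => (p.1, Φ p.1 p.2))
    (a := (t, (0 : E))) (f' := f') hg hf' ⟨ht, rfl⟩ hz'
  have h2 : HasDerivWithinAt (fun l : ℝ => (l, (0 : E))) ((1 : ℝ), (0 : E)) I t :=
    (hasDerivWithinAt_id t I).prodMk (hasDerivWithinAt_const t I _)
  have h3 := HasFDerivWithinAt.comp_hasDerivWithinAt (t := I ×ˢ {(0 : E)}) t hmain h2
    (fun l hl => ⟨hl, rfl⟩)
  have h4 := (ContinuousLinearMap.snd ℝ ℝ E).hasFDerivAt.comp_hasDerivWithinAt t h3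
  rw [← hL, Ring.inverse_unit]
  refine HasDerivWithinAt.congr_deriv (f := u) h4 ?_
  have hsymm : f'.symm (1, 0) = (1, - e.symm a) := by
    rw [ContinuousLinearEquiv.symm_apply_eq]
    refine Prod.ext rfl ?_
    change 0 = e (-e.symm a) + (1 : ℝ) • a
    simp
  change (f'.symm (1, 0)).2 = _
  rw [hsymm]
  rfl

end PartialDerivatives

/-! ### Tame estimates and tame inverses in one Banach space -/

section TameFamilies

variable {E G : Type*} [NormedAddCommGroup E] [NormedSpace ℝ E]
  [NormedAddCommGroup G] [NormedSpace ℝ G]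

/-- Tame bounds with constant `κ`, on the unit ball, for the partial derivatives of a family of
maps `Φ t : E → E`, measured by the seminorm `‖j ·‖`. -/
structure TameFamily (I : Set ℝ) (Φ : ℝ → E → E) (κ : ℝ) (j : E →L[ℝ] G) : Prop where
  param : ∀ t ∈ I, ∀ u, ‖u‖ ≤ 1 → ‖j (derivWithin (fun l => Φ l u) I t)‖ ≤ κ * (1 + ‖j u‖)
  fst : ∀ t ∈ I, ∀ u, ‖u‖ ≤ 1 → ∀ h, ‖j (fderiv ℝ (Φ t) u h)‖ ≤ κ * (‖j u‖ * ‖h‖ + ‖j h‖)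
  snd : ∀ t ∈ I, ∀ u, ‖u‖ ≤ 1 → ∀ h v,
    ‖j (fderiv ℝ (fun w => fderiv ℝ (Φ t) w) u h v)‖ ≤
      κ * (‖j u‖ * ‖h‖ * ‖v‖ + ‖j h‖ * ‖v‖ + ‖h‖ * ‖j v‖)
  mixed : ∀ t ∈ I, ∀ u, ‖u‖ ≤ 1 → ∀ h,
    ‖j (derivWithin (fun l => fderiv ℝ (Φ l) u h) I t)‖ ≤ κ * (‖j h‖ + ‖j u‖ * ‖h‖)

/-- An invertible operator whose inverse is bounded by `α` and satisfies a tame bound for the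
seminorm `‖j ·‖`. -/
def TameInvertible (L : E →L[ℝ] E) (j : E →L[ℝ] G) (α β : ℝ) : Prop :=
  IsUnit L ∧ ∀ g, ‖g‖ ≤ α * ‖L g‖ ∧ ‖j g‖ ≤ α * (‖j (L g)‖ + β * ‖L g‖)

/-- A Neumann series: `L' = L (1 + L⁻¹ (L' - L))` with `‖L⁻¹ (L' - L)‖ ≤ α * η₁ ≤ 1 / 2`. In both
estimates the term with `α * η₁` is absorbed on the left, which doubles `α`; the low norm bound on
`g` is then inserted in the high norm estimate, which produces `2 * α * η₂`. -/
theorem TameInvertible.perturb [CompleteSpace E] {L L' : E →L[ℝ] E} {j : E →L[ℝ] G}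
    {α β η₁ η₂ : ℝ} (hL : TameInvertible L j α β) (hα : 0 < α) (hβ : 0 ≤ β)
    (hη₁ : 0 ≤ η₁) (hη₂ : 0 ≤ η₂)
    (hα₁ : 2 * (α * η₁) ≤ 1) (h₁ : ∀ f, ‖(L' - L) f‖ ≤ η₁ * ‖f‖)
    (h₂ : ∀ f, ‖j ((L' - L) f)‖ ≤ η₁ * ‖j f‖ + η₂ * ‖f‖) :
    TameInvertible L' j (2 * α) (2 * β + 2 * α * η₂) := by
  obtain ⟨⟨U, rfl⟩, hU⟩ := hL
  have hLL : ∀ f, U.1 f = L' f - (L' - U.1) f := by intro f; simp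
  constructor
  · have hinv : ‖(U⁻¹).1‖ ≤ α := by
      refine ContinuousLinearMap.opNorm_le_bound _ hα.le fun g => ?_
      have := (hU ((U⁻¹).1 g)).1
      have e : U.1 ((U⁻¹).1 g) = g := by
        rw [← mul_apply_eq_comp, Units.mul_inv]; rfl
      rwa [e] at this
    have hd : ‖(U⁻¹).1 * (L' - U.1)‖ < 1 := by
      calc ‖(U⁻¹).1 * (L' - U.1)‖ ≤ ‖(U⁻¹).1‖ * ‖L' - U.1‖ := norm_mul_le _ _
        _ ≤ α * η₁ := mul_le_mul hinv (ContinuousLinearMap.opNorm_le_bound _ hη₁ h₁)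
            (norm_nonneg _) hα.le
        _ < 1 := by linarith
    have h1 : IsUnit (1 + (U⁻¹).1 * (L' - U.1)) := by
      have := (Units.oneSub (-((U⁻¹).1 * (L' - U.1))) (by rwa [norm_neg])).isUnit
      simpa using this
    have h2 : L' = U.1 * (1 + (U⁻¹).1 * (L' - U.1)) := by
      rw [mul_add, ← mul_assoc, Units.mul_inv]
      simp
    rw [h2]
    exact U.isUnit.mul h1
  · intro g
    obtain ⟨ha, hb⟩ := hU g
    have n1 : ‖U.1 g‖ ≤ ‖L' g‖ + η₁ * ‖g‖ := by
      rw [hLL g]; exact (norm_sub_le _ _).trans (by gcongr; exact h₁ g)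
    have n2 : ‖j (U.1 g)‖ ≤ ‖j (L' g)‖ + (η₁ * ‖j g‖ + η₂ * ‖g‖) := by
      rw [hLL g, map_sub]; exact (norm_sub_le _ _).trans (by gcongr; exact h₂ g)
    have g1 : ‖g‖ ≤ 2 * α * ‖L' g‖ := by
      have := mul_le_mul_of_nonneg_left n1 hα.le
      nlinarith [norm_nonneg g]
    refine ⟨g1, ?_⟩
    have k1 : ‖U.1 g‖ ≤ 2 * ‖L' g‖ := by
      have := mul_le_mul_of_nonneg_left g1 hη₁
      nlinarith [norm_nonneg (L' g)]
    have k2 : η₂ * ‖g‖ ≤ η₂ * (2 * α * ‖L' g‖) := mul_le_mul_of_nonneg_left g1 hη₂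
    have k3 : α * (‖j (U.1 g)‖ + β * ‖U.1 g‖) ≤
        α * (‖j (L' g)‖ + (η₁ * ‖j g‖ + η₂ * (2 * α * ‖L' g‖)) + β * (2 * ‖L' g‖)) := by
      gcongr
      linarith
    nlinarith [norm_nonneg (j g)]

variable {I : Set ℝ} {Φ : ℝ → E → E} {κ : ℝ} {j : E →L[ℝ] G} {t : ℝ}

theorem norm_map_add_smul_le (T : E →L[ℝ] G) {u h : E} {b s : ℝ} (hu : ‖T u‖ ≤ b)
    (hh : ‖T (u + h)‖ ≤ b) (hs : s ∈ Icc (0 : ℝ) 1) : ‖T (u + s • h)‖ ≤ b := by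
  have e : u + s • h = (1 - s) • u + s • (u + h) := by module
  rw [e, map_add, map_smul, map_smul]
  refine (norm_add_le _ _).trans ?_
  rw [norm_smul, norm_smul, Real.norm_of_nonneg hs.1, Real.norm_of_nonneg (by linarith [hs.2])]
  nlinarith [hs.1, hs.2]

theorem norm_add_smul_le {u h : E} {b s : ℝ} (hu : ‖u‖ ≤ b)
    (hh : ‖u + h‖ ≤ b) (hs : s ∈ Icc (0 : ℝ) 1) : ‖u + s • h‖ ≤ b :=
  norm_map_add_smul_le (ContinuousLinearMap.id ℝ E) hu hh hs

namespace TameFamily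

theorem fderiv_sub_le (hT : TameFamily I Φ κ j) (hκ : 0 ≤ κ)
    (hΦ : ContDiffOn ℝ 2 (fun p : ℝ × E => Φ p.1 p.2) (I ×ˢ univ)) (ht : t ∈ I) {u h : E} {b : ℝ}
    (hu : ‖u‖ ≤ 1) (huh : ‖u + h‖ ≤ 1) (hb : ‖j u‖ ≤ b) (hb' : ‖j (u + h)‖ ≤ b) (f : E) :
    ‖j (fderiv ℝ (Φ t) (u + h) f - fderiv ℝ (Φ t) u f)‖ ≤
      κ * (b * ‖h‖ * ‖f‖ + ‖j h‖ * ‖f‖ + ‖h‖ * ‖j f‖) := by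
  refine norm_map_fderiv_sub_le j (differentiable_fderiv_slice hΦ ht) u h f fun s hs => ?_
  refine (hT.snd t ht _ (norm_add_smul_le hu huh hs) h f).trans ?_
  gcongr
  exact norm_map_add_smul_le j hb hb' hs

theorem fderiv_sub_param_le (hT : TameFamily I Φ κ j) (hI : UniqueDiffOn ℝ I)
    (hIc : Convex ℝ I) (hΦ : ContDiffOn ℝ 2 (fun p : ℝ × E => Φ p.1 p.2) (I ×ˢ univ)) {t' : ℝ}
    (ht : t ∈ I) (ht' : t' ∈ I) {u : E} (hu : ‖u‖ ≤ 1) (f : E) :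
    ‖j (fderiv ℝ (Φ t) u f - fderiv ℝ (Φ t') u f)‖ ≤
      κ * (‖j f‖ + ‖j u‖ * ‖f‖) * |t - t'| :=
  norm_map_sub_le_of_derivWithin j hIc (differentiableOn_fderiv_slice hI hΦ u f)
    (fun l hl => hT.mixed l hl u hu f) ht' ht

theorem derivWithin_sub_le (hT : TameFamily I Φ κ j) (hκ : 0 ≤ κ) (hI : UniqueDiffOn ℝ I)
    (hIc : Convex ℝ I) (hΦ : ContDiffOn ℝ 2 (fun p : ℝ × E => Φ p.1 p.2) (I ×ˢ univ))
    (ht : t ∈ I) {u h : E} {b : ℝ} (hu : ‖u‖ ≤ 1) (huh : ‖u + h‖ ≤ 1) (hb : ‖j u‖ ≤ b)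
    (hb' : ‖j (u + h)‖ ≤ b) :
    ‖j (derivWithin (fun l => Φ l (u + h)) I t - derivWithin (fun l => Φ l u) I t)‖ ≤
      κ * (‖j h‖ + b * ‖h‖) := by
  refine norm_map_derivWithin_sub_le j hI hIc hΦ ht u h fun l hl s hs => ?_
  refine (hT.mixed l hl _ (norm_add_smul_le hu huh hs) h).trans ?_
  gcongr
  exact norm_map_add_smul_le j hb hb' hs

theorem remainder_le (hT : TameFamily I Φ κ j) (hκ : 0 ≤ κ)
    (hΦ : ContDiffOn ℝ 2 (fun p : ℝ × E => Φ p.1 p.2) (I ×ˢ univ)) (ht : t ∈ I) {u h : E} {b : ℝ}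
    (hu : ‖u‖ ≤ 1) (huh : ‖u + h‖ ≤ 1) (hb : ‖j u‖ ≤ b) (hb' : ‖j (u + h)‖ ≤ b) :
    ‖j (Φ t (u + h) - Φ t u - fderiv ℝ (Φ t) u h)‖ ≤ κ * (b * ‖h‖ ^ 2 + 2 * ‖j h‖ * ‖h‖) := by
  have hb0 : 0 ≤ b := (norm_nonneg _).trans hb
  refine norm_map_sub_sub_le_of_fderiv j ((contDiff_slice hΦ ht).differentiable two_ne_zero) _ u h
    fun s hs => ?_
  refine (hT.fderiv_sub_le hκ hΦ ht hu (norm_add_smul_le hu huh hs) hb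
    (norm_map_add_smul_le j hb hb' hs) h).trans ?_
  have e1 : ‖s • h‖ ≤ ‖h‖ := by
    rw [norm_smul, Real.norm_of_nonneg hs.1]
    exact mul_le_of_le_one_left (norm_nonneg _) hs.2
  have e2 : ‖j (s • h)‖ ≤ ‖j h‖ := by
    rw [map_smul, norm_smul, Real.norm_of_nonneg hs.1]
    exact mul_le_of_le_one_left (norm_nonneg _) hs.2
  have : κ * (b * ‖s • h‖ * ‖h‖ + ‖j (s • h)‖ * ‖h‖ + ‖s • h‖ * ‖j h‖) ≤
    κ * (b * ‖h‖ * ‖h‖ + ‖j h‖ * ‖h‖ + ‖h‖ * ‖j h‖) := by gcongr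
  refine this.trans (le_of_eq ?_)
  ring

/-- With `j` the identity, the three terms of `TameFamily.snd` contribute `κ * ρ * ‖f‖` each on the
unit ball. -/
theorem norm_fderiv_sub_le (hT : TameFamily I Φ κ (ContinuousLinearMap.id ℝ E)) (hκ : 0 ≤ κ)
    (hΦ : ContDiffOn ℝ 2 (fun p : ℝ × E => Φ p.1 p.2) (I ×ˢ univ)) (ht : t ∈ I) {u h : E} {ρ : ℝ}
    (hu : ‖u‖ ≤ 1 - ρ) (hh : ‖h‖ ≤ ρ) (f : E) :
    ‖fderiv ℝ (Φ t) (u + h) f - fderiv ℝ (Φ t) u f‖ ≤ 3 * (κ * ρ) * ‖f‖ := by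
  have hρ := (norm_nonneg h).trans hh
  have huh : ‖u + h‖ ≤ 1 := (norm_add_le u h).trans (by linarith)
  have := hT.fderiv_sub_le hκ hΦ ht (u := u) (h := h) (b := 1) (by linarith) huh
    (by simpa using by linarith) (by simpa using huh) f
  simp only [ContinuousLinearMap.id_apply] at this
  refine this.trans ?_
  have : κ * (1 * ‖h‖ * ‖f‖ + ‖h‖ * ‖f‖ + ‖h‖ * ‖f‖) ≤
    κ * (1 * ρ * ‖f‖ + ρ * ‖f‖ + ρ * ‖f‖) := by gcongr
  refine this.trans (le_of_eq ?_)
  ring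

theorem contraction (hT : TameFamily I Φ κ (ContinuousLinearMap.id ℝ E)) (hκ : 0 ≤ κ)
    (hΦ : ContDiffOn ℝ 2 (fun p : ℝ × E => Φ p.1 p.2) (I ×ˢ univ)) (ht : t ∈ I) {w h k : E} {ρ : ℝ}
    (hw : ‖w‖ ≤ 1 - ρ) (hh : ‖h‖ ≤ ρ) (hk : ‖k‖ ≤ ρ) :
    ‖Φ t (w + h) - Φ t (w + k) - fderiv ℝ (Φ t) w (h - k)‖ ≤ 3 * (κ * ρ) * ‖h - k‖ := by
  have := norm_map_sub_sub_le_of_fderiv (ContinuousLinearMap.id ℝ E)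
    ((contDiff_slice hΦ ht).differentiable two_ne_zero) (fderiv ℝ (Φ t) w) (w + k) (h - k)
    (M := 3 * (κ * ρ) * ‖h - k‖) ?_
  · simpa [add_assoc] using this
  · intro s hs
    rw [add_assoc]
    refine hT.norm_fderiv_sub_le hκ hΦ ht hw ?_ (h - k)
    exact norm_add_smul_le hk (by simpa using hh) hs

end TameFamily

theorem fderiv_mem_of_forall_mem {f : E → E} {u h : E} (hf : DifferentiableAt ℝ f u)
    {Y : Submodule ℝ E} (hY : IsClosed (Y : Set E)) (hmap : ∀ v ∈ Y, f v ∈ Y) (hu : u ∈ Y)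
    (hh : h ∈ Y) : fderiv ℝ f u h ∈ Y := by
  have hl : HasDerivAt (fun s : ℝ => u + s • h) h 0 := by
    simpa using ((hasDerivAt_id (0 : ℝ)).smul_const h).const_add u
  have h1 : HasDerivAt (fun s : ℝ => f (u + s • h)) (fderiv ℝ f u h) 0 := by
    have hf' : HasFDerivAt f (fderiv ℝ f u) (u + (0 : ℝ) • h) := by simpa using hf.hasFDerivAt
    exact hf'.comp_hasDerivAt (0 : ℝ) hl
  have h2 := h1.tendsto_slope
  refine hY.mem_of_tendsto h2 (Eventually.of_forall fun s => ?_)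
  rw [slope_def_module]
  exact Y.smul_mem _ (Y.sub_mem (hmap _ (Y.add_mem hu (Y.smul_mem _ hh)))
    (hmap _ (Y.add_mem hu (Y.smul_mem _ hh))))

/-- An injective endomorphism of a finite dimensional space is onto, so `U` maps `Y` onto `Y`. This
is where finite dimension of the invariant subspaces enters. -/
theorem inverse_mem_of_forall_mem (U : (E →L[ℝ] E)ˣ) {Y : Submodule ℝ E} [FiniteDimensional ℝ Y]
    (hmap : ∀ v ∈ Y, U.1 v ∈ Y) {v : E} (hv : v ∈ Y) : (U⁻¹).1 v ∈ Y := by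
  have hinv : ∀ x, (U⁻¹).1 (U.1 x) = x := fun x => by
    rw [← mul_apply_eq_comp, Units.inv_mul]; rfl
  let A : Y →ₗ[ℝ] Y := (U.1 : E →ₗ[ℝ] E).restrict hmap
  have hinj : Function.Injective A := by
    intro x y hxy
    have h1 : U.1 x = U.1 y := congrArg Subtype.val hxy
    apply Subtype.ext
    rw [← hinv x, h1, hinv]
  obtain ⟨y, hy⟩ := LinearMap.injective_iff_surjective.1 hinj ⟨v, hv⟩
  have h2 : U.1 y = v := congrArg Subtype.val hy
  rw [← h2, hinv]
  exact y.2

/-- The simplified Newton map `h ↦ h - L⁻¹ Φ t (w + h)`, with `L` the derivative at `w`, has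
Lipschitz constant `3 * α * κ * ρ ≤ 1 / 2` on the `ρ`-ball and moves `0` by at most `α * r₁ = ρ /
2`. The estimate for all `k` in the ball gives uniqueness there, and later the continuity of the
zero in the parameter. -/
theorem exists_zero_of_tameInvertible [CompleteSpace E]
    (hT : TameFamily I Φ κ (ContinuousLinearMap.id ℝ E)) (hκ : 0 ≤ κ)
    (hΦ : ContDiffOn ℝ 2 (fun p : ℝ × E => Φ p.1 p.2) (I ×ˢ univ)) (ht : t ∈ I) {w : E}
    {ρ α β r₁ : ℝ} (hw : ‖w‖ ≤ 1 - ρ) (hα : 0 < α)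
    (hL : TameInvertible (fderiv ℝ (Φ t) w) j α β)
    (hr : ‖Φ t w‖ ≤ r₁) (hρ : ρ = 2 * α * r₁) (hs : 6 * (α * κ * ρ) ≤ 1) :
    ∃ h, ‖h‖ ≤ ρ ∧ Φ t (w + h) = 0 ∧
      (∀ k, ‖k‖ ≤ ρ → ‖k - h‖ ≤ 2 * α * ‖Φ t (w + k)‖) ∧
      ∀ Y : Submodule ℝ E, FiniteDimensional ℝ Y → (∀ v ∈ Y, Φ t v ∈ Y) → w ∈ Y → h ∈ Y := by
  obtain ⟨⟨U, hU⟩, hb⟩ := hL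
  have hr0 : 0 ≤ r₁ := (norm_nonneg _).trans hr
  have hρ0 : 0 ≤ ρ := by rw [hρ]; positivity
  have hinv : ∀ g, ‖(U⁻¹).1 g‖ ≤ α * ‖g‖ := by
    intro g
    have := (hb ((U⁻¹).1 g)).1
    have e : U.1 ((U⁻¹).1 g) = g := by
      rw [← mul_apply_eq_comp, Units.mul_inv]; rfl
    rwa [← hU, e] at this
  have hUU : ∀ x, (U⁻¹).1 (U.1 x) = x := fun x => by
    rw [← mul_apply_eq_comp, Units.inv_mul]; rfl
  set T : E → E := fun h => h - (U⁻¹).1 (Φ t (w + h)) with hTdef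
  have hcon : ∀ h k, ‖h‖ ≤ ρ → ‖k‖ ≤ ρ → ‖T h - T k‖ ≤ 1 / 2 * ‖h - k‖ := by
    intro h k hh hk
    have e : T h - T k =
        - (U⁻¹).1 (Φ t (w + h) - Φ t (w + k) - fderiv ℝ (Φ t) w (h - k)) := by
      rw [← hU, map_sub, hUU, map_sub]
      simp only [hTdef]
      abel
    rw [e, norm_neg]
    refine (hinv _).trans ?_
    have := mul_le_mul_of_nonneg_left (hT.contraction hκ hΦ ht hw hh hk) hα.le
    nlinarith [norm_nonneg (h - k)]
  have hT0 : ‖T 0‖ ≤ ρ / 2 := by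
    simp only [hTdef, add_zero, zero_sub, norm_neg]
    refine (hinv _).trans ?_
    rw [hρ]
    nlinarith
  have hmaps : MapsTo T (Metric.closedBall 0 ρ) (Metric.closedBall 0 ρ) := by
    intro h hh
    rw [mem_closedBall_zero_iff] at hh ⊢
    have h1 := hcon h 0 hh (by simpa using hρ0)
    have h2 : ‖T h‖ ≤ ‖T h - T 0‖ + ‖T 0‖ := by simpa using norm_add_le (T h - T 0) (T 0)
    rw [sub_zero] at h1
    linarith
  have hcw : ContractingWith (1 / 2 : ℝ≥0) (hmaps.restrict T _ _) := by
    refine ⟨by rw [div_lt_one (by norm_num)]; norm_num, LipschitzWith.of_dist_le_mul ?_⟩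
    rintro ⟨h, hh⟩ ⟨k, hk⟩
    rw [mem_closedBall_zero_iff] at hh hk
    have := hcon h k hh hk
    rw [Subtype.dist_eq, Subtype.dist_eq, dist_eq_norm, dist_eq_norm]
    simpa using this
  obtain ⟨h, hhB, hfix, hlim, -⟩ := hcw.exists_fixedPoint' Metric.isClosed_closedBall.isComplete
    hmaps (x := 0) (by simpa using hρ0) (edist_ne_top _ _)
  rw [mem_closedBall_zero_iff] at hhB
  have hzero : Φ t (w + h) = 0 := by
    have h1 : (U⁻¹).1 (Φ t (w + h)) = 0 := by
      have : T h = h := hfix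
      simpa [hTdef] using this
    have e : U.1 ((U⁻¹).1 (Φ t (w + h))) = Φ t (w + h) := by
      rw [← mul_apply_eq_comp, Units.mul_inv]; rfl
    rw [← e, h1, map_zero]
  refine ⟨h, hhB, hzero, ?_, ?_⟩
  · intro k hk
    have h1 := hcon k h hk hhB
    have h2 : T h = h := hfix
    have h3 : k - h = (T k - T h) + (U⁻¹).1 (Φ t (w + k)) := by
      rw [h2]; simp only [hTdef]; abel
    have h4 : ‖k - h‖ ≤ ‖T k - T h‖ + α * ‖Φ t (w + k)‖ := by
      conv_lhs => rw [h3]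
      exact (norm_add_le _ _).trans (by gcongr; exact hinv _)
    linarith
  · intro Y hYf hYm hYw
    have hYc : IsClosed (Y : Set E) := Y.closed_of_finiteDimensional
    refine hYc.mem_of_tendsto hlim (Eventually.of_forall fun n => ?_)
    induction n with
    | zero => exact Y.zero_mem
    | succ n ih =>
      rw [Function.iterate_succ_apply']
      refine Y.sub_mem ih (inverse_mem_of_forall_mem U ?_ (hYm _ (Y.add_mem hYw ih)))
      intro v hv
      rw [hU]
      exact fderiv_mem_of_forall_mem
        ((contDiff_slice hΦ ht).differentiable two_ne_zero w) hYc hYm hYw hv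

/-- The tame inverse is applied to `L h = -Φ t w - R`, with `R` the quadratic remainder. The part of
`‖j R‖` proportional to `‖j h‖` carries a factor `3 * κ * ρ`, and `3 * α * κ * ρ ≤ 1 / 2` lets it be
absorbed; in the low norm `R` is no larger than the residual `r₁`. So the high norm of the zero is
controlled without any smallness in that norm. -/
theorem norm_map_zero_le [CompleteSpace E] (hT : TameFamily I Φ κ j)
    (hT₁ : TameFamily I Φ κ (ContinuousLinearMap.id ℝ E)) (hκ : 0 ≤ κ)
    (hΦ : ContDiffOn ℝ 2 (fun p : ℝ × E => Φ p.1 p.2) (I ×ˢ univ)) (ht : t ∈ I) {w h : E}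
    {ρ α β r₁ rS B : ℝ} (hw : ‖w‖ ≤ 1 - ρ) (hB : ‖j w‖ ≤ B) (hα : 0 < α) (hβ : 0 ≤ β)
    (hL : TameInvertible (fderiv ℝ (Φ t) w) j α β)
    (hr : ‖Φ t w‖ ≤ r₁) (hrS : ‖j (Φ t w)‖ ≤ rS) (hρ : ρ = 2 * α * r₁)
    (hs : 6 * (α * κ * ρ) ≤ 1) (hρ1 : ρ ≤ 1) (hh : ‖h‖ ≤ ρ) (hz : Φ t (w + h) = 0) :
    ‖j h‖ ≤ 2 * α * (rS + B * r₁ + 2 * β * r₁) := by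
  have hr0 : 0 ≤ r₁ := (norm_nonneg _).trans hr
  have hB0 : 0 ≤ B := (norm_nonneg _).trans hB
  have hρ0 : 0 ≤ ρ := by rw [hρ]; positivity
  have hwh : ‖w + h‖ ≤ 1 := (norm_add_le _ _).trans (by linarith)
  set R := Φ t (w + h) - Φ t w - fderiv ℝ (Φ t) w h with hR
  have e : fderiv ℝ (Φ t) w h = - Φ t w - R := by rw [hR, hz]; abel
  have hR1 : ‖R‖ ≤ r₁ := by
    have h1 := hT₁.contraction hκ hΦ ht hw hh (k := 0) (by simpa using hρ0)
    rw [add_zero, sub_zero] at h1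
    refine h1.trans ?_
    have : κ * ρ * ‖h‖ ≤ κ * ρ * ρ := by gcongr
    have h3 : 3 * (κ * ρ * ρ) = (6 * (α * κ * ρ)) * r₁ := by
      rw [hρ]; ring
    nlinarith
  have hRS : ‖j R‖ ≤ κ * ((B + ‖j h‖) * ρ ^ 2 + 2 * ‖j h‖ * ρ) := by
    refine (hT.remainder_le hκ hΦ ht (b := B + ‖j h‖) (by linarith) hwh
      (by linarith [norm_nonneg (j h)]) ?_).trans ?_
    · rw [map_add]; exact (norm_add_le _ _).trans (by linarith)
    · gcongr
  have hLe := (hL.2 h).2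
  rw [e] at hLe
  have n1 : ‖-Φ t w - R‖ ≤ 2 * r₁ := (norm_sub_le _ _).trans (by rw [norm_neg]; linarith)
  have n2 : ‖j (-Φ t w - R)‖ ≤ rS + κ * ((B + ‖j h‖) * ρ ^ 2 + 2 * ‖j h‖ * ρ) := by
    rw [map_sub, map_neg]
    exact (norm_sub_le _ _).trans (by rw [norm_neg]; linarith)
  have h4 : ‖j h‖ ≤ α * (rS + κ * ((B + ‖j h‖) * ρ ^ 2 + 2 * ‖j h‖ * ρ) + β * (2 * r₁)) := by
    refine hLe.trans ?_
    gcongr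
  have h5 : α * κ * ρ * (ρ * ‖j h‖) ≤ α * κ * ρ * ‖j h‖ := by
    have : ρ * ‖j h‖ ≤ ‖j h‖ := mul_le_of_le_one_left (norm_nonneg _) hρ1
    gcongr
  have h6 : 6 * (α * κ * ρ) * ‖j h‖ ≤ 1 * ‖j h‖ := by gcongr
  have h7 : α * (κ * (B * ρ ^ 2)) ≤ α * (B * r₁) := by
    have : 6 * (α * κ * ρ) * (B * r₁) ≤ 1 * (B * r₁) := by gcongr
    have e2 : α * (κ * (B * ρ ^ 2)) = α * (1 / 3 * (6 * (α * κ * ρ) * (B * r₁))) := by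
      rw [hρ]; ring
    rw [e2]
    have : 0 ≤ B * r₁ := by positivity
    exact mul_le_mul_of_nonneg_left (by linarith) hα.le
  nlinarith

end TameFamilies

/-! ### Cutoff functions and variation of the linearised operator along a curve -/

section NewtonStep

/-- A `C¹` function on the line which is `1` on the `r`-neighbourhood of `A`, vanishes outside the
`2 * r`-neighbourhood, and has slope at most `4 / r`. -/
theorem exists_cutoff (A : Set ℝ) {r : ℝ} (hr : 0 < r) :
    ∃ ψ ψ' : ℝ → ℝ, (∀ x, HasDerivAt ψ (ψ' x) x) ∧ Continuous ψ' ∧ (∀ x, 0 ≤ ψ x ∧ ψ x ≤ 1) ∧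
      (∀ x, |ψ' x| ≤ 4 / r) ∧ (∀ x ∈ Metric.thickening r A, ψ x = 1) ∧
      ∀ x, x ∉ Metric.thickening (2 * r) A → ∀ᶠ y in 𝓝 x, ψ y = 0 := by
  rcases A.eq_empty_or_nonempty with rfl | hA
  · exact ⟨fun _ => 0, fun _ => 0, fun x => hasDerivAt_const x 0, continuous_const,
      fun x => by norm_num, fun x => by simp; positivity, fun x hx => by simp at hx,
      fun x _ => Eventually.of_forall fun _ => rfl⟩
  -- Lipschitz with constant `4 / r`, equal to `1` at distance at most `5 * r / 4` from `A` and to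
  -- `0` at distance at least `3 * r / 2`. These margins leave room for an average over a length `r
  -- / 4`.
  set φ : ℝ → ℝ := fun t => max 0 (min 1 (6 - 4 / r * Metric.infDist t A)) with hφ
  have hd : ∀ x y, |Metric.infDist x A - Metric.infDist y A| ≤ |x - y| := fun x y => by
    have := (Metric.lipschitz_infDist_pt A).dist_le_mul x y
    simpa [Real.dist_eq] using this
  have hlip : ∀ x y, |φ x - φ y| ≤ 4 / r * |x - y| := by
    intro x y
    have h1 : |φ x - φ y| ≤
        |(6 - 4 / r * Metric.infDist x A) - (6 - 4 / r * Metric.infDist y A)| := by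
      have h2 := abs_max_sub_max_le_max 0 (min 1 (6 - 4 / r * Metric.infDist x A)) 0
        (min 1 (6 - 4 / r * Metric.infDist y A))
      have h3 := abs_min_sub_min_le_max 1 (6 - 4 / r * Metric.infDist x A) 1
        (6 - 4 / r * Metric.infDist y A)
      rw [sub_self, abs_zero] at h2 h3
      exact (h2.trans (max_le (abs_nonneg _) le_rfl)).trans
        (h3.trans (max_le (abs_nonneg _) le_rfl))
    refine h1.trans ?_
    have e : (6 - 4 / r * Metric.infDist x A) - (6 - 4 / r * Metric.infDist y A) =
      - (4 / r * (Metric.infDist x A - Metric.infDist y A)) := by ring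
    rw [e, abs_neg, abs_mul, abs_of_pos (by positivity : 0 < 4 / r)]
    exact mul_le_mul_of_nonneg_left (hd x y) (by positivity)
  have hc : Continuous φ := by
    have := Metric.continuous_infDist_pt A
    fun_prop
  have h01 : ∀ x, 0 ≤ φ x ∧ φ x ≤ 1 := fun x =>
    ⟨le_max_left _ _, max_le zero_le_one (min_le_left _ _)⟩
  have hη : 0 < r / 4 := by positivity
  have hint : ∀ a b, IntervalIntegrable φ MeasureTheory.volume a b :=
    fun a b => hc.intervalIntegrable a b
  -- The moving average of `φ` over `[x, x + r / 4]` is `C¹`, and its derivative is a difference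
  -- quotient of `φ`, so the Lipschitz constant of `φ` bounds it.
  refine ⟨fun x => 4 / r * ∫ t in x..(x + r / 4), φ t,
    fun x => 4 / r * (φ (x + r / 4) - φ x), ?_, ?_, ?_, ?_, ?_, ?_⟩
  · intro x
    have h1 : ∀ z, HasDerivAt (fun y => ∫ t in (0 : ℝ)..y, φ t) (φ z) z := fun z =>
      intervalIntegral.integral_hasDerivAt_right (hint 0 z)
        (hc.stronglyMeasurableAtFilter _ _) hc.continuousAt
    have h2 : HasDerivAt (fun y => ∫ t in (0 : ℝ)..(y + r / 4), φ t) (φ (x + r / 4)) x := by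
      simpa using HasDerivAt.comp_add_const x (r / 4) (h1 (x + r / 4))
    have h3 := (h2.sub (h1 x)).const_mul (4 / r)
    refine h3.congr_of_eventuallyEq (Eventually.of_forall fun y => ?_)
    simp only [Pi.sub_apply]
    rw [intervalIntegral.integral_interval_sub_left (hint _ _) (hint _ _)]
  · fun_prop
  · intro x
    have hx : x ≤ x + r / 4 := by linarith
    have n1 : 0 ≤ ∫ t in x..(x + r / 4), φ t :=
      intervalIntegral.integral_nonneg hx fun t _ => (h01 t).1
    have n2 : ∫ t in x..(x + r / 4), φ t ≤ ∫ t in x..(x + r / 4), (1 : ℝ) :=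
      intervalIntegral.integral_mono_on hx (hint _ _) (by simp) fun t _ => (h01 t).2
    refine ⟨by positivity, ?_⟩
    simp only [intervalIntegral.integral_const, smul_eq_mul, mul_one, add_sub_cancel_left] at n2
    calc 4 / r * ∫ t in x..(x + r / 4), φ t ≤ 4 / r * (r / 4) := by gcongr
      _ = 1 := by field_simp
  · intro x
    rw [abs_mul, abs_of_pos (by positivity : 0 < 4 / r)]
    have h1 := hlip (x + r / 4) x
    rw [add_sub_cancel_left, abs_of_pos hη] at h1
    have e : 4 / r * (r / 4) = 1 := by field_simp
    rw [e] at h1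
    exact mul_le_of_le_one_right (by positivity) h1
  · intro x hx
    rw [Metric.mem_thickening_iff_infDist_lt hA] at hx
    have h1 : ∫ t in x..(x + r / 4), φ t = ∫ t in x..(x + r / 4), (1 : ℝ) := by
      refine intervalIntegral.integral_congr fun t ht => ?_
      rw [uIcc_of_le (by linarith)] at ht
      have h2 := (abs_le.1 (hd t x)).2
      rw [abs_of_nonneg (by linarith [ht.1])] at h2
      have h3 : 4 / r * Metric.infDist t A ≤ 4 / r * (5 / 4 * r) := by
        gcongr; linarith [ht.2]
      have e : 4 / r * (5 / 4 * r) = 5 := by field_simp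
      simp only [hφ]
      rw [min_eq_left (by linarith)]
      simp
    simp only [h1, intervalIntegral.integral_const, smul_eq_mul, mul_one, add_sub_cancel_left]
    field_simp
  · intro x hx
    rw [Metric.mem_thickening_iff_infDist_lt hA, not_lt] at hx
    filter_upwards [Metric.ball_mem_nhds x hη] with y hy
    rw [Metric.mem_ball, Real.dist_eq] at hy
    have h1 : ∫ t in y..(y + r / 4), φ t = ∫ t in y..(y + r / 4), (0 : ℝ) := by
      refine intervalIntegral.integral_congr fun t ht => ?_
      rw [uIcc_of_le (by linarith)] at ht
      have h2 := (abs_le.1 (hd x t)).2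
      have h4 : |x - t| ≤ r / 2 := by
        rw [abs_lt] at hy
        rw [abs_le]
        constructor <;> linarith [ht.1, ht.2]
      have h3 : 4 / r * (3 / 2 * r) ≤ 4 / r * Metric.infDist t A := by
        gcongr; linarith
      have e : 4 / r * (3 / 2 * r) = 6 := by field_simp; norm_num
      simp only [hφ]
      rw [max_eq_left]
      exact (min_le_right _ _).trans (by linarith)
    simp [h1]

variable {E G : Type*} [NormedAddCommGroup E] [NormedSpace ℝ E]
  [NormedAddCommGroup G] [NormedSpace ℝ G]
  {I : Set ℝ} {Φ : ℝ → E → E} {κ : ℝ} {j : E →L[ℝ] G}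

/-- Nothing is known about `h` off `V`. Since `ψ` vanishes in a whole neighbourhood of each point
off `V`, both the product and the candidate derivative vanish near such a point. -/
theorem hasDerivWithinAt_cutoff_smul {ψ ψ' : ℝ → ℝ} {V : Set ℝ} (hV : IsOpen V)
    (hψ : ∀ x, HasDerivAt ψ (ψ' x) x) (hψc : Continuous ψ')
    (hψ0 : ∀ x, x ∉ V → ∀ᶠ y in 𝓝 x, ψ y = 0) {h h' : ℝ → E}
    (hh : ∀ t ∈ I ∩ V, HasDerivWithinAt h (h' t) I t) (hc : ContinuousOn h' (I ∩ V)) :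
    (∀ t ∈ I, HasDerivWithinAt (fun l => ψ l • h l) (ψ t • h' t + ψ' t • h t) I t) ∧
      ContinuousOn (fun t => ψ t • h' t + ψ' t • h t) I := by
  have hψ0' : ∀ x, x ∉ V → ∀ᶠ y in 𝓝 x, ψ' y = 0 := by
    intro x hx
    filter_upwards [(hψ0 x hx).eventually_nhds] with y hy
    have h1 : ψ =ᶠ[𝓝 y] fun _ => 0 := hy
    exact (hψ y).unique ((hasDerivAt_const y (0 : ℝ)).congr_of_eventuallyEq h1)
  constructor
  · intro t ht
    by_cases hV' : t ∈ V
    · exact (hψ t).hasDerivWithinAt.smul (hh t ⟨ht, hV'⟩)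
    · have e : ψ t • h' t + ψ' t • h t = 0 := by
        rw [(hψ0 t hV').self_of_nhds, (hψ0' t hV').self_of_nhds]
        simp
      rw [e]
      refine (hasDerivWithinAt_const t I (0 : E)).congr_of_eventuallyEq ?_ ?_
      · filter_upwards [nhdsWithin_le_nhds (hψ0 t hV')] with y hy
        simp [hy]
      · simp [(hψ0 t hV').self_of_nhds]
  · intro t ht
    by_cases hV' : t ∈ V
    · have hnh : I ∩ V ∈ 𝓝[I] t := inter_mem_nhdsWithin _ (hV.mem_nhds hV')
      have c1 : ContinuousWithinAt h' I t := (hc t ⟨ht, hV'⟩).mono_of_mem_nhdsWithin hnh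
      have c2 : ContinuousWithinAt h I t := (hh t ⟨ht, hV'⟩).continuousWithinAt
      exact ((hψ t).continuousAt.continuousWithinAt.smul c1).add
        (hψc.continuousWithinAt.smul c2)
    · refine (continuousWithinAt_const (b := (0 : E))).congr_of_eventuallyEq ?_ ?_
      · filter_upwards [nhdsWithin_le_nhds (hψ0 t hV'), nhdsWithin_le_nhds (hψ0' t hV')]
          with y hy hy'
        simp [hy, hy']
      · simp [(hψ0 t hV').self_of_nhds, (hψ0' t hV').self_of_nhds]

/-- The variation splits into a change of parameter at fixed argument, estimated by `mixed`, and a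
change of argument at fixed parameter, estimated by `snd`; the mean value inequality along `w`
controls the displacement in both norms. -/
theorem TameFamily.fderiv_curve_sub_le (hT : TameFamily I Φ κ j) (hκ : 0 ≤ κ)
    (hI : UniqueDiffOn ℝ I) (hIc : Convex ℝ I)
    (hΦ : ContDiffOn ℝ 2 (fun p : ℝ × E => Φ p.1 p.2) (I ×ˢ univ)) {w w' : ℝ → E}
    (hw : ∀ t ∈ I, HasDerivWithinAt w (w' t) I t) {D B B' θ : ℝ}
    (hw1 : ∀ t ∈ I, ‖w t‖ ≤ 1) (hD : ∀ t ∈ I, ‖w' t‖ ≤ D) (hB : ∀ t ∈ I, ‖j (w t)‖ ≤ B)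
    (hB' : ∀ t ∈ I, ‖j (w' t)‖ ≤ B') {t a : ℝ} (ht : t ∈ I) (ha : a ∈ I) (hθ : |t - a| ≤ θ)
    (f : E) :
    ‖j ((fderiv ℝ (Φ t) (w t) - fderiv ℝ (Φ a) (w a)) f)‖ ≤
      θ * κ * (1 + D) * ‖j f‖ + θ * κ * (B + B * D + B') * ‖f‖ := by
  have hB0 : 0 ≤ B := (norm_nonneg _).trans (hB t ht)
  have hD0 : 0 ≤ D := (norm_nonneg _).trans (hD t ht)
  have hB'0 : 0 ≤ B' := (norm_nonneg _).trans (hB' t ht)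
  have hθ0 : 0 ≤ θ := (abs_nonneg _).trans hθ
  have n1 : ‖w t - w a‖ ≤ θ * D := by
    have := hIc.norm_image_sub_le_of_norm_hasDerivWithin_le hw hD ha ht
    rw [Real.norm_eq_abs] at this
    refine this.trans ?_
    rw [mul_comm]
    gcongr
  have n2 : ‖j (w t - w a)‖ ≤ θ * B' := by
    have := hIc.norm_image_sub_le_of_norm_hasDerivWithin_le (f := fun l => j (w l))
      (f' := fun l => j (w' l)) (fun l hl => j.hasFDerivAt.comp_hasDerivWithinAt l (hw l hl))
      hB' ha ht
    rw [Real.norm_eq_abs] at this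
    rw [map_sub]
    refine this.trans ?_
    rw [mul_comm]
    gcongr
  have e : (fderiv ℝ (Φ t) (w t) - fderiv ℝ (Φ a) (w a)) f =
      (fderiv ℝ (Φ t) (w t) f - fderiv ℝ (Φ a) (w t) f) +
        (fderiv ℝ (Φ a) (w a + (w t - w a)) f - fderiv ℝ (Φ a) (w a) f) := by
    simp
  rw [e, map_add]
  refine (norm_add_le _ _).trans ?_
  have a1 := hT.fderiv_sub_param_le hI hIc hΦ ht ha (hw1 t ht) f
  have a2 := hT.fderiv_sub_le hκ hΦ ha (u := w a) (h := w t - w a) (b := B) (hw1 a ha)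
    (by simpa using hw1 t ht) (hB a ha) (by simpa using hB t ht) f
  have a1' : κ * (‖j f‖ + ‖j (w t)‖ * ‖f‖) * |t - a| ≤ κ * (‖j f‖ + B * ‖f‖) * θ := by
    gcongr
    exact hB t ht
  have a2' : κ * (B * ‖w t - w a‖ * ‖f‖ + ‖j (w t - w a)‖ * ‖f‖ + ‖w t - w a‖ * ‖j f‖) ≤
      κ * (B * (θ * D) * ‖f‖ + (θ * B') * ‖f‖ + (θ * D) * ‖j f‖) := by
    gcongr
  refine (add_le_add (a1.trans a1') (a2.trans a2')).trans (le_of_eq ?_)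
  ring

end NewtonStep

/-! ### One Newton step with parameters -/

section NewtonStepMain

variable {E G : Type*} [NormedAddCommGroup E] [NormedSpace ℝ E]
  [NormedAddCommGroup G] [NormedSpace ℝ G]
  {I : Set ℝ} {Φ : ℝ → E → E} {κ : ℝ} {j : E →L[ℝ] G}

theorem TameInvertible.mono {L : E →L[ℝ] E} {α β β' : ℝ} (h : TameInvertible L j α β)
    (hα : 0 ≤ α) (hβ : β ≤ β') : TameInvertible L j α β' :=
  ⟨h.1, fun g => ⟨(h.2 g).1, (h.2 g).2.trans (by gcongr)⟩⟩

/-- One step of the Nash-Moser iteration in a fixed truncation: near the set `A` where the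
linearised operator at `w` is tamely invertible, the equation `Φ t (w t + h t) = 0` is solved, and
the correction is extended by a cutoff. -/
theorem exists_newton_step [CompleteSpace E] (hI : UniqueDiffOn ℝ I) (hIc : Convex ℝ I)
    (hΦ : ContDiffOn ℝ 2 (fun p : ℝ × E => Φ p.1 p.2) (I ×ˢ univ)) (hκ : 0 ≤ κ)
    (hT₁ : TameFamily I Φ κ (ContinuousLinearMap.id ℝ E)) (hT : TameFamily I Φ κ j)
    {w w' : ℝ → E} (hw : ∀ t ∈ I, HasDerivWithinAt w (w' t) I t) (hwc : ContinuousOn w' I)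
    {D B B' ρ : ℝ} (hw1 : ∀ t ∈ I, ‖w t‖ ≤ 1 - ρ) (hD : ∀ t ∈ I, ‖w' t‖ ≤ D)
    (hB : ∀ t ∈ I, ‖j (w t)‖ ≤ B) (hB' : ∀ t ∈ I, ‖j (w' t)‖ ≤ B')
    (hD0 : 0 ≤ D) (hB0 : 0 ≤ B) (hB'0 : 0 ≤ B')
    {A : Set ℝ} (hAI : A ⊆ I) {α β : ℝ} (hα : 0 < α) (hβ : 0 ≤ β)
    (hA : ∀ t ∈ A, TameInvertible (fderiv ℝ (Φ t) (w t)) j α β) {r : ℝ} (hr : 0 < r)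
    {r₁ rS r₁' : ℝ} (hr0 : 0 ≤ r₁) (hrS0 : 0 ≤ rS) (hr0' : 0 ≤ r₁')
    (hres : ∀ t ∈ I ∩ Metric.thickening (2 * r) A, ‖Φ t (w t)‖ ≤ r₁ ∧ ‖j (Φ t (w t))‖ ≤ rS ∧
      ‖derivWithin (fun l => Φ l (w t)) I t + fderiv ℝ (Φ t) (w t) (w' t)‖ ≤ r₁')
    (hsmall : 12 * (α * r * κ * (1 + D)) ≤ 1) (hρ : ρ = 4 * α * r₁)
    (hsmall' : 12 * (α * κ * ρ) ≤ 1) (hρ1 : ρ ≤ 1) {β' H β'' G₁ : ℝ}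
    (hβ' : 2 * β + 2 * α * (2 * r * κ * (B + B * D + B')) ≤ β')
    (hH : 4 * α * (rS + B * r₁ + 2 * β' * r₁) ≤ H)
    (hβ'' : 2 * β' + 4 * α * (κ * (B * ρ + 2 * H)) ≤ β'')
    (hG₁ : r₁' + 3 * (κ * ρ) * (1 + D) ≤ G₁) :
    ∃ v v' : ℝ → E, (∀ t ∈ I, HasDerivWithinAt v (v' t) I t) ∧ ContinuousOn v' I ∧
      (∀ t ∈ I ∩ Metric.thickening r A, Φ t (w t + v t) = 0) ∧
      (∀ t ∈ I, ‖v t‖ ≤ ρ ∧ ‖j (v t)‖ ≤ H ∧ ‖v' t‖ ≤ 4 / r * ρ + 4 * α * G₁ ∧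
        ‖j (v' t)‖ ≤ 4 / r * H +
          4 * α * (κ * (1 + (B + H) * (1 + D) + B') + β'' * G₁)) ∧
      ∀ Y : Submodule ℝ E, FiniteDimensional ℝ Y → (∀ t ∈ I, w t ∈ Y) →
        (∀ t ∈ I, ∀ u ∈ Y, Φ t u ∈ Y) → ∀ t ∈ I, v t ∈ Y := by
  have hρ0 : 0 ≤ ρ := by rw [hρ]; positivity
  have hβ'0 : 0 ≤ β' := le_trans (by positivity) hβ'
  have hH0 : 0 ≤ H := le_trans (by positivity) hH
  have hβ''0 : 0 ≤ β'' := le_trans (by positivity) hβ''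
  have hG₁0 : 0 ≤ G₁ := le_trans (by positivity) hG₁
  have hw1' : ∀ t ∈ I, ‖w t‖ ≤ 1 := fun t ht => (hw1 t ht).trans (by linarith)
  set V := Metric.thickening (2 * r) A with hV
  -- The first doubling of `α`, from `A` to its `2 * r`-neighbourhood: with `η₁ = 6 * r * κ * (1 +
  -- D)`, `hsmall` is exactly the smallness needed. The second doubling, from `w t` to the zero `u
  -- t`, has `η₁ = 3 * κ * ρ` and uses `hsmall'`.
  have hinv : ∀ t ∈ I ∩ V, TameInvertible (fderiv ℝ (Φ t) (w t)) j (2 * α) β' := by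
    rintro t ⟨ht, htV⟩
    obtain ⟨a, haA, hta⟩ := Metric.mem_thickening_iff.1 htV
    have ha := hAI haA
    rw [Real.dist_eq] at hta
    refine ((hA a haA).perturb hα hβ (η₁ := 3 * (2 * r * κ * (1 + D)))
      (η₂ := 2 * r * κ * (B + B * D + B')) (by positivity) (by positivity)
      (by linarith) (fun f => ?_) (fun f => ?_)).mono (by positivity) hβ'
    · have := hT₁.fderiv_curve_sub_le hκ hI hIc hΦ hw hw1' hD (B := 1) hw1' hD ht ha hta.le f
      simp only [ContinuousLinearMap.id_apply] at this
      refine this.trans ?_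
      have e : 0 ≤ r * κ * ‖f‖ := by positivity
      nlinarith
    · refine (hT.fderiv_curve_sub_le hκ hI hIc hΦ hw hw1' hD hB hB' ht ha hta.le f).trans ?_
      have : 0 ≤ 2 * r * κ * (1 + D) := by positivity
      exact add_le_add (mul_le_mul_of_nonneg_right (by linarith) (norm_nonneg _)) le_rfl
  have hsol : ∀ t, ∃ h, t ∈ I ∩ V → ‖h‖ ≤ ρ ∧ Φ t (w t + h) = 0 ∧
      (∀ k, ‖k‖ ≤ ρ → ‖k - h‖ ≤ 2 * (2 * α) * ‖Φ t (w t + k)‖) ∧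
      ∀ Y : Submodule ℝ E, FiniteDimensional ℝ Y → (∀ v ∈ Y, Φ t v ∈ Y) → w t ∈ Y → h ∈ Y := by
    intro t
    by_cases ht : t ∈ I ∩ V
    · obtain ⟨h, hh⟩ := exists_zero_of_tameInvertible hT₁ hκ hΦ ht.1 (hw1 t ht.1)
        (by positivity : 0 < 2 * α) (hinv t ht) (hres t ht).1 (by rw [hρ]; ring) (by linarith)
      exact ⟨h, fun _ => hh⟩
    · exact ⟨0, fun h => absurd h ht⟩
  choose h hsol using hsol
  set u : ℝ → E := fun t => w t + h t with hu
  have hu1 : ∀ t ∈ I ∩ V, ‖u t‖ ≤ 1 := fun t ht =>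
    (norm_add_le _ _).trans (by linarith [hw1 t ht.1, (hsol t ht).1])
  have hjh : ∀ t ∈ I ∩ V, ‖j (h t)‖ ≤ H := by
    intro t ht
    refine (norm_map_zero_le hT hT₁ hκ hΦ ht.1 (hw1 t ht.1) (hB t ht.1)
      (by positivity : 0 < 2 * α) hβ'0 (hinv t ht) (hres t ht).1 (hres t ht).2.1
      (by rw [hρ]; ring) (by linarith) hρ1 (hsol t ht).1 (hsol t ht).2.1).trans ?_
    linarith
  have hju : ∀ t ∈ I ∩ V, ‖j (u t)‖ ≤ B + H := fun t ht => by
    rw [hu, map_add]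
    exact (norm_add_le _ _).trans (by linarith [hB t ht.1, hjh t ht])
  have hinv' : ∀ t ∈ I ∩ V, TameInvertible (fderiv ℝ (Φ t) (u t)) j (4 * α) β'' := by
    intro t ht
    have := (hinv t ht).perturb (L' := fderiv ℝ (Φ t) (u t)) (by positivity) hβ'0
      (η₁ := 3 * (κ * ρ)) (η₂ := κ * (B * ρ + 2 * H))
      (by positivity) (by positivity) (by linarith) (fun f => ?_) (fun f => ?_)
    · rw [show 2 * (2 * α) = 4 * α by ring] at this
      exact this.mono (by positivity) hβ''
    · exact hT₁.norm_fderiv_sub_le hκ hΦ ht.1 (hw1 t ht.1) (hsol t ht).1 f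
    · refine (hT.fderiv_sub_le hκ hΦ ht.1 (hw1' t ht.1) (hu1 t ht) (b := B + H)
        (by linarith [hB t ht.1]) (hju t ht) f).trans ?_
      have n1 := (hsol t ht).1
      have n2 := hjh t ht
      have : κ * ((B + H) * ‖h t‖ * ‖f‖ + ‖j (h t)‖ * ‖f‖ + ‖h t‖ * ‖j f‖) ≤
        κ * ((B + H) * ρ * ‖f‖ + H * ‖f‖ + ρ * ‖j f‖) := by gcongr
      refine this.trans ?_
      have e1 : H * ρ ≤ H := mul_le_of_le_one_right hH0 hρ1
      have e2 : κ * (H * ρ * ‖f‖) ≤ κ * (H * ‖f‖) := by gcongr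
      have e3 : 0 ≤ κ * ρ * ‖j f‖ := by positivity
      linarith
  have hnear : ∀ t ∈ I ∩ V, I ∩ V ∈ 𝓝[I] t := fun t ht =>
    inter_mem_nhdsWithin _ (Metric.isOpen_thickening.mem_nhds ht.2)
  have hwcont : ContinuousOn w I := fun t ht => (hw t ht).continuousWithinAt
  -- The zero at a nearby `l` is compared with the competitor `k = h t`: their distance is at most a
  -- multiple of `‖Φ l (w l + h t)‖`, which tends to `‖Φ t (w t + h t)‖ = 0`.
  have hhc : ∀ t ∈ I ∩ V, ContinuousWithinAt h I t := by
    intro t ht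
    have h1 : Tendsto (fun l => 2 * (2 * α) * ‖Φ l (w l + h t)‖) (𝓝[I] t) (𝓝 0) := by
      have c1 : ContinuousWithinAt (fun l => (l, w l + h t)) I t :=
        continuousWithinAt_id.prodMk ((hwcont t ht.1).add continuousWithinAt_const)
      have c2 : ContinuousWithinAt (fun l => Φ l (w l + h t)) I t :=
        ContinuousWithinAt.comp (t := I ×ˢ univ) (f := fun l => (l, w l + h t))
          (hΦ.continuousOn (t, w t + h t) ⟨ht.1, mem_univ _⟩) c1 (fun l hl => ⟨hl, mem_univ _⟩)
      have c3 := (c2.norm.tendsto).const_mul (2 * (2 * α))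
      rwa [(hsol t ht).2.1, norm_zero, mul_zero] at c3
    rw [ContinuousWithinAt, tendsto_iff_norm_sub_tendsto_zero]
    refine squeeze_zero' (Eventually.of_forall fun l => norm_nonneg _) ?_ h1
    filter_upwards [hnear t ht] with l hl
    rw [norm_sub_rev]
    exact (hsol l hl).2.2.1 (h t) (hsol t ht).1
  have huc : ∀ t ∈ I ∩ V, ContinuousWithinAt u I t := fun t ht => (hwcont t ht.1).add (hhc t ht)
  set u' : ℝ → E := fun t =>
    - (Ring.inverse (fderiv ℝ (Φ t) (u t))) (derivWithin (fun l => Φ l (u t)) I t) with hu'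
  have hud : ∀ t ∈ I ∩ V, HasDerivWithinAt u (u' t) I t := by
    intro t ht
    refine hasDerivWithinAt_of_implicit hI hΦ ht.1 (huc t ht) ?_ (hinv' t ht).1
    filter_upwards [hnear t ht] with l hl
    exact (hsol l hl).2.1
  have hu'c : ContinuousOn u' (I ∩ V) := by
    have c0 : ContinuousOn (fun l => (l, u l)) (I ∩ V) :=
      continuousOn_id.prodMk fun t ht => (huc t ht).mono inter_subset_left
    have hm : MapsTo (fun l => (l, u l)) (I ∩ V) (I ×ˢ univ) := fun l hl => ⟨hl.1, mem_univ _⟩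
    have c1 := (continuousOn_fderiv_slice one_le_two hI hΦ).comp c0 hm
    have c2 := (continuousOn_derivWithin_slice one_le_two hI hΦ).comp c0 hm
    have c3 : ContinuousOn (fun t => Ring.inverse (fderiv ℝ (Φ t) (u t))) (I ∩ V) := by
      intro t ht
      obtain ⟨U, hU⟩ := (hinv' t ht).1
      have := NormedRing.inverse_continuousAt U
      rw [hU] at this
      exact ContinuousAt.comp_continuousWithinAt (f := fun t => fderiv ℝ (Φ t) (u t)) this
        (c1 t ht)
    exact (c3.clm_apply c2).neg
  have hhd : ∀ t ∈ I ∩ V, HasDerivWithinAt h (u' t - w' t) I t := by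
    intro t ht
    have := (hud t ht).sub (hw t ht.1)
    refine this.congr_of_eventuallyEq (Eventually.of_forall fun l => ?_) ?_ <;> simp [hu]
  -- The differentiated equation, arranged around the derivative of the residual `Φ t (w t)`. In the
  -- low norm all three brackets are small, the first by hypothesis and the others because `‖h t‖ ≤
  -- ρ`.
  have hLd : ∀ t ∈ I ∩ V, fderiv ℝ (Φ t) (u t) (u' t - w' t) =
      - ((derivWithin (fun l => Φ l (w t)) I t + fderiv ℝ (Φ t) (w t) (w' t)) +
        (derivWithin (fun l => Φ l (w t + h t)) I t - derivWithin (fun l => Φ l (w t)) I t) +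
        (fderiv ℝ (Φ t) (w t + h t) (w' t) - fderiv ℝ (Φ t) (w t) (w' t))) := by
    intro t ht
    have e : fderiv ℝ (Φ t) (u t) (u' t) = - derivWithin (fun l => Φ l (u t)) I t := by
      simp only [hu', map_neg, neg_inj]
      rw [← mul_apply_eq_comp, Ring.mul_inverse_cancel _ (hinv' t ht).1]
      rfl
    rw [map_sub, e]
    simp only [hu]
    abel
  have hg1 : ∀ t ∈ I ∩ V, ‖fderiv ℝ (Φ t) (u t) (u' t - w' t)‖ ≤ G₁ := by
    intro t ht
    rw [hLd t ht, norm_neg]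
    have n1 := (hres t ht).2.2
    have n2 := hT₁.derivWithin_sub_le hκ hI hIc hΦ ht.1 (u := w t) (h := h t) (b := 1)
      (hw1' t ht.1) (hu1 t ht) (hw1' t ht.1) (hu1 t ht)
    have n3 := hT₁.norm_fderiv_sub_le hκ hΦ ht.1 (hw1 t ht.1) (hsol t ht).1 (w' t)
    simp only [ContinuousLinearMap.id_apply] at n2
    have n2' : κ * (‖h t‖ + 1 * ‖h t‖) ≤ κ * (ρ + 1 * ρ) := by
      have := (hsol t ht).1
      gcongr
    have n3' : 3 * (κ * ρ) * ‖w' t‖ ≤ 3 * (κ * ρ) * D := by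
      have := hD t ht.1
      gcongr
    have e3 : 0 ≤ κ * ρ := by positivity
    refine (norm_add₃_le).trans ?_
    linarith
  -- No smallness is needed in the high norm: the two parts of the differentiated equation are
  -- bounded directly by `param` and `fst`.
  have hg2 : ∀ t ∈ I ∩ V, ‖j (fderiv ℝ (Φ t) (u t) (u' t - w' t))‖ ≤
      κ * (1 + (B + H) * (1 + D) + B') := by
    intro t ht
    have e : fderiv ℝ (Φ t) (u t) (u' t - w' t) =
        - (derivWithin (fun l => Φ l (u t)) I t + fderiv ℝ (Φ t) (u t) (w' t)) := by
      rw [hLd t ht]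
      simp only [hu]
      abel
    rw [e, map_neg, norm_neg, map_add]
    have n1 := hT.param t ht.1 (u t) (hu1 t ht)
    have n2 := hT.fst t ht.1 (u t) (hu1 t ht) (w' t)
    have n3 := hju t ht
    have n1' : κ * (1 + ‖j (u t)‖) ≤ κ * (1 + (B + H)) := by gcongr
    have n2' : κ * (‖j (u t)‖ * ‖w' t‖ + ‖j (w' t)‖) ≤ κ * ((B + H) * D + B') := by
      have := hD t ht.1
      have := hB' t ht.1
      gcongr
    refine (norm_add_le _ _).trans ?_
    linarith
  have hh1 : ∀ t ∈ I ∩ V, ‖u' t - w' t‖ ≤ 4 * α * G₁ := fun t ht =>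
    ((hinv' t ht).2 _).1.trans (by have := hg1 t ht; gcongr)
  have hh2 : ∀ t ∈ I ∩ V, ‖j (u' t - w' t)‖ ≤
      4 * α * (κ * (1 + (B + H) * (1 + D) + B') + β'' * G₁) := fun t ht =>
    ((hinv' t ht).2 _).2.trans (by have := hg1 t ht; have := hg2 t ht; gcongr)
  obtain ⟨ψ, ψ', hψ, hψc, hψ01, hψ', hψ1, hψ0⟩ := exists_cutoff A hr
  obtain ⟨k1, k2⟩ := hasDerivWithinAt_cutoff_smul Metric.isOpen_thickening hψ hψc hψ0 hhd
    (hu'c.sub (hwc.mono inter_subset_left))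
  refine ⟨fun t => ψ t • h t, fun t => ψ t • (u' t - w' t) + ψ' t • h t, k1, k2, ?_, ?_, ?_⟩
  · rintro t ⟨ht, htr⟩
    have htV : t ∈ V := Metric.thickening_mono (by linarith) A htr
    simp only [hψ1 t htr, one_smul]
    exact (hsol t ⟨ht, htV⟩).2.1
  · intro t ht
    by_cases htV : t ∈ V
    · have hψn : ‖ψ t‖ ≤ 1 := by
        rw [Real.norm_of_nonneg (hψ01 t).1]; exact (hψ01 t).2
      have hψn' : ‖ψ' t‖ ≤ 4 / r := hψ' t
      have q1 := (hsol t ⟨ht, htV⟩).1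
      have q2 := hjh t ⟨ht, htV⟩
      have q3 := hh1 t ⟨ht, htV⟩
      have q4 := hh2 t ⟨ht, htV⟩
      refine ⟨?_, ?_, ?_, ?_⟩
      · rw [norm_smul]
        exact (mul_le_of_le_one_left (norm_nonneg _) hψn).trans q1
      · rw [map_smul, norm_smul]
        exact (mul_le_of_le_one_left (norm_nonneg _) hψn).trans q2
      · refine (norm_add_le _ _).trans ?_
        rw [norm_smul, norm_smul, add_comm]
        refine add_le_add (by gcongr) ?_
        exact (mul_le_of_le_one_left (norm_nonneg _) hψn).trans q3
      · rw [map_add, map_smul, map_smul]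
        refine (norm_add_le _ _).trans ?_
        rw [norm_smul, norm_smul, add_comm]
        refine add_le_add (by gcongr) ?_
        exact (mul_le_of_le_one_left (norm_nonneg _) hψn).trans q4
    · have e0 := (hψ0 t htV).self_of_nhds
      have e1 : ψ' t = 0 := by
        have h1 : ψ =ᶠ[𝓝 t] fun _ => 0 := hψ0 t htV
        exact (hψ t).unique ((hasDerivAt_const t (0 : ℝ)).congr_of_eventuallyEq h1)
      simp only [e0, e1, zero_smul, add_zero, map_zero, norm_zero]
      refine ⟨hρ0, hH0, by positivity, by positivity⟩
  · intro Y hY hwY hΦY t ht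
    by_cases htV : t ∈ V
    · exact Y.smul_mem _ ((hsol t ⟨ht, htV⟩).2.2.2 Y hY (hΦY t ht) (hwY t ht))
    · simp [(hψ0 t htV).self_of_nhds]

end NewtonStepMain

/-! ### Derivatives after composition with bounded operators -/

section CompCalculus

variable {E₁ E₂ G₁ G₂ : Type*} [NormedAddCommGroup E₁] [NormedSpace ℝ E₁]
  [NormedAddCommGroup E₂] [NormedSpace ℝ E₂] [NormedAddCommGroup G₁] [NormedSpace ℝ G₁]
  [NormedAddCommGroup G₂] [NormedSpace ℝ G₂]

theorem fderiv_clm_comp_comp {f : E₂ → G₁} (hf : Differentiable ℝ f) (A : G₁ →L[ℝ] G₂)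
    (B : E₁ →L[ℝ] E₂) (u h : E₁) :
    fderiv ℝ (fun x => A (f (B x))) u h = A (fderiv ℝ f (B u) (B h)) := by
  have h1 : HasFDerivAt (fun x => f (B x)) ((fderiv ℝ f (B u)).comp B) u :=
    (hf (B u)).hasFDerivAt.comp u B.hasFDerivAt
  have h2 : HasFDerivAt (fun x => A (f (B x))) (A.comp ((fderiv ℝ f (B u)).comp B)) u :=
    A.hasFDerivAt.comp u h1
  rw [h2.fderiv]
  rfl

theorem fderiv_fderiv_clm_comp_comp {f : E₂ → G₁} (hf : ContDiff ℝ 2 f) (A : G₁ →L[ℝ] G₂)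
    (B : E₁ →L[ℝ] E₂) (u h v : E₁) :
    fderiv ℝ (fun w => fderiv ℝ (fun x => A (f (B x))) w) u h v =
      A (fderiv ℝ (fun w => fderiv ℝ f w) (B u) (B h) (B v)) := by
  have hd : Differentiable ℝ (fun w => fderiv ℝ f w) :=
    (hf.fderiv_right (m := 1) (by norm_num)).differentiable (by norm_num)
  have hf1 := hf.differentiable two_ne_zero
  have hc : ContDiff ℝ 2 (fun x => A (f (B x))) := A.contDiff.comp (hf.comp B.contDiff)
  have hd' : Differentiable ℝ (fun w => fderiv ℝ (fun x => A (f (B x))) w) :=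
    (hc.fderiv_right (m := 1) (by norm_num)).differentiable (by norm_num)
  have e1 : fderiv ℝ (fun w => fderiv ℝ (fun x => A (f (B x))) w) u h v =
      fderiv ℝ (fun w => fderiv ℝ (fun x => A (f (B x))) w v) u h := by
    have := ((ContinuousLinearMap.apply ℝ G₂ v).hasFDerivAt.comp u (hd' u).hasFDerivAt).fderiv
    change _ = fderiv ℝ ((ContinuousLinearMap.apply ℝ G₂ v) ∘
      (fun w => fderiv ℝ (fun x => A (f (B x))) w)) u h
    rw [this]
    rfl
  rw [e1]
  simp only [fderiv_clm_comp_comp hf1]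
  have h1 : HasFDerivAt (fun w => fderiv ℝ f (B w))
      ((fderiv ℝ (fun w => fderiv ℝ f w) (B u)).comp B) u :=
    (hd (B u)).hasFDerivAt.comp u B.hasFDerivAt
  have h2 := ((A.comp (ContinuousLinearMap.apply ℝ G₁ (B v))).hasFDerivAt.comp u h1).fderiv
  change fderiv ℝ ((A.comp (ContinuousLinearMap.apply ℝ G₁ (B v))) ∘
    (fun w => fderiv ℝ f (B w))) u h = _
  rw [h2]
  rfl

end CompCalculus

/-! ### Projectors as bounded operators, and integrated tame bounds for `F` -/

namespace BanachScale

variable {V : Type*} [AddCommGroup V] [Module ℝ V] {X : BanachScale V} (P : X.Smoothing)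

/-- The truncated difference `t - s` covers both cases: for `t ≤ s` it is `0` and monotonicity of
the norms suffices, otherwise this is (P1). -/
theorem Smoothing.proj_bound (s t : ℝ≥0) : ∃ C : ℝ, 1 ≤ C ∧ ∀ N : ℕ, 1 ≤ N → ∀ u ∈ X.space s,
    X.nrm t (P.proj N u) ≤ C * (N : ℝ) ^ ((t - s : ℝ≥0) : ℝ) * X.nrm s u := by
  obtain ⟨C, -, hC⟩ := P.P1 s (t - s)
  refine ⟨max C 1, le_max_right _ _, fun N hN u hu => ?_⟩
  have h1 := hC N hN u hu
  have h2 : X.nrm t (P.proj N u) ≤ X.nrm (s + (t - s)) (P.proj N u) :=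
    X.nrm_mono _ _ le_add_tsub _ (P.E_le N _ (P.proj_mem N u))
  have := X.nrm_nonneg s u hu
  refine h2.trans (h1.trans ?_)
  gcongr
  exact le_max_left _ _

/-- The projector `Π^(N)` as a bounded operator from `X_s` to `X_t`. -/
noncomputable def Smoothing.projL {N : ℕ} (hN : 1 ≤ N) (s t : ℝ≥0) : X.Sp s →L[ℝ] X.Sp t :=
  LinearMap.mkContinuousOfExistsBound
    ((X.ofLE (P.E_le N t)) ∘ₗ (LinearMap.codRestrict (P.E N) (P.proj N) (P.proj_mem N)) ∘ₗ
      X.val s)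
    (by
      obtain ⟨C, -, hC⟩ := P.proj_bound s t
      exact ⟨C * (N : ℝ) ^ ((t - s : ℝ≥0) : ℝ), fun u => hC N hN u u.2⟩)

/-- The inclusion `X_t ⊆ X_s`, `s ≤ t`, as a bounded operator. -/
noncomputable def inclL (X : BanachScale V) {s t : ℝ≥0} (h : s ≤ t) : X.Sp t →L[ℝ] X.Sp s :=
  LinearMap.mkContinuous (X.incl h) 1 (fun u => by
    rw [one_mul]; exact X.nrm_mono s t h u u.2)

/-- The subspace `E^(N)` of `X_s`. -/
def Smoothing.EB (N : ℕ) (s : ℝ≥0) : Submodule ℝ (X.Sp s) := (P.E N).comap (X.val s)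

/-- The projector `Π^(N)` as a bounded operator from `X_s` to `E^(N)`. -/
noncomputable def Smoothing.toEB {N : ℕ} (hN : 1 ≤ N) (s t : ℝ≥0) : X.Sp s →L[ℝ] P.EB N t :=
  (P.projL hN s t).codRestrict (P.EB N t) (fun u => P.proj_mem N u)

/-- The inclusion of `E^(N)` in `X_t`. -/
noncomputable def Smoothing.ofEB {N : ℕ} (hN : 1 ≤ N) (s t : ℝ≥0) : P.EB N s →L[ℝ] X.Sp t :=
  (P.projL hN s t).comp (P.EB N s).subtypeL

theorem Smoothing.val_toEB {N : ℕ} (hN : 1 ≤ N) (s t : ℝ≥0) (u : X.Sp s) :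
    (((P.toEB hN s t u : P.EB N t) : X.Sp t) : V) = P.proj N u := rfl

theorem Smoothing.val_ofEB {N : ℕ} (hN : 1 ≤ N) (s t : ℝ≥0) (u : P.EB N s) :
    ((P.ofEB hN s t u : X.Sp t) : V) = (u : X.Sp s) :=
  P.proj_eq N _ u.2

theorem Smoothing.norm_ofEB {N : ℕ} (hN : 1 ≤ N) (s t : ℝ≥0) (u : P.EB N s) :
    ‖P.ofEB hN s t u‖ = X.nrm t (u : X.Sp s) := by
  rw [norm_def, P.val_ofEB]

/-- `E^(N)` is the fixed set of the bounded projector. Hence it is complete for `‖·‖_s`, and the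
contraction argument runs in it even when it is infinite dimensional. -/
theorem Smoothing.isClosed_EB {N : ℕ} (hN : 1 ≤ N) (s : ℝ≥0) :
    IsClosed (P.EB N s : Set (X.Sp s)) := by
  have : (P.EB N s : Set (X.Sp s)) = {u | P.projL hN s s u = u} := by
    ext u
    constructor
    · intro hu
      exact Subtype.ext (P.proj_eq N _ hu)
    · intro hu
      have h1 : P.proj N u = (u : V) := congrArg Subtype.val hu
      change (u : V) ∈ P.E N
      rw [← h1]
      exact P.proj_mem N _
  rw [this]
  exact isClosed_eq (P.projL hN s s).continuous continuous_id

theorem Smoothing.completeSpace_EB {N : ℕ} (hN : 1 ≤ N) (s : ℝ≥0) : CompleteSpace (P.EB N s) :=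
  (P.isClosed_EB hN s).completeSpace_coe

variable {s₀ ν : ℝ≥0} {S' : ℝ≥0∞} {ε' : ℝ} {I : Set ℝ} {F : ℝ → ℝ → X.Sp (s₀ + ν) → X.Sp s₀}

namespace IsTame

theorem contDiffOn_fixed (hF : X.IsTame S' ε' I F) {ε : ℝ} (hε : ε ∈ Ico 0 ε') :
    ContDiffOn ℝ 2 (fun p : ℝ × X.Sp (s₀ + ν) => F ε p.1 p.2) (I ×ˢ univ) :=
  hF.contDiff.comp (f := fun p : ℝ × X.Sp (s₀ + ν) => (ε, p)) (contDiff_prodMk_right ε).contDiffOn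
    (fun _ hp => ⟨hε, hp⟩)

theorem differentiableOn_eps (hF : X.IsTame S' ε' I F) {lam : ℝ} (hl : lam ∈ I) :
    DifferentiableOn ℝ (fun e => F e lam 0) (Ico 0 ε') := by
  refine (hF.contDiff.differentiableOn two_ne_zero).comp
    (f := fun e : ℝ => (e, lam, (0 : X.Sp (s₀ + ν)))) ?_ (fun e he => ⟨he, hl, mem_univ _⟩)
  fun_prop

/-- The tame bounds for `F` and its derivatives, after composition with a continuous operator
which is bounded for the norm `‖·‖_s`. -/
theorem exists_bound (hF : X.IsTame S' ε' I F) {s : ℝ≥0} (hs : s₀ ≤ s) (hsS : (s : ℝ≥0∞) < S') :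
    ∃ C : ℝ, 1 ≤ C ∧ ∀ {H : Type _} [NormedAddCommGroup H] [NormedSpace ℝ H]
      (T : X.Sp s₀ →L[ℝ] H) (K : ℝ), 0 ≤ K →
      (∀ v : X.Sp s₀, (v : V) ∈ X.space s → ‖T v‖ ≤ K * X.nrm s v) →
      ∀ ε ∈ Ico 0 ε', ∀ lam ∈ I, ∀ u : X.Sp (s₀ + ν), (u : V) ∈ X.space (s + ν) →
        X.nrm s₀ u ≤ 1 →
      ‖T (F ε lam u)‖ ≤ K * C * (ε + X.nrm (s + ν) u) ∧
      ‖T (derivWithin (fun l => F ε l u) I lam)‖ ≤ K * C * (1 + X.nrm (s + ν) u) ∧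
      ∀ h : X.Sp (s₀ + ν), (h : V) ∈ X.space (s + ν) →
      ‖T (fderiv ℝ (F ε lam) u h)‖ ≤ K * C * (X.nrm (s + ν) u * X.nrm s₀ h + X.nrm (s + ν) h) ∧
      ‖T (derivWithin (fun l => fderiv ℝ (F ε l) u h) I lam)‖ ≤
        K * C * (X.nrm (s + ν) h + X.nrm (s + ν) u * X.nrm s₀ h) ∧
      ∀ v : X.Sp (s₀ + ν), (v : V) ∈ X.space (s + ν) →
      ‖T (fderiv ℝ (fun w => fderiv ℝ (F ε lam) w) u h v)‖ ≤
        K * C * (X.nrm (s + ν) u * X.nrm s₀ h * X.nrm s₀ v + X.nrm (s + ν) h * X.nrm s₀ v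
          + X.nrm s₀ h * X.nrm (s + ν) v) := by
  obtain ⟨C₀, hC₀⟩ := hF.F1_eps s hs hsS
  obtain ⟨C₁, hC₁⟩ := hF.F1 s hs hsS
  obtain ⟨C₂, hC₂⟩ := hF.F2 s hs hsS
  obtain ⟨C₃, hC₃⟩ := hF.F3 s hs hsS
  obtain ⟨C₄, hC₄⟩ := hF.F4 s hs hsS
  set M := 1 + |C₀| + |C₁| + |C₂| + |C₃| + |C₄| with hM
  have i0 : C₀ ≤ M := by
    linarith [le_abs_self C₀, abs_nonneg C₁, abs_nonneg C₂, abs_nonneg C₃, abs_nonneg C₄]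
  have i1 : C₁ ≤ M := by
    linarith [le_abs_self C₁, abs_nonneg C₀, abs_nonneg C₂, abs_nonneg C₃, abs_nonneg C₄]
  have i2 : C₂ ≤ M := by
    linarith [le_abs_self C₂, abs_nonneg C₁, abs_nonneg C₀, abs_nonneg C₃, abs_nonneg C₄]
  have i3 : C₃ ≤ M := by
    linarith [le_abs_self C₃, abs_nonneg C₁, abs_nonneg C₂, abs_nonneg C₀, abs_nonneg C₄]
  have i4 : C₄ ≤ M := by
    linarith [le_abs_self C₄, abs_nonneg C₁, abs_nonneg C₂, abs_nonneg C₃, abs_nonneg C₀]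
  have hM1 : 1 ≤ M := by
    linarith [abs_nonneg C₀, abs_nonneg C₁, abs_nonneg C₂, abs_nonneg C₃, abs_nonneg C₄]
  clear_value M
  -- Integrating (F3) and adding (F2) bounds `D_u F` with constant `2 * M`; integrating once more,
  -- with `‖u‖_{s₀} ≤ 1`, bounds `F` with `4 * M`.
  refine ⟨4 * M, by linarith, ?_⟩
  intro H _ _ T K hK hT ε hε lam hlam
  have hs0ν : s₀ ≤ s₀ + ν := le_self_add
  have hmem : ∀ u : X.Sp (s₀ + ν), (u : V) ∈ X.space s₀ := fun u => X.space_anti _ _ hs0ν u.2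
  have hnn : ∀ u : X.Sp (s₀ + ν), 0 ≤ X.nrm s₀ u := fun u => X.nrm_nonneg _ _ (hmem u)
  have hle : ∀ u : X.Sp (s₀ + ν), (u : V) ∈ X.space (s + ν) →
      X.nrm s₀ u ≤ X.nrm (s + ν) u := fun u hu =>
    X.nrm_mono _ _ (hs.trans le_self_add) _ hu
  have hΦ := hF.contDiffOn_fixed hε
  have hsm : ∀ (a : ℝ) (u : X.Sp (s₀ + ν)), ((a • u : X.Sp (s₀ + ν)) : V) = a • (u : V) :=
    fun a u => rfl
  have h3 : ∀ u : X.Sp (s₀ + ν), (u : V) ∈ X.space (s + ν) → X.nrm s₀ u ≤ 1 →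
      ∀ h : X.Sp (s₀ + ν), (h : V) ∈ X.space (s + ν) →
      ∀ v : X.Sp (s₀ + ν), (v : V) ∈ X.space (s + ν) →
      ‖T (fderiv ℝ (fun w => fderiv ℝ (F ε lam) w) u h v)‖ ≤
        K * M * (X.nrm (s + ν) u * X.nrm s₀ h * X.nrm s₀ v + X.nrm (s + ν) h * X.nrm s₀ v
          + X.nrm s₀ h * X.nrm (s + ν) v) := by
    intro u hu hu1 h hh v hv
    obtain ⟨a, b⟩ := hC₃ ε hε lam hlam u h v hu hh hv hu1
    have := X.nrm_nonneg _ _ hu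
    have := X.nrm_nonneg _ _ hh
    have := X.nrm_nonneg _ _ hv
    have := hnn h
    have := hnn v
    refine (hT _ a).trans ?_
    rw [mul_assoc]
    gcongr
    refine b.trans ?_
    gcongr
  have h2 : ∀ u : X.Sp (s₀ + ν), (u : V) ∈ X.space (s + ν) → X.nrm s₀ u ≤ 1 →
      ∀ h : X.Sp (s₀ + ν), (h : V) ∈ X.space (s + ν) →
      ‖T (fderiv ℝ (F ε lam) u h)‖ ≤
        K * (2 * M) * (X.nrm (s + ν) u * X.nrm s₀ h + X.nrm (s + ν) h) := by
    intro u hu hu1 h hh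
    have p1 := X.nrm_nonneg _ _ hu
    have p2 := X.nrm_nonneg _ _ hh
    have p3 := hnn h
    have p4 := hnn u
    have e1 : ‖T (fderiv ℝ (F ε lam) 0 h)‖ ≤ K * (M * X.nrm (s + ν) h) := by
      obtain ⟨a, b⟩ := hC₂ ε hε lam hlam h hh
      refine (hT _ a).trans ?_
      gcongr
      exact b.trans (by gcongr)
    have e2 := norm_map_fderiv_sub_le T (differentiable_fderiv_slice hΦ hlam) 0 u h
      (M := K * M * (2 * (X.nrm (s + ν) u * X.nrm s₀ h) + X.nrm (s + ν) h)) ?_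
    · rw [zero_add, map_sub] at e2
      have e3 : ‖T (fderiv ℝ (F ε lam) u h)‖ ≤ ‖T (fderiv ℝ (F ε lam) u h) -
          T (fderiv ℝ (F ε lam) 0 h)‖ + ‖T (fderiv ℝ (F ε lam) 0 h)‖ := by
        simpa using norm_add_le (T (fderiv ℝ (F ε lam) u h) - T (fderiv ℝ (F ε lam) 0 h))
          (T (fderiv ℝ (F ε lam) 0 h))
      refine e3.trans ((add_le_add e2 e1).trans (le_of_eq ?_))
      ring
    · intro t ht
      have c1 : X.nrm s₀ ((t • u : X.Sp (s₀ + ν)) : V) ≤ X.nrm s₀ u := by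
        rw [hsm, X.nrm_smul _ _ _ (hmem u), abs_of_nonneg ht.1]
        exact mul_le_of_le_one_left p4 ht.2
      have c2 : X.nrm (s + ν) ((t • u : X.Sp (s₀ + ν)) : V) ≤ X.nrm (s + ν) u := by
        rw [hsm, X.nrm_smul _ _ _ hu, abs_of_nonneg ht.1]
        exact mul_le_of_le_one_left p1 ht.2
      rw [zero_add]
      refine (h3 (t • u) ((X.space (s + ν)).smul_mem _ hu) (c1.trans hu1) u hu h hh).trans ?_
      have : K * M * (X.nrm (s + ν) ((t • u : X.Sp (s₀ + ν)) : V) * X.nrm s₀ u * X.nrm s₀ h +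
          X.nrm (s + ν) u * X.nrm s₀ h + X.nrm s₀ u * X.nrm (s + ν) h) ≤
          K * M * (X.nrm (s + ν) u * 1 * X.nrm s₀ h +
          X.nrm (s + ν) u * X.nrm s₀ h + 1 * X.nrm (s + ν) h) := by gcongr
      refine this.trans (le_of_eq ?_)
      ring
  intro u hu hu1
  have p1 := X.nrm_nonneg _ _ hu
  have p4 := hnn u
  refine ⟨?_, ?_, fun h hh => ⟨?_, ?_, fun v hv => ?_⟩⟩
  -- Integration in `ε` from `F(0, λ, 0) = 0`. The factor `ε` is the source of the smallness that
  -- starts the iteration.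
  · have e1 : ‖T (F ε lam 0)‖ ≤ K * M * ε := by
      have := norm_map_sub_le_of_derivWithin T (convex_Ico 0 ε') (hF.differentiableOn_eps hlam)
        (M := K * M) (fun e he => ?_) (a := 0) (b := ε) ⟨le_rfl, hε.1.trans_lt hε.2⟩ hε
      · rwa [hF.F0 lam hlam, sub_zero, sub_zero, abs_of_nonneg hε.1] at this
      · obtain ⟨a, b⟩ := hC₀ e he lam hlam
        refine (hT _ a).trans ?_
        gcongr
        exact b.trans i0
    have e2 := norm_map_sub_le_of_fderiv T ((contDiff_slice hΦ hlam).differentiable two_ne_zero) 0 u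
      (M := K * (2 * M) * (2 * X.nrm (s + ν) u)) ?_
    · rw [zero_add, map_sub] at e2
      have e3 : ‖T (F ε lam u)‖ ≤ ‖T (F ε lam u) - T (F ε lam 0)‖ + ‖T (F ε lam 0)‖ := by
        simpa using norm_add_le (T (F ε lam u) - T (F ε lam 0)) (T (F ε lam 0))
      refine e3.trans ((add_le_add e2 e1).trans ?_)
      have : 0 ≤ K * M * ε := by have := hε.1; positivity
      linarith
    · intro t ht
      have c1 : X.nrm s₀ ((t • u : X.Sp (s₀ + ν)) : V) ≤ X.nrm s₀ u := by
        rw [hsm, X.nrm_smul _ _ _ (hmem u), abs_of_nonneg ht.1]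
        exact mul_le_of_le_one_left p4 ht.2
      have c2 : X.nrm (s + ν) ((t • u : X.Sp (s₀ + ν)) : V) ≤ X.nrm (s + ν) u := by
        rw [hsm, X.nrm_smul _ _ _ hu, abs_of_nonneg ht.1]
        exact mul_le_of_le_one_left p1 ht.2
      rw [zero_add]
      refine (h2 (t • u) ((X.space (s + ν)).smul_mem _ hu) (c1.trans hu1) u hu).trans ?_
      have : K * (2 * M) * (X.nrm (s + ν) ((t • u : X.Sp (s₀ + ν)) : V) * X.nrm s₀ u +
          X.nrm (s + ν) u) ≤ K * (2 * M) * (X.nrm (s + ν) u * 1 + X.nrm (s + ν) u) := by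
        gcongr
      refine this.trans (le_of_eq ?_)
      ring
  · obtain ⟨a, b⟩ := hC₁ ε hε lam hlam u hu hu1
    refine (hT _ a).trans ?_
    rw [mul_assoc]
    gcongr
    refine b.trans ?_
    gcongr
    linarith
  · have p2 := X.nrm_nonneg _ _ hh
    have p3 := hnn h
    refine (h2 u hu hu1 h hh).trans ?_
    gcongr
    linarith
  · have p2 := X.nrm_nonneg _ _ hh
    have p3 := hnn h
    obtain ⟨a, b⟩ := hC₄ ε hε lam hlam u h hu hh hu1
    refine (hT _ a).trans ?_
    rw [mul_assoc]
    gcongr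
    refine b.trans ?_
    gcongr
    linarith
  · have p2 := X.nrm_nonneg _ _ hh
    have p3 := hnn h
    have p5 := X.nrm_nonneg _ _ hv
    have p6 := hnn v
    refine (h3 u hu hu1 h hh v hv).trans ?_
    gcongr
    linarith

end IsTame

end BanachScale

/-! ### The truncated maps form tame families -/

namespace BanachScale

variable {V : Type*} [AddCommGroup V] [Module ℝ V] {X : BanachScale V} (P : X.Smoothing)
  {s₀ ν s₁ : ℝ≥0} {S' : ℝ≥0∞} {ε' : ℝ} {I : Set ℝ} {F : ℝ → ℝ → X.Sp (s₀ + ν) → X.Sp s₀}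

/-- The truncated map `Π^(N) F(ε, λ, ·)` on `E^(N)`. -/
noncomputable def truncMap {N : ℕ} (hN : 1 ≤ N) (s₁ : ℝ≥0)
    (F : ℝ → ℝ → X.Sp (s₀ + ν) → X.Sp s₀) (ε lam : ℝ) (u : P.EB N s₁) : P.EB N s₁ :=
  P.toEB hN s₀ s₁ (F ε lam (P.ofEB hN s₁ (s₀ + ν) u))

theorem contDiffOn_truncMap (hF : X.IsTame S' ε' I F) {N : ℕ} (hN : 1 ≤ N) {ε : ℝ}
    (hε : ε ∈ Ico 0 ε') :
    ContDiffOn ℝ 2 (fun p : ℝ × P.EB N s₁ => truncMap P hN s₁ F ε p.1 p.2) (I ×ˢ univ) := by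
  refine (P.toEB hN s₀ s₁).contDiff.comp_contDiffOn ?_
  refine (hF.contDiffOn_fixed hε).comp
    (f := fun p : ℝ × P.EB N s₁ => (p.1, P.ofEB hN s₁ (s₀ + ν) p.2)) ?_
    (fun p hp => ⟨hp.1, mem_univ _⟩)
  exact (contDiff_fst.prodMk ((P.ofEB hN s₁ (s₀ + ν)).contDiff.comp contDiff_snd)).contDiffOn

theorem derivWithin_truncMap (hF : X.IsTame S' ε' I F) (hI : UniqueDiffOn ℝ I) {N : ℕ}
    (hN : 1 ≤ N) {ε lam : ℝ} (hε : ε ∈ Ico 0 ε') (hl : lam ∈ I) (u : P.EB N s₁) :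
    derivWithin (fun l => truncMap P hN s₁ F ε l u) I lam = P.toEB hN s₀ s₁
      (derivWithin (fun l => F ε l (P.ofEB hN s₁ (s₀ + ν) u)) I lam) := by
  have h1 := (hasDerivWithinAt_fst two_ne_zero (hF.contDiffOn_fixed hε) hl
    (P.ofEB hN s₁ (s₀ + ν) u)).differentiableWithinAt.hasDerivWithinAt
  exact ((P.toEB hN s₀ s₁).hasFDerivAt.comp_hasDerivWithinAt lam h1).derivWithin (hI lam hl)

theorem fderiv_truncMap (hF : X.IsTame S' ε' I F) {N : ℕ}
    (hN : 1 ≤ N) {ε lam : ℝ} (hε : ε ∈ Ico 0 ε') (hl : lam ∈ I) (u h : P.EB N s₁) :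
    fderiv ℝ (truncMap P hN s₁ F ε lam) u h = P.toEB hN s₀ s₁
      (fderiv ℝ (F ε lam) (P.ofEB hN s₁ (s₀ + ν) u) (P.ofEB hN s₁ (s₀ + ν) h)) :=
  fderiv_clm_comp_comp ((contDiff_slice (hF.contDiffOn_fixed hε) hl).differentiable two_ne_zero)
    _ _ u h

theorem fderiv_fderiv_truncMap (hF : X.IsTame S' ε' I F) {N : ℕ}
    (hN : 1 ≤ N) {ε lam : ℝ} (hε : ε ∈ Ico 0 ε') (hl : lam ∈ I) (u h v : P.EB N s₁) :
    fderiv ℝ (fun w => fderiv ℝ (truncMap P hN s₁ F ε lam) w) u h v = P.toEB hN s₀ s₁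
      (fderiv ℝ (fun w => fderiv ℝ (F ε lam) w) (P.ofEB hN s₁ (s₀ + ν) u)
        (P.ofEB hN s₁ (s₀ + ν) h) (P.ofEB hN s₁ (s₀ + ν) v)) :=
  fderiv_fderiv_clm_comp_comp (contDiff_slice (hF.contDiffOn_fixed hε) hl) _ _ u h v

theorem derivWithin_fderiv_truncMap (hF : X.IsTame S' ε' I F) (hI : UniqueDiffOn ℝ I) {N : ℕ}
    (hN : 1 ≤ N) {ε lam : ℝ} (hε : ε ∈ Ico 0 ε') (hl : lam ∈ I) (u h : P.EB N s₁) :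
    derivWithin (fun l => fderiv ℝ (truncMap P hN s₁ F ε l) u h) I lam = P.toEB hN s₀ s₁
      (derivWithin (fun l => fderiv ℝ (F ε l) (P.ofEB hN s₁ (s₀ + ν) u)
        (P.ofEB hN s₁ (s₀ + ν) h)) I lam) := by
  have h1 := (differentiableOn_fderiv_slice hI (hF.contDiffOn_fixed hε)
    (P.ofEB hN s₁ (s₀ + ν) u) (P.ofEB hN s₁ (s₀ + ν) h) lam hl).hasDerivWithinAt
  have h2 := (P.toEB hN s₀ s₁).hasFDerivAt.comp_hasDerivWithinAt lam h1
  refine HasDerivWithinAt.derivWithin (h2.congr_of_eventuallyEq ?_ ?_) (hI lam hl)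
  · filter_upwards [self_mem_nhdsWithin] with l hl'
    exact fderiv_truncMap P hF hN hε hl' u h
  · exact fderiv_truncMap P hF hN hε hl u h

theorem norm_EB {N : ℕ} (u : P.EB N s₁) : ‖u‖ = X.nrm s₁ (u : X.Sp s₁) := rfl

theorem mem_space_EB {N : ℕ} (u : P.EB N s₁) (s : ℝ≥0) : ((u : X.Sp s₁) : V) ∈ X.space s :=
  P.E_le N s u.2

theorem exists_smoothing_EB (s ν : ℝ≥0) : ∃ C : ℝ, 1 ≤ C ∧ ∀ N : ℕ, 1 ≤ N →
    ∀ u ∈ P.E N, X.nrm (s + ν) u ≤ C * (N : ℝ) ^ (ν : ℝ) * X.nrm s u := by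
  obtain ⟨C, hC, h⟩ := P.proj_bound s (s + ν)
  refine ⟨C, hC, fun N hN u hu => ?_⟩
  have := h N hN u (P.E_le N s hu)
  rwa [P.proj_eq N u hu, add_tsub_cancel_left] at this

theorem one_le_rpow_natCast {N : ℕ} (hN : 1 ≤ N) {a : ℝ} (ha : 0 ≤ a) : 1 ≤ (N : ℝ) ^ a :=
  Real.one_le_rpow (by exact_mod_cast hN) ha

/-- On `E^(N)` the loss of `ν` derivatives becomes the factor `N ^ ν`: `‖u‖_{s+ν} ≤ C₂ * N ^ ν *
‖u‖_s`. The constant also contains the bound of the projector on `X_s` and the tame constant of `F`,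
and depends on neither `N` nor `ε`. -/
theorem exists_tameFamily (hF : X.IsTame S' ε' I F) (hI : UniqueDiffOn ℝ I) (hs₁ : s₀ ≤ s₁)
    {s : ℝ≥0} (hs : s₁ ≤ s) (hsS : (s : ℝ≥0∞) < S') :
    ∃ C : ℝ, 1 ≤ C ∧ ∀ (N : ℕ) (hN : 1 ≤ N), ∀ ε ∈ Ico 0 ε',
      TameFamily I (truncMap P hN s₁ F ε) (C * (N : ℝ) ^ (ν : ℝ)) (P.ofEB hN s₁ s) := by
  obtain ⟨C₁, hC₁, h1⟩ := P.proj_bound s s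
  obtain ⟨C₂, hC₂, h2⟩ := exists_smoothing_EB P s ν
  obtain ⟨C, hC, hb⟩ := hF.exists_bound (hs₁.trans hs) hsS
  refine ⟨C₁ * C * C₂, ?_, fun N hN ε hε => ?_⟩
  · exact one_le_mul_of_one_le_of_one_le (one_le_mul_of_one_le_of_one_le hC₁ hC) hC₂
  set Z := C₂ * (N : ℝ) ^ (ν : ℝ) with hZ
  have hZ1 : 1 ≤ Z := one_le_mul_of_one_le_of_one_le hC₂ (one_le_rpow_natCast hN ν.2)
  set T := (P.ofEB hN s₁ s).comp (P.toEB hN s₀ s₁) with hTdef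
  have hT : ∀ v : X.Sp s₀, (v : V) ∈ X.space s → ‖T v‖ ≤ C₁ * X.nrm s v := by
    intro v hv
    have := h1 N hN v hv
    rw [tsub_self, NNReal.coe_zero, Real.rpow_zero, mul_one] at this
    change ‖P.ofEB hN s₁ s (P.toEB hN s₀ s₁ v)‖ ≤ _
    rwa [P.norm_ofEB]
  have hb' := fun l hl u => hb T C₁ (by linarith) hT ε hε l hl u
  have hn : ∀ u : P.EB N s₁, X.nrm s₀ ((P.ofEB hN s₁ (s₀ + ν) u : X.Sp (s₀ + ν)) : V) ≤ ‖u‖ := by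
    intro u
    rw [P.val_ofEB]
    exact X.nrm_mono _ _ hs₁ _ (mem_space_EB P u s₁)
  have hn0 : ∀ u : P.EB N s₁, 0 ≤ X.nrm s₀ ((P.ofEB hN s₁ (s₀ + ν) u : X.Sp (s₀ + ν)) : V) :=
    fun u => by
      rw [P.val_ofEB]
      exact X.nrm_nonneg _ _ (mem_space_EB P u _)
  have hm : ∀ u : P.EB N s₁, ((P.ofEB hN s₁ (s₀ + ν) u : X.Sp (s₀ + ν)) : V) ∈ X.space (s + ν) :=
    fun u => by
      rw [P.val_ofEB]
      exact mem_space_EB P u _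
  have hz : ∀ u : P.EB N s₁, X.nrm (s + ν) ((P.ofEB hN s₁ (s₀ + ν) u : X.Sp (s₀ + ν)) : V) ≤
      Z * ‖P.ofEB hN s₁ s u‖ := by
    intro u
    rw [P.val_ofEB, P.norm_ofEB]
    exact h2 N hN _ u.2
  have hz0 : ∀ u : P.EB N s₁,
      0 ≤ X.nrm (s + ν) ((P.ofEB hN s₁ (s₀ + ν) u : X.Sp (s₀ + ν)) : V) := fun u =>
    X.nrm_nonneg _ _ (hm u)
  have hK : C₁ * C * C₂ * (N : ℝ) ^ (ν : ℝ) = C₁ * C * Z := by rw [hZ]; ring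
  rw [hK]
  have hC₁0 : 0 ≤ C₁ := by linarith
  have hC0 : 0 ≤ C := by linarith
  have hZ0 : 0 ≤ Z := by linarith
  constructor
  · intro t ht u hu
    rw [derivWithin_truncMap P hF hI hN hε ht]
    have := (hb' t ht _ (hm u) ((hn u).trans hu)).2.1
    refine this.trans ?_
    rw [mul_assoc (C₁ * C)]
    gcongr
    have := hz u
    linarith
  · intro t ht u hu h
    rw [fderiv_truncMap P hF hN hε ht]
    have := ((hb' t ht _ (hm u) ((hn u).trans hu)).2.2 _ (hm h)).1
    refine this.trans ?_
    rw [mul_assoc (C₁ * C)]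
    gcongr
    have a1 := hz u
    have a2 := hz h
    have a3 := hn h
    have := hn0 h
    have a4 : X.nrm (s + ν) ((P.ofEB hN s₁ (s₀ + ν) u : X.Sp (s₀ + ν)) : V) *
      X.nrm s₀ ((P.ofEB hN s₁ (s₀ + ν) h : X.Sp (s₀ + ν)) : V) ≤
      (Z * ‖P.ofEB hN s₁ s u‖) * ‖h‖ := by gcongr
    linarith
  · intro t ht u hu h v
    rw [fderiv_fderiv_truncMap P hF hN hε ht]
    have := ((hb' t ht _ (hm u) ((hn u).trans hu)).2.2 _ (hm h)).2.2 _ (hm v)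
    refine this.trans ?_
    rw [mul_assoc (C₁ * C)]
    gcongr
    have a1 := hz u
    have a2 := hz h
    have a3 := hz v
    have b1 := hn h
    have b2 := hn v
    have b3 := hn0 h
    have b4 := hn0 v
    have := hz0 v
    have a4 : X.nrm (s + ν) ((P.ofEB hN s₁ (s₀ + ν) u : X.Sp (s₀ + ν)) : V) *
      X.nrm s₀ ((P.ofEB hN s₁ (s₀ + ν) h : X.Sp (s₀ + ν)) : V) *
      X.nrm s₀ ((P.ofEB hN s₁ (s₀ + ν) v : X.Sp (s₀ + ν)) : V) ≤
      (Z * ‖P.ofEB hN s₁ s u‖) * ‖h‖ * ‖v‖ := by gcongr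
    have a5 : X.nrm (s + ν) ((P.ofEB hN s₁ (s₀ + ν) h : X.Sp (s₀ + ν)) : V) *
      X.nrm s₀ ((P.ofEB hN s₁ (s₀ + ν) v : X.Sp (s₀ + ν)) : V) ≤
      (Z * ‖P.ofEB hN s₁ s h‖) * ‖v‖ := by gcongr
    have a6 : X.nrm s₀ ((P.ofEB hN s₁ (s₀ + ν) h : X.Sp (s₀ + ν)) : V) *
      X.nrm (s + ν) ((P.ofEB hN s₁ (s₀ + ν) v : X.Sp (s₀ + ν)) : V) ≤
      ‖h‖ * (Z * ‖P.ofEB hN s₁ s v‖) := by gcongr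
    linarith
  · intro t ht u hu h
    rw [derivWithin_fderiv_truncMap P hF hI hN hε ht]
    have := ((hb' t ht _ (hm u) ((hn u).trans hu)).2.2 _ (hm h)).2.1
    refine this.trans ?_
    rw [mul_assoc (C₁ * C)]
    gcongr
    have a1 := hz u
    have a2 := hz h
    have a3 := hn h
    have := hn0 h
    have a4 : X.nrm (s + ν) ((P.ofEB hN s₁ (s₀ + ν) u : X.Sp (s₀ + ν)) : V) *
      X.nrm s₀ ((P.ofEB hN s₁ (s₀ + ν) h : X.Sp (s₀ + ν)) : V) ≤
      (Z * ‖P.ofEB hN s₁ s u‖) * ‖h‖ := by gcongr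
    linarith

end BanachScale

/-! ### Change of seminorm and constant in a tame family -/

section TameFamilyTransfer

variable {E G H : Type*} [NormedAddCommGroup E] [NormedSpace ℝ E] [NormedAddCommGroup G]
  [NormedSpace ℝ G] [NormedAddCommGroup H] [NormedSpace ℝ H] {I : Set ℝ} {Φ : ℝ → E → E} {κ κ' : ℝ}

theorem TameFamily.mono {j : E →L[ℝ] G} {i : E →L[ℝ] H} (h : TameFamily I Φ κ j)
    (hij : ∀ x, ‖j x‖ = ‖i x‖) (hκ : κ ≤ κ') : TameFamily I Φ κ' i := by
  constructor
  · intro t ht u hu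
    rw [← hij, ← hij]
    exact (h.param t ht u hu).trans (by gcongr)
  · intro t ht u hu f
    rw [← hij, ← hij, ← hij]
    exact (h.fst t ht u hu f).trans (by gcongr)
  · intro t ht u hu f g
    rw [← hij, ← hij, ← hij, ← hij]
    exact (h.snd t ht u hu f g).trans (by gcongr)
  · intro t ht u hu f
    rw [← hij, ← hij, ← hij]
    exact (h.mixed t ht u hu f).trans (by gcongr)

end TameFamilyTransfer

/-! ### Good parameters and invariant subspaces in the truncations -/

namespace BanachScale

variable {V : Type*} [AddCommGroup V] [Module ℝ V] {X : BanachScale V} (P : X.Smoothing)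
  {s₀ ν s₁ : ℝ≥0} {S' : ℝ≥0∞} {ε' : ℝ} {I : Set ℝ} {F : ℝ → ℝ → X.Sp (s₀ + ν) → X.Sp s₀}

theorem exists_tameFamily_pair (hF : X.IsTame S' ε' I F) (hI : UniqueDiffOn ℝ I) (hs₁ : s₀ ≤ s₁)
    {s : ℝ≥0} (hs : s₁ ≤ s) (hsS : (s : ℝ≥0∞) < S') :
    ∃ C : ℝ, 1 ≤ C ∧ ∀ (N : ℕ) (hN : 1 ≤ N), ∀ ε ∈ Ico 0 ε',
      TameFamily I (truncMap P hN s₁ F ε) (C * (N : ℝ) ^ (ν : ℝ))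
        (ContinuousLinearMap.id ℝ (P.EB N s₁)) ∧
      TameFamily I (truncMap P hN s₁ F ε) (C * (N : ℝ) ^ (ν : ℝ)) (P.ofEB hN s₁ s) := by
  obtain ⟨C, hC, h⟩ := exists_tameFamily P hF hI hs₁ hs hsS
  obtain ⟨C', hC', h'⟩ := exists_tameFamily P hF hI hs₁ (s := s₁) le_rfl
    (lt_of_le_of_lt (by exact_mod_cast hs) hsS)
  refine ⟨max C C', hC.trans (le_max_left _ _), fun N hN ε hε => ⟨?_, ?_⟩⟩
  · exact (h' N hN ε hε).mono (fun x => P.norm_ofEB hN s₁ s₁ x) (by gcongr; exact le_max_right _ _)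
  · exact (h N hN ε hε).mono (fun x => rfl) (by gcongr; exact le_max_left _ _)

/-- Only the indices `s₁` and `S` of the tame bounds are used. At `s₁` the bound `‖u‖_{s₁} ≤ 1`
turns the bracket into at most `2 * ‖h‖_{s₁}`, whence the factor `2`; the summand `1` keeps the
constant positive whatever the signs of `C`. -/
theorem tameInvertible_of_mem_goodSet (hF : X.IsTame S' ε' I F) {N : ℕ} (hN : 1 ≤ N) {ε lam : ℝ}
    (hε : ε ∈ Ico 0 ε') {S : ℝ≥0} (hS : s₁ ≤ S) {τ δ B : ℝ} {C : ℝ≥0 → ℝ} {u : ℝ → V}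
    (hl : lam ∈ goodSet P F I s₁ S τ δ C N ε u) (w : P.EB N s₁)
    (hw : ((w : X.Sp s₁) : V) = u lam) (hB : ‖P.ofEB hN s₁ S w‖ ≤ B) :
    TameInvertible (fderiv ℝ (truncMap P hN s₁ F ε lam) w) (P.ofEB hN s₁ S)
      (2 * (|C s₁| + |C S| + 1) * (N : ℝ) ^ (τ + δ * s₁)) ((N : ℝ) ^ (δ * ((S : ℝ) - s₁)) * B) := by
  obtain ⟨hlI, hu, -, hu1, L, hL, hLb⟩ := hl
  have hcomp := P.completeSpace_EB hN s₁
  have hofLE : P.ofEB hN s₁ (s₀ + ν) w = X.ofLE (P.E_le N (s₀ + ν)) (⟨u lam, hu⟩ : P.E N) :=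
    Subtype.ext (by rw [P.val_ofEB, hw]; rfl)
  have hofLE' : ∀ g : P.EB N s₁, P.ofEB hN s₁ (s₀ + ν) g =
      X.ofLE (P.E_le N (s₀ + ν)) (⟨((g : X.Sp s₁) : V), g.2⟩ : P.E N) := fun g =>
    Subtype.ext (by rw [P.val_ofEB]; rfl)
  have hLg : ∀ g : P.EB N s₁,
      ((fderiv ℝ (truncMap P hN s₁ F ε lam) w g : P.EB N s₁) : X.Sp s₁).1 =
      (L ⟨((g : X.Sp s₁) : V), g.2⟩ : V) := by
    intro g
    rw [fderiv_truncMap P hF hN hε hlI]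
    have e : L ⟨((g : X.Sp s₁) : V), g.2⟩ =
        linOp P F N ε lam ⟨u lam, hu⟩ ⟨((g : X.Sp s₁) : V), g.2⟩ := by
      rw [← hL]; rfl
    rw [e, P.val_toEB, hofLE, hofLE' g]
    rfl
  have hNp : 0 ≤ (N : ℝ) ^ (τ + δ * s₁) := by positivity
  have hb : ∀ g : P.EB N s₁, ∀ s ∈ Icc s₁ S, X.nrm s ((g : X.Sp s₁) : V) ≤
      |C s| * (N : ℝ) ^ (τ + δ * s₁) *
        (X.nrm s ((fderiv ℝ (truncMap P hN s₁ F ε lam) w g : P.EB N s₁) : X.Sp s₁).1 +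
          (N : ℝ) ^ (δ * ((s : ℝ) - s₁)) * X.nrm s (u lam) *
          ‖fderiv ℝ (truncMap P hN s₁ F ε lam) w g‖) := by
    intro g s hs
    have := hLb s hs (L ⟨((g : X.Sp s₁) : V), g.2⟩)
    rw [L.symm_apply_apply, ← hLg] at this
    have n1 := X.nrm_nonneg s _
      (mem_space_EB P (fderiv ℝ (truncMap P hN s₁ F ε lam) w g) s)
    have n2 := X.nrm_nonneg s _ (P.E_le N s hu)
    refine this.trans ?_
    rw [norm_EB]
    have n3 := X.nrm_nonneg s₁ _
      (mem_space_EB P (fderiv ℝ (truncMap P hN s₁ F ε lam) w g) s₁)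
    gcongr
    exact le_abs_self _
  refine ⟨?_, fun g => ⟨?_, ?_⟩⟩
  · rw [ContinuousLinearMap.isUnit_iff_bijective]
    constructor
    · intro g g' hgg
      have h1 : L ⟨((g : X.Sp s₁) : V), g.2⟩ = L ⟨((g' : X.Sp s₁) : V), g'.2⟩ :=
        Subtype.ext (by rw [← hLg, ← hLg, hgg])
      have h2 := congrArg Subtype.val (L.injective h1)
      exact Subtype.ext (Subtype.ext h2)
    · intro f
      obtain ⟨⟨g, hg⟩, hLgf⟩ := L.surjective ⟨((f : X.Sp s₁) : V), f.2⟩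
      refine ⟨⟨X.toSp g (P.E_le N s₁ hg), hg⟩, Subtype.ext (Subtype.ext ?_)⟩
      rw [hLg]
      exact congrArg Subtype.val hLgf
  · have := hb g s₁ ⟨le_rfl, hS⟩
    rw [sub_self, mul_zero, Real.rpow_zero, one_mul, ← norm_EB, ← norm_EB] at this
    refine this.trans ?_
    have hu1' : X.nrm s₁ (u lam) ≤ 1 := hu1
    set a := ‖fderiv ℝ (truncMap P hN s₁ F ε lam) w g‖ with ha
    have ha0 : 0 ≤ a := norm_nonneg _
    calc |C s₁| * (N : ℝ) ^ (τ + δ * s₁) * (a + X.nrm s₁ (u lam) * a)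
        ≤ |C s₁| * (N : ℝ) ^ (τ + δ * s₁) * (a + 1 * a) := by gcongr
      _ = 2 * |C s₁| * (N : ℝ) ^ (τ + δ * s₁) * a := by ring
      _ ≤ 2 * (|C s₁| + |C S| + 1) * (N : ℝ) ^ (τ + δ * s₁) * a := by
        gcongr
        linarith [abs_nonneg (C S)]
  · have := hb g S ⟨hS, le_rfl⟩
    rw [P.norm_ofEB, P.norm_ofEB]
    refine this.trans ?_
    rw [P.norm_ofEB, hw] at hB
    have n1 := X.nrm_nonneg S _
      (mem_space_EB P (fderiv ℝ (truncMap P hN s₁ F ε lam) w g) S)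
    have n2 := X.nrm_nonneg S _ (P.E_le N S hu)
    have n3 := abs_nonneg (C s₁)
    have n4 := abs_nonneg (C S)
    gcongr
    linarith

/-- The trace on `E^(N)` of an invariant family. -/
def traceEB (Y : Submodule ℝ V) (N : ℕ) (s : ℝ≥0) : Submodule ℝ (P.EB N s) :=
  Y.comap ((X.val s) ∘ₗ (P.EB N s).subtype)

theorem IsInvariant.mem_iff {P : X.Smoothing} {ε₀ : ℝ} {Y : ℝ≥0 → Submodule ℝ V}
    (hY : IsInvariant P S' ε₀ I F Y) {s t : ℝ≥0} {u : V} (ht : u ∈ X.space t) (hs : u ∈ Y s) :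
    u ∈ Y t := by
  have h0 : u ∈ Y 0 := by
    have := hY.inter 0 s (zero_le)
    rw [this] at hs
    exact hs.1
  rw [hY.inter 0 t (zero_le)]
  exact ⟨h0, ht⟩

theorem IsInvariant.finiteDimensional_trace {P : X.Smoothing} {ε₀ : ℝ} {Y : ℝ≥0 → Submodule ℝ V}
    (hY : IsInvariant P S' ε₀ I F Y) (N : ℕ) (s t : ℝ≥0) :
    FiniteDimensional ℝ (traceEB P (Y t) N s) := by
  have := hY.finite N t
  let f : traceEB P (Y t) N s →ₗ[ℝ] (P.E N ⊓ Y t : Submodule ℝ V) :=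
    { toFun := fun u => ⟨u.1.1.1, u.1.2, u.2⟩
      map_add' := fun _ _ => rfl
      map_smul' := fun _ _ => rfl }
  refine FiniteDimensional.of_injective f fun u v h => ?_
  have h' : (u.1.1.1 : V) = v.1.1.1 :=
    congrArg (fun x : (P.E N ⊓ Y t : Submodule ℝ V) => (x : V)) h
  exact Subtype.ext (Subtype.ext (Subtype.ext h'))

theorem IsInvariant.truncMap_mem {P : X.Smoothing} {ε₀ : ℝ} {Y : ℝ≥0 → Submodule ℝ V}
    (hY : IsInvariant P S' ε₀ I F Y) (hs₀ : (s₀ : ℝ≥0∞) < S') {N : ℕ} (hN : 1 ≤ N) {ε lam : ℝ}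
    (hε : ε ∈ Ico 0 ε₀) (hl : lam ∈ I) {u : P.EB N s₁} (hu : u ∈ traceEB P (Y s₀) N s₁) :
    truncMap P hN s₁ F ε lam u ∈ traceEB P (Y s₀) N s₁ := by
  refine hY.proj N s₀ hN _ (hY.map s₀ le_rfl hs₀ ε hε lam hl _ ?_)
  refine hY.mem_iff (Subtype.prop (P.ofEB hN s₁ (s₀ + ν) u)) (s := s₀) ?_
  rw [P.val_ofEB]
  exact hu

end BanachScale

/-! ### The Newton step in the scale, and the residuals -/

namespace BanachScale

variable {V : Type*} [AddCommGroup V] [Module ℝ V] {X : BanachScale V} (P : X.Smoothing)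
  {s₀ ν s₁ : ℝ≥0} {S' : ℝ≥0∞} {ε' : ℝ} {I : Set ℝ} {F : ℝ → ℝ → X.Sp (s₀ + ν) → X.Sp s₀}

/-- On `I` the curve equals its image under the bounded projector, so its derivative is fixed by the
projector. -/
theorem Smoothing.deriv_mem {N : ℕ} (hN : 1 ≤ N) {s : ℝ≥0} (hI : UniqueDiffOn ℝ I)
    {w : ℝ → X.Sp s} {w' : X.Sp s} {t : ℝ} (ht : t ∈ I) (hw : ∀ l ∈ I, (w l : V) ∈ P.E N)
    (hd : HasDerivWithinAt w w' I t) : (w' : V) ∈ P.E N := by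
  have h1 := (P.projL hN s s).hasFDerivAt.comp_hasDerivWithinAt t hd
  have h2 : HasDerivWithinAt w (P.projL hN s s w') I t := by
    refine h1.congr_of_eventuallyEq ?_ ?_
    · filter_upwards [self_mem_nhdsWithin] with l hl
      exact Subtype.ext (P.proj_eq N _ (hw l hl)).symm
    · exact Subtype.ext (P.proj_eq N _ (hw t ht)).symm
  have h3 : w' = P.projL hN s s w' := (hI t ht).eq_deriv I hd h2
  have h4 : (w' : V) = P.proj N w' := congrArg Subtype.val h3
  rw [h4]
  exact P.proj_mem N _

/-- One step of the iteration for the truncation `E^(N)` of the scale. -/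
theorem exists_scale_step (hF : X.IsTame S' ε' I F) (hI : UniqueDiffOn ℝ I) (hIc : Convex ℝ I)
    (hs₁ : s₀ ≤ s₁) {S : ℝ≥0} (hS : s₁ ≤ S) {N : ℕ} (hN : 1 ≤ N) {ε : ℝ} (hε : ε ∈ Ico 0 ε')
    {κ : ℝ} (hκ : 0 ≤ κ)
    (hT₁ : TameFamily I (truncMap P hN s₁ F ε) κ (ContinuousLinearMap.id ℝ (P.EB N s₁)))
    (hT : TameFamily I (truncMap P hN s₁ F ε) κ (P.ofEB hN s₁ S))
    {w w' : ℝ → X.Sp (s₁ + ν)} (hwE : ∀ l ∈ I, (w l : V) ∈ P.E N)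
    (hw : ∀ t ∈ I, HasDerivWithinAt w (w' t) I t) (hwc : ContinuousOn w' I)
    {D B B' ρ : ℝ} (hw1 : ∀ t ∈ I, X.nrm s₁ (w t) ≤ 1 - ρ) (hD : ∀ t ∈ I, X.nrm s₁ (w' t) ≤ D)
    (hB : ∀ t ∈ I, X.nrm S (w t) ≤ B) (hB' : ∀ t ∈ I, X.nrm S (w' t) ≤ B')
    (hD0 : 0 ≤ D) (hB0 : 0 ≤ B) (hB'0 : 0 ≤ B')
    {τ δ : ℝ} {C : ℝ≥0 → ℝ} {A : Set ℝ}
    (hA : A ⊆ goodSet P F I s₁ S τ δ C N ε (fun l => (w l : V)))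
    {α β : ℝ} (hα : α = 2 * (|C s₁| + |C S| + 1) * (N : ℝ) ^ (τ + δ * s₁))
    (hβ : β = (N : ℝ) ^ (δ * ((S : ℝ) - s₁)) * B) {r : ℝ} (hr : 0 < r)
    {r₁ rS r₁' : ℝ} (hr0 : 0 ≤ r₁) (hrS0 : 0 ≤ rS) (hr0' : 0 ≤ r₁')
    (hres : ∀ t ∈ I ∩ Metric.thickening (2 * r) A,
      X.nrm s₁ (P.proj N (F ε t (X.inclL (add_le_add_left hs₁ ν) (w t)) : X.Sp s₀)) ≤ r₁ ∧
      X.nrm S (P.proj N (F ε t (X.inclL (add_le_add_left hs₁ ν) (w t)) : X.Sp s₀)) ≤ rS ∧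
      X.nrm s₁ (P.proj N (derivWithin (fun l => F ε l (X.inclL (add_le_add_left hs₁ ν) (w t))) I t +
        fderiv ℝ (F ε t) (X.inclL (add_le_add_left hs₁ ν) (w t))
          (X.inclL (add_le_add_left hs₁ ν) (w' t)) : X.Sp s₀)) ≤ r₁')
    (hsmall : 12 * (α * r * κ * (1 + D)) ≤ 1) (hρ : ρ = 4 * α * r₁)
    (hsmall' : 12 * (α * κ * ρ) ≤ 1) (hρ1 : ρ ≤ 1) {β' H β'' G₁ : ℝ}
    (hβ' : 2 * β + 2 * α * (2 * r * κ * (B + B * D + B')) ≤ β')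
    (hH : 4 * α * (rS + B * r₁ + 2 * β' * r₁) ≤ H)
    (hβ'' : 2 * β' + 4 * α * (κ * (B * ρ + 2 * H)) ≤ β'')
    (hG₁ : r₁' + 3 * (κ * ρ) * (1 + D) ≤ G₁) :
    ∃ v v' : ℝ → X.Sp (s₁ + ν), (∀ t ∈ I, HasDerivWithinAt v (v' t) I t) ∧ ContinuousOn v' I ∧
      (∀ t, (v t : V) ∈ P.E N ∧ (v' t : V) ∈ P.E N) ∧
      (∀ t ∈ I ∩ Metric.thickening r A,
        P.proj N (F ε t (X.inclL (add_le_add_left hs₁ ν) (w t + v t)) : X.Sp s₀) = 0) ∧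
      (∀ t ∈ I, X.nrm s₁ (v t) ≤ ρ ∧ X.nrm S (v t) ≤ H ∧
        X.nrm s₁ (v' t) ≤ 4 / r * ρ + 4 * α * G₁ ∧
        X.nrm S (v' t) ≤ 4 / r * H +
          4 * α * (κ * (1 + (B + H) * (1 + D) + B') + β'' * G₁)) ∧
      ∀ (ε₀ : ℝ) (Y : ℝ≥0 → Submodule ℝ V), IsInvariant P S' ε₀ I F Y → (s₀ : ℝ≥0∞) < S' →
        ε < ε₀ → (∀ t ∈ I, (w t : V) ∈ Y s₀) → ∀ t ∈ I, (v t : V) ∈ Y s₀ := by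
  have hcomp := P.completeSpace_EB hN s₁
  set inc := X.inclL (add_le_add_left hs₁ ν) with hinc
  set W : ℝ → P.EB N s₁ := fun t => P.toEB hN (s₁ + ν) s₁ (w t) with hW
  set W' : ℝ → P.EB N s₁ := fun t => P.toEB hN (s₁ + ν) s₁ (w' t) with hW'
  have hw'E : ∀ t ∈ I, (w' t : V) ∈ P.E N := fun t ht => P.deriv_mem hN hI ht hwE (hw t ht)
  have vW : ∀ t ∈ I, ((W t : X.Sp s₁) : V) = w t := fun t ht => P.proj_eq N _ (hwE t ht)
  have vW' : ∀ t ∈ I, ((W' t : X.Sp s₁) : V) = w' t := fun t ht => P.proj_eq N _ (hw'E t ht)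
  have oW : ∀ t ∈ I, P.ofEB hN s₁ (s₀ + ν) (W t) = inc (w t) := fun t ht =>
    Subtype.ext (by rw [P.val_ofEB, vW t ht]; rfl)
  have oW' : ∀ t ∈ I, P.ofEB hN s₁ (s₀ + ν) (W' t) = inc (w' t) := fun t ht =>
    Subtype.ext (by rw [P.val_ofEB, vW' t ht]; rfl)
  have nEB : ∀ x : X.Sp s₀, ‖P.toEB hN s₀ s₁ x‖ = X.nrm s₁ (P.proj N x) := fun x => rfl
  have nEB' : ∀ x : X.Sp s₀, ‖P.ofEB hN s₁ S (P.toEB hN s₀ s₁ x)‖ = X.nrm S (P.proj N x) :=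
    fun x => by rw [P.norm_ofEB]; rfl
  have hα0 : 0 < α := by
    rw [hα]
    have : (0 : ℝ) < N := by exact_mod_cast hN
    have := abs_nonneg (C s₁)
    have := abs_nonneg (C S)
    positivity
  obtain ⟨v, v', h1, h2, h3, h4, h5⟩ := exists_newton_step hI hIc
    (contDiffOn_truncMap P hF hN hε) hκ hT₁ hT (w := W) (w' := W')
    (fun t ht => (P.toEB hN (s₁ + ν) s₁).hasFDerivAt.comp_hasDerivWithinAt t (hw t ht))
    ((P.toEB hN (s₁ + ν) s₁).continuous.comp_continuousOn hwc) (D := D) (B := B) (B' := B') (ρ := ρ)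
    (fun t ht => by rw [norm_EB, vW t ht]; exact hw1 t ht)
    (fun t ht => by rw [norm_EB, vW' t ht]; exact hD t ht)
    (fun t ht => by rw [P.norm_ofEB, vW t ht]; exact hB t ht)
    (fun t ht => by rw [P.norm_ofEB, vW' t ht]; exact hB' t ht) hD0 hB0 hB'0
    (A := A) (fun t ht => (hA ht).1) hα0 (β := β) (by rw [hβ]; positivity)
    (fun t ht => by
      have htI : t ∈ I := (hA ht).1
      rw [hα, hβ]
      refine tameInvertible_of_mem_goodSet P hF hN hε hS (hA ht) (W t) (vW t htI) ?_
      rw [P.norm_ofEB, vW t htI]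
      exact hB t htI) hr hr0 hrS0 hr0'
    (fun t ht => by
      obtain ⟨a, b, c⟩ := hres t ht
      rw [derivWithin_truncMap P hF hI hN hε ht.1, fderiv_truncMap P hF hN hε ht.1, ← map_add,
        truncMap, oW t ht.1, oW' t ht.1, nEB, nEB', nEB]
      exact ⟨a, b, c⟩) hsmall hρ hsmall' hρ1 hβ' hH hβ'' hG₁
  refine ⟨fun t => P.ofEB hN s₁ (s₁ + ν) (v t), fun t => P.ofEB hN s₁ (s₁ + ν) (v' t),
    fun t ht => (P.ofEB hN s₁ (s₁ + ν)).hasFDerivAt.comp_hasDerivWithinAt t (h1 t ht),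
    (P.ofEB hN s₁ (s₁ + ν)).continuous.comp_continuousOn h2, ?_, ?_, ?_, ?_⟩
  · intro t
    exact ⟨P.proj_mem N _, P.proj_mem N _⟩
  · intro t ht
    have e := h3 t ht
    have e2 : P.ofEB hN s₁ (s₀ + ν) (W t + v t) =
        inc (w t + P.ofEB hN s₁ (s₁ + ν) (v t)) := by
      rw [map_add, map_add, oW t ht.1]
      congr 1
    rw [truncMap, e2] at e
    exact congrArg (fun x : P.EB N s₁ => ((x : X.Sp s₁) : V)) e
  · intro t ht
    obtain ⟨a, b, c, d⟩ := h4 t ht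
    simp only [P.val_ofEB]
    rw [P.norm_ofEB] at b d
    exact ⟨a, b, c, d⟩
  · intro ε₀ Y hY hsS hεε hwY t ht
    have := h5 (traceEB P (Y s₀) N s₁) (hY.finiteDimensional_trace N s₁ s₀)
      (fun l hl => by
        change ((W l : X.Sp s₁) : V) ∈ Y s₀
        rw [vW l hl]
        exact hwY l hl)
      (fun l hl u hu => hY.truncMap_mem hsS hN ⟨hε.1, hεε⟩ hl hu) t ht
    simp only [P.val_ofEB]
    exact this

/-! Bounds on the residuals. -/

/-- At the start no earlier equation holds: the residual of `u = 0` is small only because of `ε`,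
and its `λ`-derivative is merely bounded. -/
theorem exists_residual_zero (hF : X.IsTame S' ε' I F) (hs₁ : s₀ ≤ s₁) {S : ℝ≥0}
    (hS : s₁ ≤ S) (hSS : (S : ℝ≥0∞) < S') :
    ∃ C : ℝ, 1 ≤ C ∧ ∀ N : ℕ, 1 ≤ N → ∀ ε ∈ Ico 0 ε', ∀ lam ∈ I,
      X.nrm s₁ (P.proj N (F ε lam 0 : X.Sp s₀)) ≤ C * ε ∧
      X.nrm S (P.proj N (F ε lam 0 : X.Sp s₀)) ≤ C * ε ∧
      X.nrm s₁ (P.proj N (derivWithin (fun l => F ε l 0) I lam : X.Sp s₀)) ≤ C := by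
  obtain ⟨C₁, hC₁, h1⟩ := P.proj_bound S S
  obtain ⟨C, hC, hb⟩ := hF.exists_bound (hs₁.trans hS) hSS
  refine ⟨C₁ * C, one_le_mul_of_one_le_of_one_le hC₁ hC, fun N hN ε hε lam hl => ?_⟩
  have hT : ∀ v : X.Sp s₀, (v : V) ∈ X.space S → ‖P.projL hN s₀ S v‖ ≤ C₁ * X.nrm S v := by
    intro v hv
    have := h1 N hN v hv
    rwa [tsub_self, NNReal.coe_zero, Real.rpow_zero, mul_one] at this
  have := hb (P.projL hN s₀ S) C₁ (by linarith) hT ε hε lam hl 0 (X.space _).zero_mem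
    (by change X.nrm s₀ 0 ≤ 1; rw [X.nrm_zero]; exact zero_le_one)
  have e0 : X.nrm (S + ν) ((0 : X.Sp (s₀ + ν)) : V) = 0 := X.nrm_zero _
  rw [e0, add_zero, add_zero, mul_one] at this
  obtain ⟨a, b, -⟩ := this
  exact ⟨(X.nrm_mono _ _ hS _ (P.E_le N S (P.proj_mem N _))).trans a, a,
    (X.nrm_mono _ _ hS _ (P.E_le N S (P.proj_mem N _))).trans b⟩

/-- What `Π^(M)` annihilates equals its own high-frequency part, so (P2) gains `M ^ (-(S - s₁))`,
while `u, h ∈ E^(M)` costs `M ^ ν` for passing from `S + ν` to `S`. -/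
theorem exists_residual (hF : X.IsTame S' ε' I F) (hs₁ : s₀ ≤ s₁) {S : ℝ≥0}
    (hS : s₁ ≤ S) (hSS : (S : ℝ≥0∞) < S') :
    ∃ C : ℝ, 1 ≤ C ∧ ∀ M N : ℕ, 1 ≤ M → 1 ≤ N → ∀ ε ∈ Ico 0 ε', ∀ lam ∈ I,
      ∀ u h : X.Sp (s₀ + ν), (u : V) ∈ P.E M → (h : V) ∈ P.E M → ∀ B D B' : ℝ,
      X.nrm s₁ u ≤ 1 → X.nrm S u ≤ B → X.nrm s₁ h ≤ D → X.nrm S h ≤ B' →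
      P.proj M (F ε lam u : X.Sp s₀) = 0 →
      P.proj M (derivWithin (fun l => F ε l u) I lam + fderiv ℝ (F ε lam) u h : X.Sp s₀) = 0 →
      X.nrm s₁ (P.proj N (F ε lam u : X.Sp s₀)) ≤ C * (M : ℝ) ^ (ν - (S - s₁) : ℝ) * (ε + B) ∧
      X.nrm S (P.proj N (F ε lam u : X.Sp s₀)) ≤ C * (M : ℝ) ^ (ν : ℝ) * (ε + B) ∧
      X.nrm s₁ (P.proj N (derivWithin (fun l => F ε l u) I lam + fderiv ℝ (F ε lam) u h :
        X.Sp s₀)) ≤ C * (M : ℝ) ^ (ν - (S - s₁) : ℝ) * (1 + B + B * D + B') := by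
  obtain ⟨C₁, hC₁, h1⟩ := P.proj_bound S S
  obtain ⟨C₂, hC₂, h2⟩ := P.proj_bound s₁ s₁
  obtain ⟨C₃, hC₃, h3⟩ := P.P2 s₁ (S - s₁)
  obtain ⟨C₄, hC₄, h4⟩ := exists_smoothing_EB P S ν
  obtain ⟨C, hC, hb⟩ := hF.exists_bound (hs₁.trans hS) hSS
  have hC₃0 : 0 ≤ C₂ * C₃ := by positivity
  refine ⟨(C₁ + C₂ * C₃) * C * C₄, ?_, ?_⟩
  · exact one_le_mul_of_one_le_of_one_le (one_le_mul_of_one_le_of_one_le (by linarith) hC) hC₄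
  intro M N hM hN ε hε lam hl u h hu hh B D B' hu1 huB hhD hhB hz hz'
  have hM0 : (0 : ℝ) < M := by exact_mod_cast hM
  have hT1 : ∀ v : X.Sp s₀, (v : V) ∈ X.space S → ‖P.projL hN s₀ S v‖ ≤ C₁ * X.nrm S v := by
    intro v hv
    have := h1 N hN v hv
    rwa [tsub_self, NNReal.coe_zero, Real.rpow_zero, mul_one] at this
  -- `T = Π^(N) (1 - Π^(M))`. It agrees with `Π^(N)` on the kernel of `Π^(M)`, and (P2) bounds it on
  -- all of `X_S`; this second fact allows the integrated bounds, whose intermediate points solve no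
  -- equation.
  set T : X.Sp s₀ →L[ℝ] X.Sp s₁ :=
    (P.projL hN s₀ s₁).comp (ContinuousLinearMap.id ℝ (X.Sp s₀) - P.projL hM s₀ s₀) with hTdef
  have vT : ∀ v : X.Sp s₀, ((T v : X.Sp s₁) : V) = P.proj N ((v : V) - P.proj M v) := fun v => rfl
  have hss : s₁ + (S - s₁) = S := add_tsub_cancel_of_le hS
  have hcoe : ((S - s₁ : ℝ≥0) : ℝ) = (S : ℝ) - s₁ := NNReal.coe_sub hS
  have hT2 : ∀ v : X.Sp s₀, (v : V) ∈ X.space S →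
      ‖T v‖ ≤ (C₂ * C₃ * (M : ℝ) ^ (-((S : ℝ) - s₁))) * X.nrm S v := by
    intro v hv
    rw [norm_def, vT]
    have hmem : (v : V) - P.proj M v ∈ X.space s₁ :=
      (X.space s₁).sub_mem (X.space_anti _ _ hS hv) (P.E_le M s₁ (P.proj_mem M _))
    have a := h2 N hN _ hmem
    rw [tsub_self, NNReal.coe_zero, Real.rpow_zero, mul_one] at a
    have b := h3 M hM v (by rw [hss]; exact hv)
    rw [hss, hcoe] at b
    refine a.trans ?_
    rw [mul_assoc C₂, mul_assoc C₂]
    gcongr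
  have hm : ∀ x ∈ P.E M, x ∈ X.space (S + ν) := fun x hx => P.E_le M _ hx
  have hu0 : X.nrm s₀ u ≤ 1 := (X.nrm_mono _ _ hs₁ _ (P.E_le M _ hu)).trans hu1
  have hh0 : X.nrm s₀ h ≤ D := (X.nrm_mono _ _ hs₁ _ (P.E_le M _ hh)).trans hhD
  have q1 := hb (P.projL hN s₀ S) C₁ (by linarith) hT1 ε hε lam hl u (hm _ hu) hu0
  have q2 := hb T (C₂ * C₃ * (M : ℝ) ^ (-((S : ℝ) - s₁))) (by positivity) hT2 ε hε lam hl u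
    (hm _ hu) hu0
  have q3 := (q2.2.2 h (hm _ hh)).1
  have z1 := h4 M hM u hu
  have z2 := h4 M hM h hh
  have nu := X.nrm_nonneg S _ (P.E_le M _ hu)
  have nh := X.nrm_nonneg S _ (P.E_le M _ hh)
  have nh0 := X.nrm_nonneg s₀ _ (P.E_le M _ hh)
  have hε0 := hε.1
  set Z := (M : ℝ) ^ (ν : ℝ) with hZ
  have hZ1 : 1 ≤ C₄ * Z := one_le_mul_of_one_le_of_one_le hC₄ (one_le_rpow_natCast hM ν.2)
  have hB0 : 0 ≤ B := nu.trans huB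
  have hD0 : 0 ≤ D := nh0.trans hh0
  have hB'0 : 0 ≤ B' := nh.trans hhB
  have y1 : X.nrm (S + ν) u ≤ C₄ * Z * B := z1.trans (by gcongr)
  have y2 : X.nrm (S + ν) h ≤ C₄ * Z * B' := z2.trans (by gcongr)
  have y0 := X.nrm_nonneg _ _ (hm _ hu)
  have x1 : ε + X.nrm (S + ν) u ≤ C₄ * Z * (ε + B) := by
    have : 1 * ε ≤ C₄ * Z * ε := by gcongr
    linarith
  have hpow : (M : ℝ) ^ (ν - (S - s₁) : ℝ) = Z * (M : ℝ) ^ (-((S : ℝ) - s₁)) := by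
    rw [hZ, ← Real.rpow_add hM0]
    congr 1
  set Q := (M : ℝ) ^ (-((S : ℝ) - s₁)) with hQ
  have hQ0 : 0 ≤ Q := by positivity
  have hZ0 : 0 ≤ Z := by positivity
  have hTeq : ∀ v : X.Sp s₀, P.proj M v = 0 → ‖T v‖ = X.nrm s₁ (P.proj N v) := by
    intro v hv
    rw [norm_def, vT, hv, sub_zero]
  have hC0 : 0 ≤ C := by linarith
  refine ⟨?_, ?_, ?_⟩
  · rw [← hTeq _ hz]
    refine q2.1.trans ?_
    calc C₂ * C₃ * Q * C * (ε + X.nrm (S + ν) u) ≤ C₂ * C₃ * Q * C * (C₄ * Z * (ε + B)) := by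
          gcongr
      _ = (C₂ * C₃) * C * C₄ * (Z * Q) * (ε + B) := by ring
      _ ≤ (C₁ + C₂ * C₃) * C * C₄ * (M : ℝ) ^ (ν - (S - s₁) : ℝ) * (ε + B) := by
          rw [hpow]
          gcongr
          linarith
  · refine q1.1.trans ?_
    calc C₁ * C * (ε + X.nrm (S + ν) u) ≤ C₁ * C * (C₄ * Z * (ε + B)) := by gcongr
      _ = C₁ * C * C₄ * Z * (ε + B) := by ring
      _ ≤ (C₁ + C₂ * C₃) * C * C₄ * Z * (ε + B) := by
          gcongr
          linarith
  · rw [← hTeq _ hz', map_add]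
    refine (norm_add_le _ _).trans ((add_le_add q2.2.1 q3).trans ?_)
    have x2 : 1 + X.nrm (S + ν) u + (X.nrm (S + ν) u * X.nrm s₀ h + X.nrm (S + ν) h) ≤
        C₄ * Z * (1 + B + B * D + B') := by
      have : X.nrm (S + ν) u * X.nrm s₀ h ≤ C₄ * Z * B * D := by gcongr
      linarith
    calc C₂ * C₃ * Q * C * (1 + X.nrm (S + ν) u) + C₂ * C₃ * Q * C *
          (X.nrm (S + ν) u * X.nrm s₀ h + X.nrm (S + ν) h)
        = C₂ * C₃ * Q * C *
          (1 + X.nrm (S + ν) u + (X.nrm (S + ν) u * X.nrm s₀ h + X.nrm (S + ν) h)) := by ring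
      _ ≤ C₂ * C₃ * Q * C * (C₄ * Z * (1 + B + B * D + B')) := by gcongr
      _ = (C₂ * C₃) * C * C₄ * (Z * Q) * (1 + B + B * D + B') := by ring
      _ ≤ (C₁ + C₂ * C₃) * C * C₄ * (M : ℝ) ^ (ν - (S - s₁) : ℝ) * (1 + B + B * D + B') := by
          rw [hpow]
          gcongr
          linarith

end BanachScale

/-! ### Bookkeeping of exponents -/

section PowerBounds

/-- The function `x` is nonnegative and of order at most `N ^ e` on `[1, ∞)`. -/
def PowBounded (x : ℝ → ℝ) (e : ℝ) : Prop :=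
  ∃ A, 0 ≤ A ∧ ∀ N, 1 ≤ N → 0 ≤ x N ∧ x N ≤ A * N ^ e

namespace PowBounded

variable {x y : ℝ → ℝ} {a b e : ℝ}

theorem mono (h : PowBounded x a) (hae : a ≤ e) : PowBounded x e := by
  obtain ⟨A, hA, h⟩ := h
  refine ⟨A, hA, fun N hN => ⟨(h N hN).1, (h N hN).2.trans ?_⟩⟩
  have := Real.rpow_le_rpow_of_exponent_le hN hae
  gcongr

theorem mul (hx : PowBounded x a) (hy : PowBounded y b) (he : a + b ≤ e) :
    PowBounded (fun N => x N * y N) e := by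
  obtain ⟨A, hA, hx⟩ := hx
  obtain ⟨B, hB, hy⟩ := hy
  refine PowBounded.mono (a := a + b) ⟨A * B, by positivity, fun N hN => ?_⟩ he
  obtain ⟨x0, x1⟩ := hx N hN
  obtain ⟨y0, y1⟩ := hy N hN
  refine ⟨by positivity, ?_⟩
  have hN0 : 0 < N := by linarith
  calc x N * y N ≤ (A * N ^ a) * (B * N ^ b) := by gcongr
    _ = A * B * N ^ (a + b) := by rw [Real.rpow_add hN0]; ring

theorem add (hx : PowBounded x a) (hy : PowBounded y b) (ha : a ≤ e) (hb : b ≤ e) :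
    PowBounded (fun N => x N + y N) e := by
  obtain ⟨A, hA, hx⟩ := hx.mono ha
  obtain ⟨B, hB, hy⟩ := hy.mono hb
  refine ⟨A + B, by positivity, fun N hN => ?_⟩
  obtain ⟨x0, x1⟩ := hx N hN
  obtain ⟨y0, y1⟩ := hy N hN
  exact ⟨by positivity, by linarith⟩

theorem const {c : ℝ} (hc : 0 ≤ c) : PowBounded (fun _ => c) 0 :=
  ⟨c, hc, fun N _ => ⟨hc, by simp⟩⟩

theorem rpow (a : ℝ) : PowBounded (fun N => N ^ a) a :=
  ⟨1, zero_le_one, fun N hN => ⟨by positivity, by simp⟩⟩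

theorem const_mul {c : ℝ} (hc : 0 ≤ c) (hx : PowBounded x a) : PowBounded (fun N => c * x N) a :=
  (const hc).mul hx (by simp)

theorem eventually_le (hx : PowBounded x a) (hae : a < e) {c : ℝ} (hc : 0 < c) :
    ∀ᶠ N in atTop, x N ≤ c * N ^ e := by
  obtain ⟨A, hA, hx⟩ := hx
  have h1 := (tendsto_rpow_atTop (sub_pos.2 hae)).eventually_ge_atTop (A / c)
  filter_upwards [h1, eventually_ge_atTop 1] with N h2 hN
  have hN0 : 0 < N := by linarith
  refine (hx N hN).2.trans ?_
  rw [div_le_iff₀ hc, Real.rpow_sub hN0] at h2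
  have h3 : 0 < N ^ a := by positivity
  rw [div_mul_eq_mul_div, le_div_iff₀ h3] at h2
  linarith

end PowBounded

theorem rpow_half_sq {M e : ℝ} (hM : 0 ≤ M) : (M ^ 2) ^ (e / 2) = M ^ e := by
  rw [← Real.rpow_natCast, ← Real.rpow_mul hM]
  congr 1
  push_cast
  ring

/-- The numerical inequalities behind the inductive step of the iteration. -/
theorem eventually_step_numerics {a c K μ ν σ d δ p q : ℝ} (ha : 0 ≤ a) (hc : 0 ≤ c)
    (hK : 0 ≤ K) (hμ : 0 < μ) (hν : 0 < ν)
    (hσ₂ : 4 * (μ + ν) ≤ σ) (hd : 2 * (2 * μ + ν + 3 + σ) ≤ d) (hδ : δ * d ≤ σ + 1)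
    (hp : p = μ + ν / 2 + 1) (hq : q = 2 * μ + ν + 2 + σ / 2) :
    ∀ᶠ N : ℝ in atTop, ∃ α κ D B B' r r₁ rS r₁' β ρ β' H β'' G₁ : ℝ,
      α = a * N ^ μ ∧ κ = c * N ^ ν ∧ D = K * N ^ (μ / 2) ∧ B = 2 * N ^ p ∧ B' = 2 * N ^ q ∧
      r = N ^ (-σ / 2) ∧ r₁ = c * N ^ ((ν - d) / 2) * (1 + B) ∧ rS = c * N ^ (ν / 2) * (1 + B) ∧
      r₁' = c * N ^ ((ν - d) / 2) * (1 + B + B * D + B') ∧ β = N ^ (δ * d) * B ∧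
      ρ = 4 * α * r₁ ∧ 12 * (α * r * κ * (1 + D)) ≤ 1 ∧ 12 * (α * κ * ρ) ≤ 1 ∧
      2 * β + 2 * α * (2 * r * κ * (B + B * D + B')) ≤ β' ∧
      4 * α * (rS + B * r₁ + 2 * β' * r₁) ≤ H ∧
      2 * β' + 4 * α * (κ * (B * ρ + 2 * H)) ≤ β'' ∧
      r₁' + 3 * (κ * ρ) * (1 + D) ≤ G₁ ∧
      ρ ≤ 1 / 2 * N ^ (-σ - 1) ∧ H ≤ N ^ (2 * p) ∧
      4 / r * ρ + 4 * α * G₁ ≤ N ^ (-1 - ν) ∧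
      4 / r * H + 4 * α * (κ * (1 + (B + H) * (1 + D) + B') + β'' * G₁) ≤ N ^ (2 * q) := by
  have b1 : PowBounded (fun _ => (1 : ℝ)) 0 := .const zero_le_one
  have bα : PowBounded (fun N => a * N ^ μ) μ := .const_mul ha (.rpow μ)
  have bκ : PowBounded (fun N => c * N ^ ν) ν := .const_mul hc (.rpow ν)
  have bD : PowBounded (fun N => K * N ^ (μ / 2)) (μ / 2) := .const_mul hK (.rpow _)
  have bB : PowBounded (fun N => 2 * N ^ p) p := .const_mul zero_le_two (.rpow _)
  have bB' : PowBounded (fun N => 2 * N ^ q) q := .const_mul zero_le_two (.rpow _)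
  have br : PowBounded (fun N => N ^ (-σ / 2)) (-σ / 2) := .rpow _
  have b1B := b1.add bB (e := p) (by linarith) le_rfl
  have b1D := b1.add bD (e := μ / 2) (by linarith) le_rfl
  have bBD := bB.mul bD (e := q) (by linarith)
  -- Here `N = M ^ 2`, so `N ^ ((ν - d) / 2) = M ^ (ν - d)`. The lower bound on `d = S - s₁` gives
  -- the exponent `-μ - σ - 2`, and `ρ = 4 * α * r₁` is one power of `N` below the required `N ^ (-σ
  -- - 1)`.
  have br₁ := (PowBounded.const_mul hc (.rpow ((ν - d) / 2))).mul b1B (e := -μ - σ - 2)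
    (by linarith)
  have brS := (PowBounded.const_mul hc (.rpow (ν / 2))).mul b1B (e := ν / 2 + p) (by linarith)
  have br₁' := (PowBounded.const_mul hc (.rpow ((ν - d) / 2))).mul
    ((b1B.add bBD (e := q) (by linarith) le_rfl).add bB' (e := q) le_rfl le_rfl)
    (e := ν / 2 - 1 - σ / 2) (by linarith)
  -- The factor `N ^ (δ * d)` is the only place where a large `d` hurts. With `δ * d ≤ σ + 1`, the
  -- product of `β'` and `r₁` has order at most `N ^ (ν / 2)`.
  have bβ := (PowBounded.rpow (δ * d)).mul bB (e := σ + 1 + p) (by linarith)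
  have b4α := PowBounded.const_mul (c := 4) (by norm_num) bα
  have b2α := PowBounded.const_mul (c := 2) (by norm_num) bα
  have bρ := b4α.mul br₁ (e := -σ - 2) (by linarith)
  have bE1 := PowBounded.const_mul (c := 12) (by norm_num)
    (((bα.mul br le_rfl).mul bκ le_rfl).mul b1D (e := -ν) (by linarith))
  have bE2 := PowBounded.const_mul (c := 12) (by norm_num)
    ((bα.mul bκ le_rfl).mul bρ (e := -1) (by linarith))
  have bBBB := (bB.add bBD (e := q) (by linarith) le_rfl).add bB' (e := q) le_rfl le_rfl
  have bβ' := (PowBounded.const_mul (c := 2) (by norm_num) bβ).add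
    (b2α.mul (((PowBounded.const_mul (c := 2) (by norm_num) br).mul bκ le_rfl).mul bBBB le_rfl)
      le_rfl) (e := σ + 1 + p) le_rfl (by linarith)
  have b2β' := PowBounded.const_mul (c := 2) (by norm_num) bβ'
  -- The leading term `α * rS` has exponent `μ + ν / 2 + p`, which is `2 * p - 1` by the choice of
  -- `p`. The spare power of `N` absorbs the constants.
  have bH := b4α.mul ((brS.add (bB.mul br₁ le_rfl) (e := ν / 2 + p) le_rfl (by linarith)).add
    (b2β'.mul br₁ le_rfl) (e := ν / 2 + p) le_rfl (by linarith)) (e := 2 * p - 1) (by linarith)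
  have b2H := PowBounded.const_mul (c := 2) (by norm_num) bH
  have bβ'' := b2β'.add (b4α.mul (bκ.mul ((bB.mul bρ (e := 2 * p - 1) (by linarith)).add b2H
    (e := 2 * p - 1) le_rfl le_rfl) le_rfl) le_rfl) (e := σ + 1 + p) le_rfl (by linarith)
  have bG₁ := br₁'.add ((PowBounded.const_mul (c := 3) (by norm_num) (bκ.mul bρ le_rfl)).mul b1D
    le_rfl) (e := ν / 2 - 1 - σ / 2) le_rfl (by linarith)
  have b4r : PowBounded (fun N => 4 / N ^ (-σ / 2)) (σ / 2) := by
    refine ⟨4, by norm_num, fun N hN => ⟨by positivity, ?_⟩⟩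
    change 4 / N ^ (-σ / 2) ≤ _
    rw [neg_div, Real.rpow_neg (by linarith), div_inv_eq_mul]
  -- From `σ ≥ 4 * (μ + ν)`, `α * G₁` has exponent at most `-1 - 3 * ν / 2`; the cutoff term has `-σ
  -- / 2 - 2`. The margin `ν / 2 > 0` absorbs the constants.
  have bV := (b4r.mul bρ le_rfl).add (b4α.mul bG₁ le_rfl) (e := -1 - 3 * ν / 2) (by linarith)
    (by linarith)
  have bVS := (b4r.mul bH le_rfl).add (b4α.mul ((bκ.mul ((b1.add ((bB.add bH (e := 2 * p - 1)
    (by linarith) le_rfl).mul b1D le_rfl) (e := μ / 2 + (2 * p - 1)) (by linarith)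
    (by linarith)).add bB' (e := μ / 2 + (2 * p - 1) + q) (by linarith) (by linarith)) le_rfl).add
    (bβ''.mul bG₁ le_rfl) (e := 2 * q - 1 - μ) (by linarith) (by linarith)) le_rfl)
    (e := 2 * q - 1) (by linarith) (by linarith)
  have n1 := bE1.eventually_le (e := 0) (by linarith) one_pos
  have n2 := bE2.eventually_le (e := 0) (by linarith) one_pos
  have n3 := bρ.eventually_le (e := -σ - 1) (by linarith) (half_pos one_pos)
  have n4 := bH.eventually_le (e := 2 * p) (by linarith) one_pos
  have n5 := bV.eventually_le (e := -1 - ν) (by linarith) one_pos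
  have n6 := bVS.eventually_le (e := 2 * q) (by linarith) one_pos
  filter_upwards [n1, n2, n3, n4, n5, n6] with N n1 n2 n3 n4 n5 n6
  rw [Real.rpow_zero, mul_one] at n1 n2
  rw [one_mul] at n4 n5 n6
  exact ⟨_, _, _, _, _, _, _, _, _, _, _, _, _, _, _, rfl, rfl, rfl, rfl, rfl, rfl, rfl, rfl, rfl,
    rfl, rfl, n1, n2, le_rfl, le_rfl, le_rfl, le_rfl, n3, n4, n5, n6⟩

/-- The numerical inequalities behind the initialisation of the iteration. -/
theorem exists_initial_numerics {a c μ ν σ d S q : ℝ} (ha : 0 ≤ a) (hc : 0 ≤ c)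
    (hμ : 0 < μ) (hν : 0 < ν)
    (hσ₂ : 4 * (μ + ν) ≤ σ) (hd : 2 * (2 * μ + ν + 3 + σ) ≤ d) (hS : d ≤ S)
    (hq : q = 2 * μ + ν + 2 + σ / 2) :
    ∃ K : ℝ, 1 ≤ K ∧ ∀ᶠ N : ℝ in atTop, ∃ α κ r r₁ ρ H β'' G₁ : ℝ,
      α = a * N ^ μ ∧ κ = c * N ^ ν ∧ r = N ^ (-σ / 2) ∧ r₁ = c * N ^ (-S) ∧
      ρ = 4 * α * r₁ ∧ 12 * (α * r * κ * (1 + 0)) ≤ 1 ∧ 12 * (α * κ * ρ) ≤ 1 ∧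
      4 * α * (r₁ + 0 * r₁ + 2 * 0 * r₁) ≤ H ∧ 2 * 0 + 4 * α * (κ * (0 * ρ + 2 * H)) ≤ β'' ∧
      c + 3 * (κ * ρ) * (1 + 0) ≤ G₁ ∧ ρ ≤ 1 / 2 ∧ H ≤ 1 ∧
      4 / r * ρ + 4 * α * G₁ ≤ K * N ^ μ ∧
      4 / r * H + 4 * α * (κ * (1 + (0 + H) * (1 + 0) + 0) + β'' * G₁) ≤ N ^ (2 * q) := by
  have b1 : PowBounded (fun _ => (1 : ℝ)) 0 := .const zero_le_one
  have b0 : PowBounded (fun _ => (0 : ℝ)) (-S) :=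
    ⟨0, le_rfl, fun N _ => ⟨le_rfl, by simp⟩⟩
  have b10 := b1.add b0 (e := 0) le_rfl (by linarith)
  have bα : PowBounded (fun N => a * N ^ μ) μ := .const_mul ha (.rpow μ)
  have bκ : PowBounded (fun N => c * N ^ ν) ν := .const_mul hc (.rpow ν)
  have br : PowBounded (fun N => N ^ (-σ / 2)) (-σ / 2) := .rpow _
  have br₁ := PowBounded.const_mul hc (.rpow (-S))
  have b4α := PowBounded.const_mul (c := 4) (by norm_num) bα
  have bρ := b4α.mul br₁ (e := μ - S) (by linarith)
  have bE1 := PowBounded.const_mul (c := 12) (by norm_num)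
    (((bα.mul br le_rfl).mul bκ le_rfl).mul b10 (e := -ν) (by linarith))
  have bE2 := PowBounded.const_mul (c := 12) (by norm_num)
    ((bα.mul bκ le_rfl).mul bρ (e := -1) (by linarith))
  have b2b0 := PowBounded.const_mul (c := 2) (by norm_num) b0
  have bH := b4α.mul ((br₁.add (b0.mul br₁ le_rfl) (e := -S) le_rfl (by linarith)).add
    (b2b0.mul br₁ le_rfl) (e := -S) le_rfl (by linarith)) (e := μ - S) (by linarith)
  have b2H := PowBounded.const_mul (c := 2) (by norm_num) bH
  have bβ'' := b2b0.add (b4α.mul (bκ.mul ((b0.mul bρ (e := μ - S) (by linarith)).add b2H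
    (e := μ - S) le_rfl le_rfl) le_rfl) le_rfl) (e := 0) (by linarith) (by linarith)
  have bG₁ := (PowBounded.const hc).add ((PowBounded.const_mul (c := 3) (by norm_num)
    (bκ.mul bρ le_rfl)).mul b10 le_rfl) (e := 0) le_rfl (by linarith)
  have b4r : PowBounded (fun N => 4 / N ^ (-σ / 2)) (σ / 2) := by
    refine ⟨4, by norm_num, fun N hN => ⟨by positivity, ?_⟩⟩
    change 4 / N ^ (-σ / 2) ≤ _
    rw [neg_div, Real.rpow_neg (by linarith), div_inv_eq_mul]
  have bV := (b4r.mul bρ le_rfl).add (b4α.mul bG₁ le_rfl) (e := μ) (by linarith)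
    (by linarith)
  have bVS := (b4r.mul bH le_rfl).add (b4α.mul ((bκ.mul ((b1.add ((b0.add bH (e := μ - S)
    (by linarith) le_rfl).mul b10 le_rfl) (e := 0) (by linarith)
    (by linarith)).add b0 (e := 0) (by linarith) (by linarith)) le_rfl).add
    (bβ''.mul bG₁ le_rfl) (e := ν) (by linarith) (by linarith)) le_rfl)
    (e := 2 * q - 1) (by linarith) (by linarith)
  have n1 := bE1.eventually_le (e := 0) (by linarith) one_pos
  have n2 := bE2.eventually_le (e := 0) (by linarith) one_pos
  have n3 := bρ.eventually_le (e := 0) (by linarith) (half_pos one_pos)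
  have n4 := bH.eventually_le (e := 0) (by linarith) one_pos
  have n6 := bVS.eventually_le (e := 2 * q) (by linarith) one_pos
  obtain ⟨K, hK, hV⟩ := bV
  refine ⟨K + 1, by linarith, ?_⟩
  filter_upwards [n1, n2, n3, n4, n6, eventually_ge_atTop 1] with N n1 n2 n3 n4 n6 hN
  rw [Real.rpow_zero, mul_one] at n1 n2 n3 n4
  rw [one_mul] at n6
  refine ⟨_, _, _, _, _, _, _, _, rfl, rfl, rfl, rfl,
    rfl, n1, n2, le_rfl, le_rfl, le_rfl, n3, n4, ?_, n6⟩
  have : 0 ≤ N ^ μ := by positivity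
  linarith [(hV N hN).2]

end PowerBounds

/-! ### Stages of the iteration: inductive step and initialisation -/

namespace BanachScale

variable {V : Type*} [AddCommGroup V] [Module ℝ V] {X : BanachScale V} (P : X.Smoothing)
  {s₀ ν s₁ : ℝ≥0} {S' : ℝ≥0∞} {ε' : ℝ} {I : Set ℝ} {F : ℝ → ℝ → X.Sp (s₀ + ν) → X.Sp s₀}

/-- The properties of the approximate solution `w` in `E^(M)`, on the set of parameters `A`, which
are propagated by the iteration. -/
structure IsStage (S' : ℝ≥0∞) (I : Set ℝ) (F : ℝ → ℝ → X.Sp (s₀ + ν) → X.Sp s₀) (hs₁ : s₀ ≤ s₁)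
    (S : ℝ≥0) (σ p q : ℝ) (L ε : ℝ) (M : ℕ) (A : Set ℝ) (w : ℝ → X.Sp (s₁ + ν)) : Prop where
  smooth : ContDiffOn ℝ 1 w I
  mem : ∀ t ∈ I, (w t : V) ∈ P.E M
  low : ∀ t ∈ I, X.nrm s₁ (w t) ≤ 1 - 1 / (M : ℝ)
  low_deriv : ∀ t ∈ I, X.nrm s₁ (derivWithin w I t : X.Sp (s₁ + ν)) ≤ L - 1 / (M : ℝ)
  high : ∀ t ∈ I, 1 + X.nrm S (w t) ≤ 2 * ((M : ℝ) ^ 2) ^ p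
  high_deriv : ∀ t ∈ I, X.nrm S (derivWithin w I t : X.Sp (s₁ + ν)) ≤ 2 * ((M : ℝ) ^ 2) ^ q
  zero : ∀ t ∈ I ∩ Metric.thickening ((M : ℝ) ^ (-σ / 2)) A,
    P.proj M (F ε t (X.inclL (add_le_add_left hs₁ ν) (w t)) : X.Sp s₀) = 0
  invariant : ∀ (ε₀ : ℝ) (Y : ℝ≥0 → Submodule ℝ V), IsInvariant P S' ε₀ I F Y →
    ε < ε₀ → ∀ t ∈ I, (w t : V) ∈ Y s₀

/-- The next step needs the previous equation on a `2 * r`-neighbourhood, with `r = (M ^ 2) ^ (-σ /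
2)`; this puts it inside the neighbourhood where that equation holds. -/
theorem two_mul_rpow_sq_le {M σ : ℝ} (hM : 2 ≤ M) (hσ : 2 ≤ σ) :
    2 * (M ^ 2) ^ (-σ / 2) ≤ M ^ (-σ / 2) := by
  have hM0 : 0 < M := by linarith
  rw [rpow_half_sq hM0.le]
  have e : M ^ (-σ / 2) = M ^ (σ / 2) * M ^ (-σ) := by
    rw [← Real.rpow_add hM0]; congr 1; ring
  rw [e]
  gcongr
  calc (2 : ℝ) ≤ M := hM
    _ = M ^ (1 : ℝ) := (Real.rpow_one M).symm
    _ ≤ M ^ (σ / 2) := Real.rpow_le_rpow_of_exponent_le (by linarith) (by linarith)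

/-- The truncated equation holds on a relatively open set of parameters, so it can be
differentiated. The residual of the derivative then has the same high-frequency form as the residual
itself. -/
theorem proj_deriv_eq_zero (hF : X.IsTame S' ε' I F) (hI : UniqueDiffOn ℝ I) (hs₁ : s₀ ≤ s₁)
    {M : ℕ} (hM : 1 ≤ M) {ε : ℝ} (hε : ε ∈ Ico 0 ε') {w : ℝ → X.Sp (s₁ + ν)} {w' : X.Sp (s₁ + ν)}
    {U : Set ℝ} (hU : IsOpen U)
    (hz : ∀ t ∈ I ∩ U, P.proj M (F ε t (X.inclL (add_le_add_left hs₁ ν) (w t)) : X.Sp s₀) = 0)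
    {t : ℝ} (ht : t ∈ I ∩ U) (hw : HasDerivWithinAt w w' I t) :
    P.proj M (derivWithin (fun l => F ε l (X.inclL (add_le_add_left hs₁ ν) (w t))) I t +
      fderiv ℝ (F ε t) (X.inclL (add_le_add_left hs₁ ν) (w t))
        (X.inclL (add_le_add_left hs₁ ν) w') : X.Sp s₀) = 0 := by
  set inc := X.inclL (add_le_add_left hs₁ ν)
  have h1 : HasDerivWithinAt (fun l => inc (w l)) (inc w') I t :=
    inc.hasFDerivAt.comp_hasDerivWithinAt t hw
  have h2 := hasDerivWithinAt_slice two_ne_zero hI (hF.contDiffOn_fixed hε) ht.1 h1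
  have h3 := (P.projL hM s₀ s₀).hasFDerivAt.comp_hasDerivWithinAt t h2
  have h4 : HasDerivWithinAt ((P.projL hM s₀ s₀) ∘ fun l => F ε l (inc (w l))) 0 I t := by
    refine (hasDerivWithinAt_const t I (0 : X.Sp s₀)).congr_of_eventuallyEq ?_ ?_
    · filter_upwards [inter_mem_nhdsWithin I (hU.mem_nhds ht.2)] with l hl
      exact Subtype.ext (hz l hl)
    · exact Subtype.ext (hz t ht)
  have h5 := (hI t ht.1).eq_deriv I h3 h4
  exact congrArg (fun x : X.Sp s₀ => (x : V)) h5

set_option maxHeartbeats 1000000 in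
-- The bound `L` on the derivative stays the same through the whole iteration; `K * M ^ μ` is only a
-- majorant that brings `D` into the form of a power of `N`.
theorem exists_stage_succ (hF : X.IsTame S' ε' I F) (hI : UniqueDiffOn ℝ I) (hIc : Convex ℝ I)
    (hs₁ : s₀ ≤ s₁) {S : ℝ≥0} (hS : s₁ ≤ S) (hSS : (S : ℝ≥0∞) < S') (hν : 0 < ν)
    {τ δ σ μ p q K : ℝ} {C : ℝ≥0 → ℝ} (hμ : 0 < μ) (hμ' : μ = τ + δ * s₁) (hK : 0 ≤ K)
    (hσ₁ : 2 ≤ σ) (hσ₂ : 4 * (μ + ν) ≤ σ)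
    (hd : 2 * (2 * μ + ν + 3 + σ) ≤ (S : ℝ) - s₁) (hδ : δ * ((S : ℝ) - s₁) ≤ σ + 1)
    (hp : p = μ + ν / 2 + 1) (hq : q = 2 * μ + ν + 2 + σ / 2) :
    ∀ᶠ M : ℕ in atTop, ∀ ε ∈ Ico 0 ε', ε ≤ 1 → ∀ L, L ≤ K * (M : ℝ) ^ μ →
      ∀ (A : Set ℝ) (w : ℝ → X.Sp (s₁ + ν)), IsStage P S' I F hs₁ S σ p q L ε M A w →
      ∃ w₂ : ℝ → X.Sp (s₁ + ν), IsStage P S' I F hs₁ S σ p q L ε (M ^ 2)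
          (A ∩ goodSet P F I s₁ S τ δ C (M ^ 2) ε (fun l => (w l : V))) w₂ ∧
        ∀ t ∈ I, X.nrm s₁ (w₂ t - w t : X.Sp (s₁ + ν)) ≤
            1 / 2 * ((M ^ 2 : ℕ) : ℝ) ^ (-σ - 1) ∧
          X.nrm s₁ (derivWithin w₂ I t - derivWithin w I t : X.Sp (s₁ + ν)) ≤
            ((M ^ 2 : ℕ) : ℝ) ^ (-1 - (ν : ℝ)) := by
  obtain ⟨c₁, hc₁, htame⟩ := exists_tameFamily_pair P hF hI hs₁ hS hSS
  obtain ⟨c₂, hc₂, hresid⟩ := exists_residual P hF hs₁ hS hSS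
  set c := max c₁ c₂ with hc
  have hcc₁ : c₁ ≤ c := le_max_left _ _
  have hcc₂ : c₂ ≤ c := le_max_right _ _
  have hc0 : 0 ≤ c := by linarith
  clear_value c
  have hν' : (0 : ℝ) < ν := hν
  have ha0 : 0 ≤ 2 * (|C s₁| + |C S| + 1) := by positivity
  have hnum := eventually_step_numerics ha0 hc0 hK hμ hν' hσ₂ hd hδ hp hq
  have hsq : Tendsto (fun M : ℕ => (M : ℝ) ^ 2) atTop atTop :=
    (tendsto_pow_atTop two_ne_zero).comp tendsto_natCast_atTop_atTop
  filter_upwards [hsq.eventually hnum, eventually_ge_atTop 2] with M hM hM2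
  intro ε hε hε1 L hL A w hw
  obtain ⟨α, κ, D, B, B', r, r₁, rS, r₁', β, ρ, β', H, β'', G₁, eα, eκ, eD, eB, eB', er, er₁, erS,
    er₁', eβ, eρ, k1, k2, k3, k4, k5, k6, k7, k8, k9, k10⟩ := hM
  have hM1 : 1 ≤ M := by omega
  have hN1 : 1 ≤ M ^ 2 := Nat.one_le_pow _ _ hM1
  have hM2' : (2 : ℝ) ≤ M := by exact_mod_cast hM2
  have hM0 : (0 : ℝ) < M := by linarith
  have hcast : ((M ^ 2 : ℕ) : ℝ) = (M : ℝ) ^ 2 := by push_cast; rfl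
  have hNR2 : (2 : ℝ) ≤ (M : ℝ) ^ 2 := hM2'.trans (le_self_pow₀ (by linarith only [hM2']) two_ne_zero)
  have hNR1 : (1 : ℝ) ≤ (M : ℝ) ^ 2 := by linarith only [hNR2]
  have hNR0 : (0 : ℝ) < (M : ℝ) ^ 2 := by positivity
  set N : ℕ := M ^ 2 with hNdef
  rw [hcast]
  have hp0 : 0 < p := by rw [hp]; positivity
  have hp1 : 1 ≤ p := by rw [hp]; linarith
  have hq1 : 1 ≤ q := by rw [hq]; linarith
  have hD' : D = K * (M : ℝ) ^ μ := by rw [eD, rpow_half_sq hM0.le]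
  have hD0 : 0 ≤ D := by rw [hD']; positivity
  have hB0 : 0 ≤ B := by rw [eB]; positivity
  have hB'0 : 0 ≤ B' := by rw [eB']; positivity
  have hr0 : 0 < r := by rw [er]; positivity
  have hr₁0 : 0 ≤ r₁ := by rw [er₁]; positivity
  have hrS0 : 0 ≤ rS := by rw [erS]; positivity
  have hr₁'0 : 0 ≤ r₁' := by rw [er₁']; positivity
  have hκ0 : 0 ≤ κ := by rw [eκ]; positivity
  -- The reserve `1 / M` in `low` and `low_deriv` shrinks to `1 / M ^ 2`. The difference is at least
  -- `1 / M ^ 2`, and neither correction exceeds this. The reserve also supplies `‖w‖ ≤ 1 - ρ`.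
  have hMN : 1 / (M : ℝ) ^ 2 ≤ 1 / 2 * (1 / (M : ℝ)) := by
    rw [pow_two, ← one_div_mul_one_div]
    have := one_div_le_one_div_of_le two_pos hM2'
    gcongr
  have hσN : ((M : ℝ) ^ 2) ^ (-σ - 1) ≤ 1 / (M : ℝ) ^ 2 := by
    rw [one_div, ← Real.rpow_neg_one]
    exact Real.rpow_le_rpow_of_exponent_le hNR1 (by linarith)
  have hνN : ((M : ℝ) ^ 2) ^ (-1 - (ν : ℝ)) ≤ 1 / (M : ℝ) ^ 2 := by
    rw [one_div, ← Real.rpow_neg_one]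
    exact Real.rpow_le_rpow_of_exponent_le hNR1 (by linarith)
  have hinvM : 0 < 1 / (M : ℝ) := by positivity
  have hinvM1 : 1 / (M : ℝ) ≤ 1 := by rw [div_le_one hM0]; linarith
  have hρM : ρ ≤ 1 / (M : ℝ) := by linarith
  have hwd : ∀ t ∈ I, HasDerivWithinAt w (derivWithin w I t) I t := fun t ht =>
    ((hw.smooth.differentiableOn one_ne_zero) t ht).hasDerivWithinAt
  have hwc : ContinuousOn (derivWithin w I) I :=
    hw.smooth.continuousOn_derivWithin hI le_rfl
  have hw'M : ∀ t ∈ I, ((derivWithin w I t : X.Sp (s₁ + ν)) : V) ∈ P.E M := fun t ht =>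
    P.deriv_mem hM1 hI ht hw.mem (hwd t ht)
  have hEM : P.E M ≤ P.E N := P.E_mono _ _ (Nat.le_self_pow two_ne_zero M)
  have hwS : ∀ t ∈ I, X.nrm S (w t) ≤ B := fun t ht => by
    rw [eB]; linarith [hw.high t ht]
  have hwS' : ∀ t ∈ I, X.nrm S (derivWithin w I t : X.Sp (s₁ + ν)) ≤ B' := fun t ht => by
    rw [eB']; exact hw.high_deriv t ht
  have hwD : ∀ t ∈ I, X.nrm s₁ (derivWithin w I t : X.Sp (s₁ + ν)) ≤ D := fun t ht => by
    rw [hD']; linarith [hw.low_deriv t ht]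
  have hw1 : ∀ t ∈ I, X.nrm s₁ (w t) ≤ 1 := fun t ht => by linarith [hw.low t ht]
  set A₂ := A ∩ goodSet P F I s₁ S τ δ C N ε (fun l => (w l : V)) with hA₂
  have hthick : Metric.thickening (2 * r) A₂ ⊆ Metric.thickening ((M : ℝ) ^ (-σ / 2)) A := by
    refine (Metric.thickening_mono ?_ _).trans (Metric.thickening_subset_of_subset _
      inter_subset_left)
    rw [er]
    exact two_mul_rpow_sq_le hM2' hσ₁
  obtain ⟨hT₁, hT⟩ := htame N hN1 ε hε
  have hκle : c₁ * (N : ℝ) ^ (ν : ℝ) ≤ κ := by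
    rw [eκ, hcast]
    gcongr
  obtain ⟨v, v', hv, hvc, hvE, hvz, hvb, hvY⟩ := exists_scale_step P hF hI hIc hs₁ hS hN1 hε hκ0
    (hT₁.mono (fun _ => rfl) hκle) (hT.mono (fun _ => rfl) hκle) (w := w)
    (w' := derivWithin w I) (fun t ht => hEM (hw.mem t ht)) hwd hwc (D := D) (B := B) (B' := B')
    (ρ := ρ) (fun t ht => by linarith [hw.low t ht]) hwD hwS hwS' hD0 hB0 hB'0 (τ := τ) (δ := δ)
    (C := C) (A := A₂) inter_subset_right (α := α) (β := β)
    (by rw [eα, hcast, hμ']) (by rw [eβ, hcast]) hr0 (r₁ := r₁) (rS := rS) (r₁' := r₁') hr₁0 hrS0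
    hr₁'0
    (fun t ht => by
      have htU : t ∈ I ∩ Metric.thickening ((M : ℝ) ^ (-σ / 2)) A := ⟨ht.1, hthick ht.2⟩
      obtain ⟨x1, x2, x3⟩ := hresid M N hM1 hN1 ε hε t ht.1
        (X.inclL (add_le_add_left hs₁ ν) (w t))
        (X.inclL (add_le_add_left hs₁ ν) (derivWithin w I t)) (hw.mem t ht.1) (hw'M t ht.1)
        B D B' (hw1 t ht.1) (hwS t ht.1) (hwD t ht.1) (hwS' t ht.1) (hw.zero t htU)
        (proj_deriv_eq_zero P hF hI hs₁ hM1 hε Metric.isOpen_thickening hw.zero htU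
          (hwd t ht.1))
      have hBB : ε + B ≤ 1 + B := by linarith
      have hεB : 0 ≤ ε + B := by linarith [hε.1]
      refine ⟨x1.trans ?_, x2.trans ?_, x3.trans ?_⟩
      · rw [er₁, rpow_half_sq hM0.le]
        gcongr
      · rw [erS, rpow_half_sq hM0.le]
        gcongr
      · rw [er₁', rpow_half_sq hM0.le]
        gcongr)
    k1 eρ k2 (by linarith) k3 k4 k5 k6
  have hd2 : ∀ t ∈ I, HasDerivWithinAt (fun l => w l + v l) (derivWithin w I t + v' t) I t :=
    fun t ht => (hwd t ht).add (hv t ht)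
  have hd2' : ∀ t ∈ I, derivWithin (fun l => w l + v l) I t = derivWithin w I t + v' t :=
    fun t ht => (hd2 t ht).derivWithin (hI t ht)
  have hadd : ∀ a b : X.Sp (s₁ + ν), ((a + b : X.Sp (s₁ + ν)) : V) = (a : V) + b := fun _ _ => rfl
  have htri : ∀ (s : ℝ≥0) (a b : X.Sp (s₁ + ν)), (a : V) ∈ P.E N → (b : V) ∈ P.E N →
      X.nrm s ((a + b : X.Sp (s₁ + ν)) : V) ≤ X.nrm s a + X.nrm s b := fun s a b h1 h2 =>
    X.nrm_add_le s _ (P.E_le N s h1) _ (P.E_le N s h2)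
  have hpow2 : ∀ e : ℝ, 1 ≤ e → 2 * ((M : ℝ) ^ 2) ^ e ≤ (((M : ℝ) ^ 2) ^ 2) ^ e := by
    intro e he
    have h1 : (((M : ℝ) ^ 2) ^ 2) ^ e = ((M : ℝ) ^ 2) ^ e * ((M : ℝ) ^ 2) ^ e := by
      rw [pow_two ((M : ℝ) ^ 2), Real.mul_rpow hNR0.le hNR0.le]
    rw [h1]
    gcongr
    calc (2 : ℝ) ≤ ((M : ℝ) ^ 2) ^ (1 : ℝ) := by rw [Real.rpow_one]; exact hNR2
      _ ≤ ((M : ℝ) ^ 2) ^ e := Real.rpow_le_rpow_of_exponent_le hNR1 he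
  have hpow3 : ∀ e : ℝ, ((M : ℝ) ^ 2) ^ (2 * e) = (((M : ℝ) ^ 2) ^ 2) ^ e := by
    intro e
    rw [← Real.rpow_natCast ((M : ℝ) ^ 2) 2, ← Real.rpow_mul hNR0.le]
    norm_num
  have hN2 : ((N : ℝ)) = (M : ℝ) ^ 2 := hcast
  refine ⟨fun l => w l + v l, ⟨?_, ?_, ?_, ?_, ?_, ?_, ?_, ?_⟩, ?_⟩
  · rw [contDiffOn_one_iff_derivWithin hI]
    refine ⟨fun t ht => (hd2 t ht).differentiableWithinAt, (hwc.add hvc).congr hd2'⟩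
  · exact fun t ht => (P.E N).add_mem (hEM (hw.mem t ht)) (hvE t).1
  · intro t ht
    refine (htri s₁ _ _ (hEM (hw.mem t ht)) (hvE t).1).trans ?_
    rw [hN2]
    linarith [hw.low t ht, (hvb t ht).1]
  · intro t ht
    rw [hd2' t ht]
    refine (htri s₁ _ _ (hEM (hw'M t ht)) (hvE t).2).trans ?_
    rw [hN2]
    linarith [hw.low_deriv t ht, (hvb t ht).2.2.1]
  · intro t ht
    have h1 := htri S _ _ (hEM (hw.mem t ht)) (hvE t).1
    rw [hN2]
    rw [hpow3] at k8
    linarith [hw.high t ht, (hvb t ht).2.1, hpow2 p hp1]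
  · intro t ht
    rw [hd2' t ht]
    have h1 := htri S _ _ (hEM (hw'M t ht)) (hvE t).2
    rw [hN2]
    rw [hpow3] at k10
    linarith [hw.high_deriv t ht, (hvb t ht).2.2.2, hpow2 q hq1]
  · intro t ht
    rw [hN2, ← er] at ht
    exact hvz t ht
  · intro ε₀ Y hY hεε t ht
    refine (Y s₀).add_mem (hw.invariant ε₀ Y hY hεε t ht) ?_
    exact hvY ε₀ Y hY ((by exact_mod_cast hs₁.trans hS : (s₀ : ℝ≥0∞) ≤ S).trans_lt hSS) hεε
      (hw.invariant ε₀ Y hY hεε) t ht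
  · intro t ht
    rw [hd2' t ht, add_sub_cancel_left, add_sub_cancel_left]
    exact ⟨(hvb t ht).1.trans k7, (hvb t ht).2.2.1.trans k9⟩

/-- A Newton step from `w = 0`, where `D`, `B`, `B'` and `β` vanish. Since `ε ≤ N ^ (-S)` the
residual has order `N ^ (-S)`, but its `λ`-derivative has order one, so the derivative of the
solution is only `O(N ^ μ)`. -/
theorem exists_stage_zero (hF : X.IsTame S' ε' I F) (hI : UniqueDiffOn ℝ I) (hIc : Convex ℝ I)
    (hs₁ : s₀ ≤ s₁) {S : ℝ≥0} (hS : s₁ ≤ S) (hSS : (S : ℝ≥0∞) < S') (hν : 0 < ν)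
    {τ δ σ μ p q : ℝ} {C : ℝ≥0 → ℝ} (hμ : 0 < μ) (hμ' : μ = τ + δ * s₁)
    (hσ₂ : 4 * (μ + ν) ≤ σ)
    (hd : 2 * (2 * μ + ν + 3 + σ) ≤ (S : ℝ) - s₁)
    (hp : p = μ + ν / 2 + 1) (hq : q = 2 * μ + ν + 2 + σ / 2) :
    ∃ K : ℝ, 1 ≤ K ∧ ∀ᶠ N : ℕ in atTop, ∀ ε ∈ Ico 0 ε', ε ≤ (N : ℝ) ^ (-(S : ℝ)) →
      ∃ w : ℝ → X.Sp (s₁ + ν), IsStage P S' I F hs₁ S σ p q (K * (N : ℝ) ^ μ) ε N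
        (goodSet P F I s₁ S τ δ C N ε (fun _ => 0)) w := by
  obtain ⟨c₁, hc₁, htame⟩ := exists_tameFamily_pair P hF hI hs₁ hS hSS
  obtain ⟨c₂, hc₂, hresid⟩ := exists_residual_zero P hF hs₁ hS hSS
  set c := max c₁ c₂ with hc
  have hcc₁ : c₁ ≤ c := le_max_left _ _
  have hcc₂ : c₂ ≤ c := le_max_right _ _
  have hc0 : 0 ≤ c := by linarith
  clear_value c
  have hν' : (0 : ℝ) < ν := hν
  have ha0 : 0 ≤ 2 * (|C s₁| + |C S| + 1) := by positivity
  obtain ⟨K, hK, hnum⟩ := exists_initial_numerics ha0 hc0 hμ hν' hσ₂ hd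
    (sub_le_self (S : ℝ) s₁.2) hq
  -- The extra `N ^ μ ≥ 1` pays for the reserve `1 / N` in `low_deriv`.
  refine ⟨K + 1, by linarith, ?_⟩
  filter_upwards [tendsto_natCast_atTop_atTop.eventually hnum, eventually_ge_atTop 2] with N hN hN2
  intro ε hε hεS
  obtain ⟨α, κ, r, r₁, ρ, H, β'', G₁, eα, eκ, er, er₁, eρ, k1, k2, k3, k4, k5, k6, k7, k8, k9⟩ := hN
  have hN1 : 1 ≤ N := by omega
  have hN2' : (2 : ℝ) ≤ N := by exact_mod_cast hN2
  have hN0 : (0 : ℝ) < N := by linarith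
  have hN2R : (1 : ℝ) ≤ (N : ℝ) ^ 2 := one_le_pow₀ (by linarith only [hN2'])
  have hr0 : 0 < r := by rw [er]; positivity
  have hr₁0 : 0 ≤ r₁ := by rw [er₁]; positivity
  have hκ0 : 0 ≤ κ := by rw [eκ]; positivity
  obtain ⟨hT₁, hT⟩ := htame N hN1 ε hε
  have hκle : c₁ * (N : ℝ) ^ (ν : ℝ) ≤ κ := by
    rw [eκ]
    gcongr
  have hz0 : ∀ s, X.nrm s ((0 : X.Sp (s₁ + ν)) : V) = 0 := fun s => X.nrm_zero s
  obtain ⟨v, v', hv, hvc, hvE, hvz, hvb, hvY⟩ := exists_scale_step P hF hI hIc hs₁ hS hN1 hε hκ0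
    (hT₁.mono (fun _ => rfl) hκle) (hT.mono (fun _ => rfl) hκle) (w := fun _ => 0)
    (w' := fun _ => 0) (fun t ht => (P.E N).zero_mem) (fun t _ => hasDerivWithinAt_const t I 0)
    continuousOn_const (D := 0) (B := 0) (B' := 0)
    (ρ := ρ) (fun t ht => by rw [hz0]; linarith) (fun t ht => (hz0 _).le) (fun t ht => (hz0 _).le)
    (fun t ht => (hz0 _).le) le_rfl le_rfl le_rfl (τ := τ) (δ := δ)
    (C := C) (A := goodSet P F I s₁ S τ δ C N ε (fun _ => 0)) Subset.rfl (α := α) (β := 0)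
    (by rw [eα, hμ']) (by rw [mul_zero]) hr0 (r₁ := r₁) (rS := r₁) (r₁' := c) hr₁0 hr₁0
    hc0
    (fun t ht => by
      obtain ⟨x1, x2, x3⟩ := hresid N hN1 ε hε t ht.1
      simp only [map_zero, add_zero]
      have : c₂ * ε ≤ r₁ := by
        rw [er₁]
        have := hε.1
        gcongr
      exact ⟨x1.trans this, x2.trans this, x3.trans hcc₂⟩)
    k1 eρ k2 (by linarith) (β' := 0) (by simp) k3 k4 k5
  have hd2' : ∀ t ∈ I, derivWithin v I t = v' t := fun t ht => (hv t ht).derivWithin (hI t ht)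
  have hinv : 1 / (N : ℝ) ≤ 1 / 2 := one_div_le_one_div_of_le two_pos hN2'
  have hpow3 : ∀ e : ℝ, (N : ℝ) ^ (2 * e) = ((N : ℝ) ^ 2) ^ e := by
    intro e
    rw [← Real.rpow_natCast (N : ℝ) 2, ← Real.rpow_mul hN0.le]
    norm_num
  refine ⟨v, ⟨?_, ?_, ?_, ?_, ?_, ?_, ?_, ?_⟩⟩
  · rw [contDiffOn_one_iff_derivWithin hI]
    exact ⟨fun t ht => (hv t ht).differentiableWithinAt, hvc.congr hd2'⟩
  · exact fun t ht => (hvE t).1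
  · intro t ht
    linarith [(hvb t ht).1]
  · intro t ht
    rw [hd2' t ht]
    have : 1 ≤ (N : ℝ) ^ μ := Real.one_le_rpow (by linarith) hμ.le
    linarith [(hvb t ht).2.2.1]
  · intro t ht
    have : 1 ≤ ((N : ℝ) ^ 2) ^ p :=
      Real.one_le_rpow hN2R (by rw [hp]; positivity)
    linarith [(hvb t ht).2.1]
  · intro t ht
    rw [hd2' t ht]
    have h0 : 0 ≤ ((N : ℝ) ^ 2) ^ q := by positivity
    rw [hpow3] at k9
    linarith [(hvb t ht).2.2.2]
  · intro t ht
    rw [← er] at ht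
    have := hvz t ht
    rwa [zero_add] at this
  · intro ε₀ Y hY hεε t ht
    exact hvY ε₀ Y hY ((by exact_mod_cast hs₁.trans hS : (s₀ : ℝ≥0∞) ≤ S).trans_lt hSS) hεε
      (fun _ _ => (Y s₀).zero_mem) t ht

end BanachScale

/-! ### Uniform `C¹` limits on an interval -/

section UniformLimits

variable {E : Type*} [NormedAddCommGroup E] {I : Set ℝ}

/-- The mean value inequality on the convex set `I` makes `f m - f n` Lipschitz with a small
constant, uniformly in `m`; letting `m` tend to infinity, `g - f n` is so too, and `f n` is
differentiable at `t`. -/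
theorem hasDerivWithinAt_of_tendstoUniformlyOn [NormedSpace ℝ E] (hIc : Convex ℝ I)
    {f f' : ℕ → ℝ → E}
    {g g' : ℝ → E} (hf : ∀ n, ∀ t ∈ I, HasDerivWithinAt (f n) (f' n t) I t)
    (hg : ∀ t ∈ I, Tendsto (fun n => f n t) atTop (𝓝 (g t)))
    (hg' : TendstoUniformlyOn f' g' atTop I) {t : ℝ} (ht : t ∈ I) :
    HasDerivWithinAt g (g' t) I t := by
  rw [hasDerivWithinAt_iff_isLittleO, Asymptotics.isLittleO_iff]
  intro η hη
  have hη' : 0 < η / 4 := by positivity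
  obtain ⟨n, hn⟩ := (Metric.tendstoUniformlyOn_iff.1 hg' _ hη').exists_forall_of_atTop
  have hlip : ∀ l ∈ I, ‖(g l - f n l) - (g t - f n t)‖ ≤ η / 2 * ‖l - t‖ := by
    intro l hl
    refine le_of_tendsto (((hg l hl).sub_const (f n l)).sub ((hg t ht).sub_const (f n t))).norm ?_
    filter_upwards [eventually_ge_atTop n] with m hm
    refine hIc.norm_image_sub_le_of_norm_hasDerivWithin_le (f := fun l => f m l - f n l)
      (f' := fun l => f' m l - f' n l) (fun l hl => (hf m l hl).sub (hf n l hl)) (fun l hl => ?_)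
      ht hl
    have h1 := hn m hm l hl
    have h2 := hn n le_rfl l hl
    rw [dist_eq_norm] at h1 h2
    have h3 : f' m l - f' n l = (g' l - f' n l) - (g' l - f' m l) := by abel
    rw [h3]
    exact (norm_sub_le _ _).trans (by linarith)
  have hd := (Asymptotics.isLittleO_iff.1 (hasDerivWithinAt_iff_isLittleO.1 (hf n t ht))) hη'
  filter_upwards [hd, self_mem_nhdsWithin] with l hl hlI
  have h1 := hlip l hlI
  have h2 := hn n le_rfl t ht
  rw [dist_eq_norm] at h2
  have e : g l - g t - (l - t) • g' t = ((g l - f n l) - (g t - f n t)) +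
      (f n l - f n t - (l - t) • f' n t) - (l - t) • (g' t - f' n t) := by
    rw [smul_sub]; abel
  rw [e]
  refine (norm_sub_le _ _).trans ?_
  have h3 := norm_add_le ((g l - f n l) - (g t - f n t)) (f n l - f n t - (l - t) • f' n t)
  have h4 : ‖(l - t) • (g' t - f' n t)‖ ≤ ‖l - t‖ * (η / 4) := by
    rw [norm_smul]
    gcongr
  linarith

theorem exists_tendstoUniformlyOn_of_summable [CompleteSpace E] {f : ℕ → ℝ → E} {a : ℕ → ℝ}
    (ha : Summable a) (hf : ∀ n, ∀ t ∈ I, ‖f (n + 1) t - f n t‖ ≤ a n) :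
    ∃ g : ℝ → E, TendstoUniformlyOn f g atTop I := by
  have hd : ∀ t ∈ I, ∀ n, dist (f n t) (f n.succ t) ≤ a n := fun t ht n => by
    rw [dist_comm, dist_eq_norm]; exact hf n t ht
  have hlim : ∀ t, ∃ y, t ∈ I → Tendsto (fun n => f n t) atTop (𝓝 y) := by
    intro t
    by_cases ht : t ∈ I
    · obtain ⟨y, hy⟩ := cauchySeq_tendsto_of_complete (cauchySeq_of_dist_le_of_summable a
        (hd t ht) ha)
      exact ⟨y, fun _ => hy⟩
    · exact ⟨0, fun h => absurd h ht⟩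
  choose g hg using hlim
  refine ⟨g, Metric.tendstoUniformlyOn_iff.2 fun η hη => ?_⟩
  have htail := tendsto_sum_nat_add a
  filter_upwards [htail.eventually_lt_const hη] with n hn t ht
  rw [dist_comm]
  have := dist_le_tsum_of_dist_le_of_tendsto a (hd t ht) ha (hg t ht) n
  refine this.trans_lt ?_
  simpa [add_comm] using hn

theorem exists_contDiffOn_limit [NormedSpace ℝ E] [CompleteSpace E] (hI : UniqueDiffOn ℝ I)
    (hIc : Convex ℝ I) {f : ℕ → ℝ → E} {a : ℕ → ℝ} (ha : Summable a) (hf1 : ∀ n, ContDiffOn ℝ 1 (f n) I)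
    (hf : ∀ n, ∀ t ∈ I, ‖f (n + 1) t - f n t‖ ≤ a n)
    (hf' : ∀ n, ∀ t ∈ I, ‖derivWithin (f (n + 1)) I t - derivWithin (f n) I t‖ ≤ a n) :
    ∃ g : ℝ → E, ContDiffOn ℝ 1 g I ∧ TendstoUniformlyOn f g atTop I ∧
      TendstoUniformlyOn (fun n => derivWithin (f n) I) (derivWithin g I) atTop I := by
  obtain ⟨g, hg⟩ := exists_tendstoUniformlyOn_of_summable ha hf
  obtain ⟨g', hg'⟩ := exists_tendstoUniformlyOn_of_summable (f := fun n => derivWithin (f n) I) ha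
    hf'
  have hd : ∀ t ∈ I, HasDerivWithinAt g (g' t) I t := fun t ht =>
    hasDerivWithinAt_of_tendstoUniformlyOn hIc (fun n t ht =>
      (((hf1 n).differentiableOn one_ne_zero) t ht).hasDerivWithinAt)
      (fun t ht => hg.tendsto_at ht) hg' ht
  have hd' : EqOn (derivWithin g I) g' I := fun t ht => (hd t ht).derivWithin (hI t ht)
  have hc : ContinuousOn g' I := hg'.continuousOn
    (Frequently.of_forall fun n => (hf1 n).continuousOn_derivWithin hI le_rfl)
  refine ⟨g, ?_, hg, hg'.congr_right hd'.symm⟩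
  rw [contDiffOn_one_iff_derivWithin hI]
  exact ⟨fun t ht => (hd t ht).differentiableWithinAt, hc.congr hd'⟩

end UniformLimits

/-! ### The sequence of approximate solutions -/

namespace BanachScale

variable {V : Type*} [AddCommGroup V] [Module ℝ V] {X : BanachScale V} (P : X.Smoothing)
  {s₀ ν s₁ : ℝ≥0} {S' : ℝ≥0∞} {ε' : ℝ} {I : Set ℝ} {F : ℝ → ℝ → X.Sp (s₀ + ν) → X.Sp s₀}

theorem setA_zero {a b s₁ S : ℝ≥0} (F : ℝ → ℝ → X.Sp a → X.Sp b) (τ δ : ℝ) (C : ℝ≥0 → ℝ) (N₀ : ℕ)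
    (ε : ℝ) (u : ℕ → ℝ → V) :
    setA P F I s₁ S τ δ C N₀ ε u 0 =
      goodSet P F I s₁ S τ δ C (N₀ ^ 2 ^ 0) ε (fun _ => 0) := by
  ext t
  constructor
  · intro h
    exact h 0 le_rfl
  · intro h i hi
    obtain rfl : i = 0 := by omega
    exact h

theorem setA_succ {a b s₁ S : ℝ≥0} (F : ℝ → ℝ → X.Sp a → X.Sp b) (τ δ : ℝ) (C : ℝ≥0 → ℝ) (N₀ : ℕ)
    (ε : ℝ) (u : ℕ → ℝ → V) (n : ℕ) :
    setA P F I s₁ S τ δ C N₀ ε u (n + 1) = setA P F I s₁ S τ δ C N₀ ε u n ∩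
      goodSet P F I s₁ S τ δ C (N₀ ^ 2 ^ (n + 1)) ε (u n) := by
  ext t
  constructor
  · intro h
    exact ⟨fun i hi => h i (by omega), h (n + 1) le_rfl⟩
  · rintro ⟨h1, h2⟩ i hi
    rcases Nat.lt_or_ge i (n + 1) with h | h
    · exact h1 i (by omega)
    · obtain rfl : i = n + 1 := by omega
      exact h2

theorem setA_subset {a b s₁ S : ℝ≥0} (F : ℝ → ℝ → X.Sp a → X.Sp b) (τ δ : ℝ) (C : ℝ≥0 → ℝ) (N₀ : ℕ)
    (ε : ℝ) (u : ℕ → ℝ → V) (n : ℕ) : setA P F I s₁ S τ δ C N₀ ε u n ⊆ I :=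
  fun _ h => (h 0 (Nat.zero_le n)).1

/-- The sequence of approximate solutions. -/
theorem exists_stage_sequence (hF : X.IsTame S' ε' I F) (hI : UniqueDiffOn ℝ I)
    (hIc : Convex ℝ I) (hs₁ : s₀ ≤ s₁) {S : ℝ≥0} (hS : s₁ ≤ S) (hSS : (S : ℝ≥0∞) < S')
    (hν : 0 < ν) {τ δ σ μ p q : ℝ} {C : ℝ≥0 → ℝ} (hμ : 0 < μ) (hμ' : μ = τ + δ * s₁)
    (hσ₁ : 2 ≤ σ) (hσ₂ : 4 * (μ + ν) ≤ σ)
    (hd : 2 * (2 * μ + ν + 3 + σ) ≤ (S : ℝ) - s₁) (hδ : δ * ((S : ℝ) - s₁) ≤ σ + 1)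
    (hp : p = μ + ν / 2 + 1) (hq : q = 2 * μ + ν + 2 + σ / 2) :
    ∃ K : ℝ, 1 ≤ K ∧ ∃ Nbar : ℕ, 2 ≤ Nbar ∧ ∀ N₀, Nbar ≤ N₀ → ∀ ε ∈ Ico 0 ε',
      ε ≤ (N₀ : ℝ) ^ (-(S : ℝ)) → ∃ u : ℕ → ℝ → X.Sp (s₁ + ν),
        (∀ n, IsStage P S' I F hs₁ S σ p q (K * (N₀ : ℝ) ^ μ) ε (N₀ ^ 2 ^ n)
          (setA P F I s₁ S τ δ C N₀ ε (fun m l => (u m l : V)) n) (u n)) ∧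
        (∀ n, ∀ t ∈ I, X.nrm s₁ (u (n + 1) t - u n t : X.Sp (s₁ + ν)) ≤
            1 / 2 * ((N₀ ^ 2 ^ (n + 1) : ℕ) : ℝ) ^ (-σ - 1) ∧
          X.nrm s₁ (derivWithin (u (n + 1)) I t - derivWithin (u n) I t : X.Sp (s₁ + ν)) ≤
            ((N₀ ^ 2 ^ (n + 1) : ℕ) : ℝ) ^ (-1 - (ν : ℝ))) ∧
        (ε = 0 → ∀ n t, u n t = 0) := by
  obtain ⟨K, hK, h0⟩ := exists_stage_zero P hF hI hIc hs₁ hS hSS hν (C := C) hμ hμ' hσ₂ hd hp hq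
  have h1 := exists_stage_succ P hF hI hIc hs₁ hS hSS hν (C := C) (K := K) hμ hμ' (by linarith) hσ₁
    hσ₂ hd hδ hp hq
  obtain ⟨n₁, hn₁⟩ := eventually_atTop.1 (h0.and h1)
  refine ⟨K, hK, max n₁ 2, le_max_right _ _, fun N₀ hN₀ ε hε hεS => ?_⟩
  have hN₁ : n₁ ≤ N₀ := (le_max_left _ _).trans hN₀
  have hN₂ : 2 ≤ N₀ := (le_max_right _ _).trans hN₀
  have hle : ∀ n, N₀ ≤ N₀ ^ 2 ^ n := fun n => Nat.le_self_pow (by positivity) N₀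
  have hN₀R : (1 : ℝ) ≤ N₀ := by exact_mod_cast (by omega : 1 ≤ N₀)
  -- At `ε = 0` the zero sequence is taken, which is a stage for every `n` by (F0); this gives
  -- `u_n(0, λ) = 0` directly.
  by_cases hε0 : ε = 0
  · subst hε0
    have hz0 : ∀ s, X.nrm s ((0 : X.Sp (s₁ + ν)) : V) = 0 := fun s => X.nrm_zero s
    refine ⟨fun _ _ => 0, fun n => ?_, fun n t ht => ?_, fun _ _ _ => rfl⟩
    · have hM : (1 : ℝ) ≤ ((N₀ ^ 2 ^ n : ℕ) : ℝ) := by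
        exact_mod_cast (by have := hle n; omega : 1 ≤ N₀ ^ 2 ^ n)
      have hinv : 1 / ((N₀ ^ 2 ^ n : ℕ) : ℝ) ≤ 1 := by
        rw [div_le_one (by linarith)]; exact hM
      have hM2 : (1 : ℝ) ≤ ((N₀ ^ 2 ^ n : ℕ) : ℝ) ^ 2 := one_le_pow₀ hM
      refine ⟨contDiffOn_const, fun t _ => (P.E _).zero_mem, fun t _ => ?_, fun t _ => ?_,
        fun t _ => ?_, fun t _ => ?_, fun t ht => ?_, fun _ Y _ _ t _ => (Y s₀).zero_mem⟩
      · rw [hz0]; linarith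
      · rw [derivWithin_fun_const, Pi.zero_apply, hz0]
        have : 1 * 1 ≤ K * (N₀ : ℝ) ^ μ := by
          gcongr
          exact Real.one_le_rpow hN₀R hμ.le
        linarith
      · rw [hz0]
        have := Real.one_le_rpow hM2 (z := p) (by rw [hp]; positivity)
        linarith
      · rw [derivWithin_fun_const, Pi.zero_apply, hz0]
        positivity
      · rw [map_zero, hF.F0 t ht.1]
        exact map_zero (P.proj _)
    · rw [derivWithin_fun_const, Pi.zero_apply, sub_zero, hz0]
      exact ⟨by positivity, by positivity⟩
  -- The state carries the set of parameters along with the function, because the next good set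
  -- depends on the current function. The sets are identified with `setA` once the whole sequence
  -- exists.
  let Q : ℕ → (ℝ → X.Sp (s₁ + ν)) × Set ℝ → Prop := fun n x =>
    IsStage P S' I F hs₁ S σ p q (K * (N₀ : ℝ) ^ μ) ε (N₀ ^ 2 ^ n) x.2 x.1
  let R : ℕ → (ℝ → X.Sp (s₁ + ν)) × Set ℝ → (ℝ → X.Sp (s₁ + ν)) × Set ℝ → Prop := fun n x y =>
    y.2 = x.2 ∩ goodSet P F I s₁ S τ δ C (N₀ ^ 2 ^ (n + 1)) ε (fun l => (x.1 l : V)) ∧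
    ∀ t ∈ I, X.nrm s₁ (y.1 t - x.1 t : X.Sp (s₁ + ν)) ≤
        1 / 2 * ((N₀ ^ 2 ^ (n + 1) : ℕ) : ℝ) ^ (-σ - 1) ∧
      X.nrm s₁ (derivWithin y.1 I t - derivWithin x.1 I t : X.Sp (s₁ + ν)) ≤
        ((N₀ ^ 2 ^ (n + 1) : ℕ) : ℝ) ^ (-1 - (ν : ℝ))
  have hpow : ∀ n, (N₀ ^ 2 ^ n) ^ 2 = N₀ ^ 2 ^ (n + 1) := fun n => by
    rw [← pow_mul, ← pow_succ]
  have hstep : ∀ n (x : {x // Q n x}), ∃ y : {y // Q (n + 1) y}, R n x.1 y.1 := by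
    rintro n ⟨⟨w, A⟩, hw⟩
    have hLM : K * (N₀ : ℝ) ^ μ ≤ K * ((N₀ ^ 2 ^ n : ℕ) : ℝ) ^ μ := by
      have : (N₀ : ℝ) ≤ ((N₀ ^ 2 ^ n : ℕ) : ℝ) := by exact_mod_cast hle n
      gcongr
    obtain ⟨w₂, hw₂, hb⟩ := (hn₁ (N₀ ^ 2 ^ n) (hN₁.trans (hle n))).2 ε hε
      (hεS.trans (Real.rpow_le_one_of_one_le_of_nonpos hN₀R (neg_nonpos.2 S.2))) _ hLM A w hw
    rw [hpow n] at hw₂ hb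
    exact ⟨⟨(w₂, _), hw₂⟩, rfl, hb⟩
  choose next hnext using hstep
  obtain ⟨w₀, hw₀⟩ := (hn₁ N₀ hN₁).1 ε hε hεS
  have hw₀' : Q 0 (w₀, goodSet P F I s₁ S τ δ C (N₀ ^ 2 ^ 0) ε (fun _ => 0)) := by
    simpa [Q] using hw₀
  let f : ∀ n, {x // Q n x} := fun n => Nat.rec ⟨_, hw₀'⟩ (fun n x => next n x) n
  have hR : ∀ n, R n (f n).1 (f (n + 1)).1 := fun n => hnext n (f n)
  have hA : ∀ n, (f n).1.2 =
      setA P F I s₁ S τ δ C N₀ ε (fun m l => ((f m).1.1 l : V)) n := by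
    intro n
    induction n with
    | zero => rw [setA_zero]; rfl
    | succ n ih => rw [setA_succ, ← ih, (hR n).1]
  refine ⟨fun n => (f n).1.1, fun n => ?_, fun n => (hR n).2, fun h => absurd h hε0⟩
  rw [← hA n]
  exact (f n).2

end BanachScale

/-! ### Passage to the limit -/

namespace BanachScale

variable {V : Type*} [AddCommGroup V] [Module ℝ V] {X : BanachScale V} (P : X.Smoothing)
  {s₀ ν s₁ : ℝ≥0} {S' : ℝ≥0∞} {ε' : ℝ} {I : Set ℝ} {F : ℝ → ℝ → X.Sp (s₀ + ν) → X.Sp s₀}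

/-- `F(w n)` lies in the kernel of `Π^(N n)`, so (P2) between `s₀` and `s₁` gives the factor `N n ^
(-(s₁ - s₀))`. The tame bound at `s₁` involves `‖w n‖_{s₁+ν}`, which stays bounded since `w`
converges in that norm. -/
theorem map_limit_eq_zero (hF : X.IsTame S' ε' I F) (hs₁ : s₀ < s₁) (hs₁S : (s₁ : ℝ≥0∞) < S')
    {ε t : ℝ} (hε : ε ∈ Ico 0 ε') (ht : t ∈ I) {N : ℕ → ℕ} (hN : Tendsto N atTop atTop)
    (hN1 : ∀ n, 1 ≤ N n) {w : ℕ → X.Sp (s₁ + ν)} {w₀ : X.Sp (s₁ + ν)}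
    (hw : Tendsto w atTop (𝓝 w₀)) (hl : ∀ n, X.nrm s₁ (w n) ≤ 1)
    (hz : ∀ n, P.proj (N n) (F ε t (X.inclL (add_le_add_left hs₁.le ν) (w n)) : X.Sp s₀) = 0) :
    F ε t (X.inclL (add_le_add_left hs₁.le ν) w₀) = 0 := by
  set inc := X.inclL (add_le_add_left hs₁.le ν)
  obtain ⟨C₂, hC₂, h2⟩ := P.P2 s₀ (s₁ - s₀)
  rw [add_tsub_cancel_of_le hs₁.le] at h2
  obtain ⟨C, hC, hb⟩ := hF.exists_bound hs₁.le hs₁S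
  have hbound : ∀ n, ‖F ε t (inc (w n))‖ ≤
      C₂ * (N n : ℝ) ^ (-((s₁ - s₀ : ℝ≥0) : ℝ)) * C * (ε + ‖w n‖) := by
    intro n
    have h := (hb (ContinuousLinearMap.id ℝ (X.Sp s₀) - P.projL (hN1 n) s₀ s₀)
      (C₂ * (N n : ℝ) ^ (-((s₁ - s₀ : ℝ≥0) : ℝ))) (by positivity) (fun v hv => h2 _ (hN1 n) v hv)
      ε hε t ht (inc (w n)) (w n).2
      ((X.nrm_mono _ _ hs₁.le _ (X.space_anti _ _ le_self_add (w n).2)).trans (hl n))).1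
    have e : P.projL (hN1 n) s₀ s₀ (F ε t (inc (w n))) = 0 := Subtype.ext (hz n)
    rwa [sub_apply, e, sub_zero, ContinuousLinearMap.id_apply] at h
  have hexp : (0 : ℝ) < ((s₁ - s₀ : ℝ≥0) : ℝ) := by exact_mod_cast tsub_pos_of_lt hs₁
  have hN0 : Tendsto (fun n => (N n : ℝ) ^ (-((s₁ - s₀ : ℝ≥0) : ℝ))) atTop (𝓝 0) :=
    (tendsto_rpow_neg_atTop hexp).comp (tendsto_natCast_atTop_atTop.comp hN)
  have hr : Tendsto (fun n => C₂ * (N n : ℝ) ^ (-((s₁ - s₀ : ℝ≥0) : ℝ)) * C * (ε + ‖w n‖)) atTop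
      (𝓝 0) := by
    simpa using ((hN0.const_mul C₂).mul_const C).mul (hw.norm.const_add ε)
  have hc : Tendsto (fun n => ‖F ε t (inc (w n))‖) atTop (𝓝 ‖F ε t (inc w₀)‖) :=
    (((contDiff_slice (hF.contDiffOn_fixed hε) ht).continuous.comp
      inc.continuous).norm.tendsto w₀).comp hw
  exact norm_le_zero_iff.1 (le_of_tendsto_of_tendsto' hc hr hbound)

theorem two_pow_le_pow_two_pow {N₀ : ℕ} (hN₀ : 2 ≤ N₀) (n : ℕ) : 2 ^ n ≤ N₀ ^ 2 ^ n :=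
  (Nat.pow_le_pow_right two_pos Nat.lt_two_pow_self.le).trans (Nat.pow_le_pow_left hN₀ _)

theorem tendsto_pow_two_pow {N₀ : ℕ} (hN₀ : 2 ≤ N₀) : Tendsto (fun n => N₀ ^ 2 ^ n) atTop atTop :=
  tendsto_atTop_mono (two_pow_le_pow_two_pow hN₀) (tendsto_pow_atTop_atTop_of_one_lt one_lt_two)

theorem rpow_pow_two_pow_le {N₀ : ℕ} (hN₀ : 2 ≤ N₀) {e : ℝ} (he : 1 ≤ e) (n : ℕ) :
    ((N₀ ^ 2 ^ (n + 1) : ℕ) : ℝ) ^ (-e) ≤ 1 / 2 * ((N₀ ^ 2 ^ n : ℕ) : ℝ) ^ (-e) := by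
  have hM : (2 : ℝ) ≤ ((N₀ ^ 2 ^ n : ℕ) : ℝ) := by
    exact_mod_cast hN₀.trans (Nat.le_self_pow (by positivity) N₀)
  have hM0 : (0 : ℝ) < ((N₀ ^ 2 ^ n : ℕ) : ℝ) := by linarith
  have e1 : ((N₀ ^ 2 ^ (n + 1) : ℕ) : ℝ) = ((N₀ ^ 2 ^ n : ℕ) : ℝ) ^ 2 := by
    push_cast
    rw [← pow_mul, ← pow_succ]
  rw [e1, sq, Real.mul_rpow hM0.le hM0.le]
  gcongr
  calc ((N₀ ^ 2 ^ n : ℕ) : ℝ) ^ (-e) ≤ ((N₀ ^ 2 ^ n : ℕ) : ℝ) ^ (-1 : ℝ) :=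
        Real.rpow_le_rpow_of_exponent_le (by linarith) (by linarith)
    _ = 1 / ((N₀ ^ 2 ^ n : ℕ) : ℝ) := by rw [Real.rpow_neg_one, one_div]
    _ ≤ 1 / 2 := one_div_le_one_div_of_le two_pos hM

theorem rpow_pow_two_pow_le_half_pow {N₀ : ℕ} (hN₀ : 2 ≤ N₀) {e : ℝ} (he : e ≤ -1) (n : ℕ) :
    ((N₀ ^ 2 ^ n : ℕ) : ℝ) ^ e ≤ (1 / 2) ^ n := by
  have h2 : (2 : ℝ) ^ n ≤ ((N₀ ^ 2 ^ n : ℕ) : ℝ) := by exact_mod_cast two_pow_le_pow_two_pow hN₀ n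
  have h1 : (1 : ℝ) ≤ 2 ^ n := one_le_pow₀ one_le_two
  calc ((N₀ ^ 2 ^ n : ℕ) : ℝ) ^ e ≤ ((N₀ ^ 2 ^ n : ℕ) : ℝ) ^ (-1 : ℝ) :=
        Real.rpow_le_rpow_of_exponent_le (h1.trans h2) he
    _ ≤ (1 / 2) ^ n := by
      rw [Real.rpow_neg_one, one_div, inv_pow]
      exact inv_anti₀ (by positivity) h2

/-- The bounds on successive corrections at least halve at each step, and the sum of the tail is at
most twice its first term; the factor `1 / 2` in the hypothesis compensates. -/
theorem nrm_limit_sub_le {N₀ : ℕ} (hN₀ : 2 ≤ N₀) {σ : ℝ} (hσ : 0 ≤ σ) {w : ℕ → X.Sp (s₁ + ν)}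
    {w₀ : X.Sp (s₁ + ν)} (hw : Tendsto w atTop (𝓝 w₀))
    (hd : ∀ n, X.nrm s₁ (w (n + 1) - w n : X.Sp (s₁ + ν)) ≤
      1 / 2 * ((N₀ ^ 2 ^ (n + 1) : ℕ) : ℝ) ^ (-σ - 1)) (n : ℕ) :
    X.nrm s₁ (w₀ - w n : X.Sp (s₁ + ν)) ≤ ((N₀ ^ 2 ^ (n + 1) : ℕ) : ℝ) ^ (-σ - 1) := by
  set inc := X.inclL (le_self_add : s₁ ≤ s₁ + ν)
  have hgeom : ∀ m, ((N₀ ^ 2 ^ (m + n + 1) : ℕ) : ℝ) ^ (-σ - 1) ≤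
      ((N₀ ^ 2 ^ (n + 1) : ℕ) : ℝ) ^ (-σ - 1) / 2 ^ m := by
    intro m
    induction m with
    | zero => simp
    | succ m ih =>
      have h := rpow_pow_two_pow_le hN₀ (e := σ + 1) (by linarith) (m + n + 1)
      rw [neg_add'] at h
      rw [show m + 1 + n + 1 = m + n + 1 + 1 by ring]
      calc _ ≤ _ := h
        _ ≤ 1 / 2 * (((N₀ ^ 2 ^ (n + 1) : ℕ) : ℝ) ^ (-σ - 1) / 2 ^ m) := by gcongr
        _ = _ := by rw [pow_succ]; ring
  have hlim : Tendsto (fun m => inc (w (m + n))) atTop (𝓝 (inc w₀)) :=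
    (inc.continuous.tendsto _).comp (hw.comp (tendsto_add_atTop_nat n))
  have h := dist_le_of_le_geometric_two_of_tendsto₀ (f := fun m => inc (w (m + n)))
    (C := ((N₀ ^ 2 ^ (n + 1) : ℕ) : ℝ) ^ (-σ - 1)) (fun m => ?_) hlim
  · rw [dist_comm, dist_eq_norm, ← map_sub, zero_add] at h
    exact h
  · rw [dist_comm, dist_eq_norm, ← map_sub, show m + 1 + n = m + n + 1 by ring]
    have h1 : ‖inc (w (m + n + 1) - w (m + n))‖ ≤ _ := hd (m + n)
    refine h1.trans ?_
    have := hgeom m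
    calc _ ≤ 1 / 2 * (((N₀ ^ 2 ^ (n + 1) : ℕ) : ℝ) ^ (-σ - 1) / 2 ^ m) := by gcongr
      _ = _ := by ring

/-- The differences lie in `E^(N_{n+1})`, so passing to `‖·‖_{s₁+ν}` costs `N_{n+1} ^ ν`. The
exponents `-σ - 1` and `-1 - ν` become at most `-1`, and `N_{n+1} ≥ 2 ^ (n + 1)` makes the series
summable. -/
theorem exists_stage_limit (hI : UniqueDiffOn ℝ I) (hIc : Convex ℝ I) {N₀ : ℕ} (hN₀ : 2 ≤ N₀)
    {σ : ℝ} (hσ : (ν : ℝ) ≤ σ) {u : ℕ → ℝ → X.Sp (s₁ + ν)} (hu : ∀ n, ContDiffOn ℝ 1 (u n) I)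
    (hE : ∀ n, ∀ t ∈ I, (u n t : V) ∈ P.E (N₀ ^ 2 ^ n) ∧
      ((derivWithin (u n) I t : X.Sp (s₁ + ν)) : V) ∈ P.E (N₀ ^ 2 ^ n))
    (hd : ∀ n, ∀ t ∈ I, X.nrm s₁ (u (n + 1) t - u n t : X.Sp (s₁ + ν)) ≤
        1 / 2 * ((N₀ ^ 2 ^ (n + 1) : ℕ) : ℝ) ^ (-σ - 1) ∧
      X.nrm s₁ (derivWithin (u (n + 1)) I t - derivWithin (u n) I t : X.Sp (s₁ + ν)) ≤
        ((N₀ ^ 2 ^ (n + 1) : ℕ) : ℝ) ^ (-1 - (ν : ℝ))) :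
    ∃ g : ℝ → X.Sp (s₁ + ν), ContDiffOn ℝ 1 g I ∧ TendstoUniformlyOn u g atTop I ∧
      TendstoUniformlyOn (fun n => derivWithin (u n) I) (derivWithin g I) atTop I := by
  obtain ⟨C, hC, hb⟩ := exists_smoothing_EB P s₁ ν
  have hpos : ∀ n, 1 ≤ N₀ ^ 2 ^ n := fun n => Nat.one_le_pow _ _ (by omega)
  have hmono : ∀ n, P.E (N₀ ^ 2 ^ n) ≤ P.E (N₀ ^ 2 ^ (n + 1)) := fun n =>
    P.E_mono _ _ (Nat.pow_le_pow_right (by omega) (Nat.pow_le_pow_right two_pos n.le_succ))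
  have key : ∀ n (x : X.Sp (s₁ + ν)) (e : ℝ), (x : V) ∈ P.E (N₀ ^ 2 ^ (n + 1)) →
      X.nrm s₁ x ≤ ((N₀ ^ 2 ^ (n + 1) : ℕ) : ℝ) ^ e → e + ν ≤ -1 →
      ‖x‖ ≤ C * (1 / 2) ^ (n + 1) := by
    intro n x e hx hxe he
    have hM : (0 : ℝ) < ((N₀ ^ 2 ^ (n + 1) : ℕ) : ℝ) := by exact_mod_cast hpos (n + 1)
    calc ‖x‖ ≤ C * ((N₀ ^ 2 ^ (n + 1) : ℕ) : ℝ) ^ (ν : ℝ) * X.nrm s₁ x := hb _ (hpos _) x hx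
      _ ≤ C * ((N₀ ^ 2 ^ (n + 1) : ℕ) : ℝ) ^ (ν : ℝ) * ((N₀ ^ 2 ^ (n + 1) : ℕ) : ℝ) ^ e := by
        gcongr
      _ = C * ((N₀ ^ 2 ^ (n + 1) : ℕ) : ℝ) ^ (e + ν) := by
        rw [mul_assoc, ← Real.rpow_add hM, add_comm (ν : ℝ)]
      _ ≤ C * (1 / 2) ^ (n + 1) := by
        gcongr
        exact rpow_pow_two_pow_le_half_pow hN₀ he (n + 1)
  refine exists_contDiffOn_limit hI hIc (a := fun n => C * (1 / 2) ^ (n + 1)) ?_ hu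
    (fun n t ht => ?_) (fun n t ht => ?_)
  · exact ((summable_nat_add_iff 1).2 summable_geometric_two).mul_left C
  · refine key n _ (-σ - 1) ?_ ((hd n t ht).1.trans ?_) (by linarith)
    · exact (P.E _).sub_mem (hE (n + 1) t ht).1 (hmono n (hE n t ht).1)
    · have : 0 ≤ ((N₀ ^ 2 ^ (n + 1) : ℕ) : ℝ) ^ (-σ - 1) := by positivity
      linarith
  · refine key n _ (-1 - (ν : ℝ)) ?_ (hd n t ht).2 (by linarith)
    exact (P.E _).sub_mem (hE (n + 1) t ht).2 (hmono n (hE n t ht).2)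

end BanachScale

/-! ### The Nash–Moser theorem -/

theorem theorem4p1 {V : Type*} [AddCommGroup V] [Module ℝ V]
    (X : BanachScale V) (P : X.Smoothing)
    (I : Set ℝ) (hI : I.OrdConnected) (hI' : I.Nontrivial)
    (s₀ ν : ℝ≥0) (hν : 0 < ν) (S' : ℝ≥0∞) (ε' : ℝ) (hε' : 0 < ε')
    (F : ℝ → ℝ → X.Sp (s₀ + ν) → X.Sp s₀) (hF : X.IsTame S' ε' I F)
    -- the constants in the definition of the sets `J`
    (C : ℝ≥0 → ℝ)
    (τ δ σ : ℝ) (s₁ S : ℝ≥0) (hτ : 0 < τ) (hδ : 0 < δ) (hδ' : δ < 1 / 4)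
    (hs₁ : s₀ < s₁) (hS : (S : ℝ≥0∞) < S')
    (hσ : max (2 * (τ + δ * s₁) + 3 * ν + 2) (4 * (τ + δ * s₁ + ν)) ≤ σ)
    (hS₁ : 2 * (2 * (τ + δ * s₁) + ν + 3 + σ) ≤ (S : ℝ) - s₁)
    (hS₂ : (S : ℝ) - s₁ ≤ 4 * (σ + 1)) :
    ∃ (c : ℝ) (Nbar : ℕ) (K₀ : ℝ), 0 < c ∧ 0 < Nbar ∧ 0 < K₀ ∧
    ∀ N₀ : ℕ, Nbar ≤ N₀ → ∀ ε₀ : ℝ, 0 < ε₀ → ε₀ ≤ ε' → ε₀ * (N₀ : ℝ) ^ (S : ℝ) ≤ c →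
    ∃ (u : ℝ → ℕ → ℝ → X.Sp (s₁ + ν)) (uinf : ℝ → ℝ → X.Sp (s₁ + ν)),
      (∀ ε ∈ Ico 0 ε₀,
        -- `u_n ∈ C¹(I, E_n)`
        (∀ n, ContDiffOn ℝ 1 (u ε n) I) ∧
        (∀ n, ∀ lam ∈ I, (u ε n lam : V) ∈ P.E (N₀ ^ 2 ^ n) ∧
          ((derivWithin (u ε n) I lam : X.Sp (s₁ + ν)) : V) ∈ P.E (N₀ ^ 2 ^ n)) ∧
        -- (S1)
        (∀ n, ∀ lam ∈ I, u 0 n lam = 0 ∧ X.nrm s₁ (u ε n lam) ≤ 1 ∧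
          X.nrm s₁ (derivWithin (u ε n) I lam : X.Sp (s₁ + ν)) ≤ K₀ * (N₀ : ℝ) ^ (σ / 2)) ∧
        -- (S1) for invariant closed subspaces
        (∀ Y : ℝ≥0 → Submodule ℝ V, BanachScale.IsInvariant P S' ε₀ I F Y →
          ∀ n, ∀ lam ∈ I, ∀ s, (u ε n lam : V) ∈ P.E (N₀ ^ 2 ^ n) ⊓ Y s) ∧
        -- (S2)
        (∀ i, 1 ≤ i → ∀ lam ∈ I,
          X.nrm s₁ (u ε i lam - u ε (i - 1) lam : X.Sp (s₁ + ν)) ≤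
            ((N₀ ^ 2 ^ i : ℕ) : ℝ) ^ (-σ - 1) ∧
          X.nrm s₁ (derivWithin (fun l => u ε i l - u ε (i - 1) l) I lam : X.Sp (s₁ + ν)) ≤
            ((N₀ ^ 2 ^ i : ℕ) : ℝ) ^ (-1 - (ν : ℝ))) ∧
        -- (S3)
        (∀ n, ∀ lam ∈ I ∩ Metric.thickening (((N₀ ^ 2 ^ n : ℕ) : ℝ) ^ (-σ / 2))
            (BanachScale.setA P F I s₁ S τ δ C N₀ ε (fun m l => (u ε m l : V)) n),
          P.proj (N₀ ^ 2 ^ n)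
            (F ε lam (X.incl (add_le_add_left hs₁.le ν) (u ε n lam)) : X.Sp s₀) = 0) ∧
        -- (S4)
        (∀ n, ∀ lam ∈ I,
          1 + X.nrm S (u ε n lam) ≤
            2 * ((N₀ ^ 2 ^ (n + 1) : ℕ) : ℝ) ^ ((τ + δ * s₁) + (ν : ℝ) / 2 + 1) ∧
          X.nrm S (derivWithin (u ε n) I lam : X.Sp (s₁ + ν)) ≤
            2 * ((N₀ ^ 2 ^ (n + 1) : ℕ) : ℝ) ^ (2 * (τ + δ * s₁) + ν + 2 + σ / 2)) ∧
        -- convergence in `C¹(I, X_{s₁+ν})`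
        ContDiffOn ℝ 1 (uinf ε) I ∧
        TendstoUniformlyOn (u ε) (uinf ε) atTop I ∧
        TendstoUniformlyOn (fun n => derivWithin (u ε n) I) (derivWithin (uinf ε) I) atTop I ∧
        -- superexponential rate
        (∀ n, ∀ lam ∈ I, X.nrm s₁ (uinf ε lam - u ε n lam : X.Sp (s₁ + ν)) ≤
          ((N₀ ^ 2 ^ (n + 1) : ℕ) : ℝ) ^ (-σ - 1)) ∧
        -- the limit is a solution on `A_∞`
        (∀ lam ∈ ⋂ n, BanachScale.setA P F I s₁ S τ δ C N₀ ε (fun m l => (u ε m l : V)) n,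
          F ε lam (X.incl (add_le_add_left hs₁.le ν) (uinf ε lam)) = 0) ∧
        -- the limit stays in invariant closed subspaces
        (∀ Y : ℝ≥0 → Submodule ℝ V, BanachScale.IsInvariant P S' ε₀ I F Y →
          ∀ lam ∈ I, (uinf ε lam : V) ∈ Y (s₁ + ν))) ∧
      (∀ lam ∈ I, uinf 0 lam = 0) := by

  have hIu : UniqueDiffOn ℝ I := uniqueDiffOn_of_ordConnected hI hI'
  have hIc : Convex ℝ I := hI.convex
  have hμ : 0 < τ + δ * s₁ := by positivity
  have hν' : (0 : ℝ) < ν := hν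
  have hσ₁ : 2 ≤ σ := by have := (le_max_left _ _).trans hσ; linarith
  have hσ₂ : 4 * (τ + δ * s₁ + ν) ≤ σ := (le_max_right _ _).trans hσ
  have hSs : s₁ ≤ S := by
    rw [← NNReal.coe_le_coe]
    linarith
  have hs₁S : (s₁ : ℝ≥0∞) < S' := (ENNReal.coe_le_coe.2 hSs).trans_lt hS
  -- The upper bound on `S - s₁` and `δ < 1 / 4` limit the loss `N ^ (δ * (S - s₁))` in the tame
  -- inverse.
  have hδS : δ * ((S : ℝ) - s₁) ≤ σ + 1 := by
    have : (0 : ℝ) ≤ (S : ℝ) - s₁ := by rw [sub_nonneg]; exact_mod_cast hSs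
    have : δ * ((S : ℝ) - s₁) ≤ 1 / 4 * ((S : ℝ) - s₁) := by gcongr
    linarith
  obtain ⟨K, hK, Nbar, hNbar, h⟩ := BanachScale.exists_stage_sequence P hF hIu hIc hs₁.le hSs hS hν
    (C := C) hμ rfl hσ₁ hσ₂ hS₁ hδS rfl rfl
  -- With `c = 1` the condition on `ε₀` reads `ε ≤ N₀ ^ (-S)`. The derivative bound `K * N₀ ^ μ` is
  -- stronger than required, as `μ ≤ σ / 2`.
  refine ⟨1, Nbar, K, one_pos, by omega, by linarith, fun N₀ hN₀ ε₀ hε₀ hε₀' hεN => ?_⟩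
  have hN₂ : 2 ≤ N₀ := hNbar.trans hN₀
  have hN₀R : (1 : ℝ) ≤ N₀ := by exact_mod_cast (by omega : 1 ≤ N₀)
  have hN₀0 : (0 : ℝ) < N₀ := by linarith
  have hpos : ∀ n, 1 ≤ N₀ ^ 2 ^ n := fun n => Nat.one_le_pow _ _ (by omega)
  have hsmall : ∀ ε ∈ Ico 0 ε₀, ε ≤ (N₀ : ℝ) ^ (-(S : ℝ)) := by
    intro ε hε
    rw [Real.rpow_neg hN₀0.le, ← one_div, le_div_iff₀ (by positivity)]
    refine le_trans ?_ hεN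
    gcongr
    exact hε.2.le
  have h' : ∀ ε, ∃ u : ℕ → ℝ → X.Sp (s₁ + ν), ε ∈ Ico 0 ε₀ → _ := fun ε => by
    by_cases hε : ε ∈ Ico 0 ε₀
    · obtain ⟨u, hu⟩ := h N₀ hN₀ ε ⟨hε.1, hε.2.trans_le hε₀'⟩ (hsmall ε hε)
      exact ⟨u, fun _ => hu⟩
    · exact ⟨fun _ _ => 0, fun hε' => absurd hε' hε⟩
  choose u hu using h'
  have hE : ∀ ε ∈ Ico 0 ε₀, ∀ n, ∀ t ∈ I, (u ε n t : V) ∈ P.E (N₀ ^ 2 ^ n) ∧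
      ((derivWithin (u ε n) I t : X.Sp (s₁ + ν)) : V) ∈ P.E (N₀ ^ 2 ^ n) := fun ε hε n t ht =>
    have hs := (hu ε hε).1 n
    ⟨hs.mem t ht, P.deriv_mem (hpos n) hIu ht hs.mem
      ((hs.smooth.differentiableOn one_ne_zero) t ht).hasDerivWithinAt⟩
  have hlim : ∀ ε, ∃ g : ℝ → X.Sp (s₁ + ν), ε ∈ Ico 0 ε₀ → ContDiffOn ℝ 1 g I ∧
      TendstoUniformlyOn (u ε) g atTop I ∧
      TendstoUniformlyOn (fun n => derivWithin (u ε n) I) (derivWithin g I) atTop I := fun ε => by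
    by_cases hε : ε ∈ Ico 0 ε₀
    · obtain ⟨g, hg⟩ := BanachScale.exists_stage_limit P hIu hIc hN₂ (σ := σ) (by linarith)
        (fun n => ((hu ε hε).1 n).smooth) (hE ε hε) (hu ε hε).2.1
      exact ⟨g, fun _ => hg⟩
    · exact ⟨fun _ => 0, fun hε' => absurd hε' hε⟩
  choose uinf huinf using hlim
  have h0 : (0 : ℝ) ∈ Ico 0 ε₀ := ⟨le_rfl, hε₀⟩
  have hu0 := (hu 0 h0).2.2 rfl
  have hsq : ∀ n, ((N₀ ^ 2 ^ (n + 1) : ℕ) : ℝ) = ((N₀ ^ 2 ^ n : ℕ) : ℝ) ^ 2 := fun n => by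
    push_cast
    rw [← pow_mul, ← pow_succ]
  have hinv : ∀ n, (0 : ℝ) ≤ 1 / ((N₀ ^ 2 ^ n : ℕ) : ℝ) := fun n => by positivity
  refine ⟨u, uinf, fun ε hε => ?_, fun t ht => ?_⟩
  · obtain ⟨hs, hd, -⟩ := hu ε hε
    obtain ⟨hg, hgu, hgu'⟩ := huinf ε hε
    have hε' : ε ∈ Ico 0 ε' := ⟨hε.1, hε.2.trans_le hε₀'⟩
    have hlow : ∀ n, ∀ t ∈ I, X.nrm s₁ (u ε n t) ≤ 1 := fun n t ht =>
      ((hs n).low t ht).trans (sub_le_self _ (hinv n))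
    refine ⟨fun n => (hs n).smooth, hE ε hε, fun n t ht => ⟨hu0 n t, hlow n t ht, ?_⟩,
      fun Y hY n t ht s => ⟨(hs n).mem t ht, ?_⟩, fun i hi t ht => ?_, fun n => (hs n).zero,
      fun n t ht => ?_, hg, hgu, hgu', fun n t ht => ?_, fun t ht => ?_, fun Y hY t ht => ?_⟩
    · refine ((hs n).low_deriv t ht).trans ((sub_le_self _ (hinv n)).trans ?_)
      gcongr
      linarith
    -- The iteration keeps track of `Y s₀` only; compatibility of the family with the scale gives
    -- every other index.
    · exact hY.mem_iff (P.E_le _ s ((hs n).mem t ht)) ((hs n).invariant ε₀ Y hY hε.2 t ht)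
    · obtain ⟨n, rfl⟩ : ∃ n, i = n + 1 := ⟨i - 1, by omega⟩
      obtain ⟨h1, h2⟩ := hd n t ht
      rw [add_tsub_cancel_right, derivWithin_fun_sub
        (((hs (n + 1)).smooth.differentiableOn one_ne_zero) t ht)
        (((hs n).smooth.differentiableOn one_ne_zero) t ht)]
      refine ⟨h1.trans ?_, h2⟩
      have : 0 ≤ ((N₀ ^ 2 ^ (n + 1) : ℕ) : ℝ) ^ (-σ - 1) := by positivity
      linarith
    · rw [hsq n]
      exact ⟨(hs n).high t ht, (hs n).high_deriv t ht⟩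
    · exact BanachScale.nrm_limit_sub_le hN₂ (by linarith) (hgu.tendsto_at ht)
        (fun m => (hd m t ht).1) n
    · have htA := mem_iInter.1 ht
      have htI : t ∈ I := BanachScale.setA_subset P F τ δ C N₀ ε _ 0 (htA 0)
      refine BanachScale.map_limit_eq_zero P hF hs₁ hs₁S hε' htI
        (BanachScale.tendsto_pow_two_pow hN₂) hpos (hgu.tendsto_at htI) (fun n => hlow n t htI)
        fun n => (hs n).zero t ⟨htI, Metric.self_subset_thickening ?_ _ (htA n)⟩
      have : (0 : ℝ) < ((N₀ ^ 2 ^ n : ℕ) : ℝ) := by exact_mod_cast hpos n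
      positivity
    · exact (hY.closed (s₁ + ν)).mem_of_tendsto (hgu.tendsto_at ht) (Eventually.of_forall fun n =>
        hY.mem_iff (u ε n t).2 ((hs n).invariant ε₀ Y hY hε.2 t ht))
  · have h1 := (huinf 0 h0).2.1.tendsto_at ht
    simp only [hu0] at h1
    exact tendsto_nhds_unique h1 tendsto_const_nhds
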